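/- Let $P=\{p_1,\dots,p_n\}\subset\mathbb R^2$ be a set of $n\ge 1$ distinct points that lie on exactly $h$ horizontal and $v$ vertical lines. A rectilinear Steiner tree for $P$ is a tree whose vertex set is a finite set of points of the plane containing $P$ and whose edges are nondegenerate horizontal or vertical segments; its length is the sum of the $l_1$-lengths of its edges. It is shortest if no rectilinear Steiner tree for $P$ is shorter. The Hanan grid of $P$ is the $h\times v$ grid formed by the horizontal and vertical lines through the points of $P$. Its vertices are the intersections $v_{ij}$ of the $i$-th horizontal line (from bottom to top) with the $j$-th vertical line (from left to right), and its edges are the segments joining neighbouring vertices. (1) There are a program for a real random access machine and a constant $C$ with the following property. For every such $P$, given as $n$ and the coordinates of the points listed from left to right (in order of non-decreasing $x$-coordinate), the program halts after at most $C\,n\,h\,5^h$ steps and outputs, as a list of segments without repetition, the edges of a shortest rectilinear Steiner tree for $P$, all of them edges of the Hanan grid. Here the machine has arrays of natural numbers (with addition, truncated subtraction and comparison) and arrays of reals (with addition, subtraction and comparison), both addressed by natural numbers; memory outside the input is initially zero; each access, operation, comparison, test and assignment costs one step. (2) For every such $P$, consider the following frontier dynamic program on the Hanan grid. A state is a family of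 pairwise disjoint nonempty subsets (the connected components) of the set of rows $\{1,\dots,h\}$; it records which of the $h$ current frontier vertices, one per row, are connected. Rows in no component are frontier vertices of degree zero. Layer $0$ contains only the state in which all degrees are zero, with cost $0$. The grid edges are processed column by column: first the vertical edges of column $1$ from bottom to top, then the horizontal edges from column $1$ to column $2$ from bottom to top, and so on. From each state of a layer, each edge is either not taken (at cost $0$) or taken (at the cost of its length), which gives the states of the next layer. At the horizontal edge $v_{ij}v_{i,j+1}$ the vertex $v_{i,j+1}$ replaces $v_{ij}$ on the frontier. A transition is discarded if it joins two vertices of one component, if a vertex of $P$ leaves the frontier with degree zero, if a component loses its last frontier vertex, or if after the last edge there is not exactly one component or a point of $P$ in the last column has degree zero. Then the least cost of a state of the last layer is the length of a shortest rectilinear Steiner tree for $P$, and some shortest rectilinear Steiner tree for $P$ has all its edges in the Hanan grid. (3) Let $\Omega(h)$ be the set of non-crossing partitions of subsets of $\{1,\dots,h\}$, where non-crossing means that if $a<b<c<d$, $a,c$ lie in the block $A$ and $b,d$ lie in the block $B$, then $A=B$. For every such $P$, all states in all layers of the dynamic program in (2) belong to $\Omega(h)$. (4) $|\Omega(h)|=O(5^h)$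 as a function of $h$; hence every layer has $O(5^h)$ states. -/

import Mathlib

noncomputable section

namespace RST

/-! ### Rectilinear Steiner trees -/

/-- Points of the plane. Lengths are measured by `l1Dist`, never by the metric of the product. -/
abbrev Pt : Type := ℝ × ℝ

def l1Dist (a b : Pt) : ℝ := |a.1 - b.1| + |a.2 - b.2|

/-- The `l₁` length of the segment joining the two points of an unordered pair. -/
def segLength : Sym2 Pt → ℝ :=
  Sym2.lift ⟨l1Dist, fun a b => by
    simp only [l1Dist, abs_sub_comm a.1 b.1, abs_sub_comm a.2 b.2]⟩

/-- A finite geometric graph: finitely many points of the plane, some pairs of which are joined by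
straight segments. -/
structure PlaneGraph where
  verts : Finset Pt
  edges : Finset (Sym2 Pt)

/-- The total length of the segments. -/
def PlaneGraph.length (T : PlaneGraph) : ℝ := ∑ e ∈ T.edges, segLength e

/-- `T` is a rectilinear Steiner tree for `P`: a tree whose vertices are the points of `P` and
finitely many additional (Steiner) points anywhere in the plane, and whose edges are nondegenerate
horizontal or vertical segments. -/
structure IsSteinerTree (P : Finset Pt) (T : PlaneGraph) : Prop where
  terminals : P ⊆ T.verts
  incident : ∀ e ∈ T.edges, ∀ a ∈ e, a ∈ T.verts
  axisParallel : ∀ a b : Pt, s(a, b) ∈ T.edges → a ≠ b ∧ (a.1 = b.1 ∨ a.2 = b.2)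
  isTree : ((SimpleGraph.fromEdgeSet (T.edges : Set (Sym2 Pt))).induce
    (T.verts : Set Pt)).IsTree

/-- `T` is a shortest rectilinear Steiner tree for `P`. -/
def IsShortestSteinerTree (P : Finset Pt) (T : PlaneGraph) : Prop :=
  IsSteinerTree P T ∧ ∀ T' : PlaneGraph, IsSteinerTree P T' → T.length ≤ T'.length

/-! ### The Hanan grid -/

/-- The number `h` of horizontal lines that contain points of `P`. -/
def numRows (P : Finset Pt) : ℕ := (P.image Prod.snd).card

/-- The number `v` of vertical lines that contain points of `P`. -/
def numCols (P : Finset Pt) : ℕ := (P.image Prod.fst).card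

/-- The vertex of the Hanan grid on the `i`-th horizontal line (from bottom to top) and the `j`-th
vertical line (from left to right), for `i < numRows P` and `j < numCols P`, counted from `0`. -/
def gridPt (P : Finset Pt) (i j : ℕ) : Pt :=
  (((P.image Prod.fst).sort (· ≤ ·)).getD j 0, ((P.image Prod.snd).sort (· ≤ ·)).getD i 0)

/-- Edges of the grid graph: `vert i j` joins the grid vertices `(i, j)` and `(i + 1, j)`, and
`horiz i j` joins `(i, j)` and `(i, j + 1)` (row, column). -/
inductive GridEdge where
  | vert (i j : ℕ)
  | horiz (i j : ℕ)

/-- The segment of the Hanan grid that a grid edge stands for. -/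
def GridEdge.seg (P : Finset Pt) : GridEdge → Sym2 Pt
  | .vert i j => s(gridPt P i j, gridPt P (i + 1) j)
  | .horiz i j => s(gridPt P i j, gridPt P i (j + 1))

/-- All edges of the grid with `h` rows and `v` columns, in the order of the dynamic program: the
vertical edges of the first column from bottom to top, then the horizontal edges from the first to
the second column from bottom to top, then the vertical edges of the second column, and so on. -/
def gridEdges (h v : ℕ) : List GridEdge :=
  (List.range v).flatMap fun j =>
    (List.range (h - 1)).map (fun i => GridEdge.vert i j) ++
      if j + 1 < v then (List.range h).map (fun i => GridEdge.horiz i j) else []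

/-- All edges of `T` are edges of the Hanan grid graph of `P`. -/
def InHananGrid (P : Finset Pt) (T : PlaneGraph) : Prop :=
  ∀ s ∈ T.edges, ∃ e ∈ gridEdges (numRows P) (numCols P), e.seg P = s

/-! ### The frontier dynamic program -/

/-- A state: the set of connected components of the `h` frontier vertices (one for each row), each
component given by its set of rows. A row in no component is a frontier vertex of degree zero. -/
abbrev FrontierState : Type := Finset (Finset ℕ)

/-- The rows whose frontier vertex has positive degree. -/
def covered (ω : FrontierState) : Finset ℕ := ω.sup id

/-- No two components cross. -/
def NonCrossing (ω : FrontierState) : Prop :=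
  ∀ A ∈ ω, ∀ B ∈ ω, ∀ a b c d : ℕ, a < b → b < c → c < d →
    a ∈ A → c ∈ A → b ∈ B → d ∈ B → A = B

open Classical in
/-- `Ω(h)`: the non-crossing partitions of subsets of the `h` rows (the remaining rows are those of
degree zero). -/
def stateSpace (h : ℕ) : Finset FrontierState :=
  ((Finset.range h).powerset.powerset).filter fun ω =>
    ∅ ∉ ω ∧ (∀ A ∈ ω, ∀ B ∈ ω, A ≠ B → Disjoint A B) ∧ NonCrossing ω

/-- The components after the frontier vertices of rows `i` and `k` have been joined by an edge. -/
def link (ω : FrontierState) (i k : ℕ) : FrontierState :=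
  insert ({i, k} ∪ (ω.filter fun A => i ∈ A ∨ k ∈ A).sup id)
    (ω.filter fun A => ¬ (i ∈ A ∨ k ∈ A))

/-- The state `ω + tr` that results from taking (`true`) or not taking (`false`) a grid edge. At the
edge `horiz i j` the vertex `(i, j + 1)` replaces `(i, j)` on the frontier. -/
def step (ω : FrontierState) : GridEdge → Bool → FrontierState
  | .vert _ _, false => ω
  | .vert i _, true => link ω i (i + 1)
  | .horiz i _, false => (ω.image fun A => A.erase i).erase ∅
  | .horiz i _, true => if i ∈ covered ω then ω else insert {i} ω

/-- Feasibility of a single transition: no edge joins two vertices of one component; a vertex of `P`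
that leaves the frontier has positive degree; and no component loses its last frontier vertex, as
it could not be connected to the rest any more. -/
def stepOK (P : Finset Pt) (ω : FrontierState) : GridEdge → Bool → Prop
  | .vert _ _, false => True
  | .vert i _, true => ¬ ∃ A ∈ ω, i ∈ A ∧ i + 1 ∈ A
  | .horiz i j, false => (gridPt P i j ∈ P → i ∈ covered ω) ∧ {i} ∉ ω
  | .horiz _ _, true => True

/-- The conditions on a state of the last layer: there is a single component, and all points of `P`
on the last vertical line have positive degree. -/
def finalOK (P : Finset Pt) (ω : FrontierState) : Prop :=
  ω.card = 1 ∧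
    ∀ i < numRows P, gridPt P i (numCols P - 1) ∈ P → i ∈ covered ω

/-- The number of transitions, that is, the index of the last layer. -/
def lastLayer (P : Finset Pt) : ℕ := (gridEdges (numRows P) (numCols P)).length

/-- Transition `tr` at the edge `e` is possible from the state `ω` of layer `l`. -/
def Allowed (P : Finset Pt) (l : ℕ) (e : GridEdge) (ω : FrontierState) (tr : Bool) : Prop :=
  stepOK P ω e tr ∧ (l + 1 = lastLayer P → finalOK P (step ω e tr))

/-- The length that a transition adds. -/
def transCost (P : Finset Pt) (e : GridEdge) : Bool → ℝ
  | false => 0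
  | true => segLength (e.seg P)

open Classical in
/-- The states of layer `l`, reached after the first `l` transitions. -/
def layer (P : Finset Pt) : ℕ → Finset FrontierState
  | 0 => {∅}
  | l + 1 =>
    match (gridEdges (numRows P) (numCols P))[l]? with
    | none => ∅
    | some e =>
      ((layer P l ×ˢ (Finset.univ : Finset Bool)).filter fun q => Allowed P l e q.1 q.2).image
        fun q => step q.1 e q.2

open Classical in
/-- `table P l ω` is the least cost of reaching the state `ω` of layer `l` (`⊤` if `ω` is not
reached). -/
def table (P : Finset Pt) : ℕ → FrontierState → WithTop ℝ
  | 0, ω => if ω = ∅ then 0 else ⊤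
  | l + 1, ω' =>
    match (gridEdges (numRows P) (numCols P))[l]? with
    | none => ⊤
    | some e =>
      ((layer P l ×ˢ (Finset.univ : Finset Bool)).filter fun q =>
          Allowed P l e q.1 q.2 ∧ step q.1 e q.2 = ω').inf
        fun q => table P l q.1 + (transCost P e q.2 : WithTop ℝ)

/-- The value of the dynamic program: the least table entry of the last layer. -/
def dpValue (P : Finset Pt) : WithTop ℝ :=
  (layer P (lastLayer P)).inf (table P (lastLayer P))

/-! ### The machine: a real random access machine

The memory has arrays of natural numbers and arrays of reals, addressed by natural numbers. The
operations on naturals are addition and truncated subtraction, those on reals are addition and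
subtraction; values of either kind can be compared. There is no multiplication, no rounding and no
conversion between the two kinds. Every memory access, operation, comparison, test and assignment
costs one step. -/

structure Mem where
  nat : ℕ → ℕ → ℕ
  real : ℕ → ℕ → ℝ

inductive NExpr where
  | lit (k : ℕ)
  | get (a : ℕ) (i : NExpr)
  | add (x y : NExpr)
  | sub (x y : NExpr)

inductive RExpr where
  | get (a : ℕ) (i : NExpr)
  | add (x y : RExpr)
  | sub (x y : RExpr)

inductive BExpr where
  | ltNat (x y : NExpr)
  | ltReal (x y : RExpr)
  | not (b : BExpr)
  | and (b c : BExpr)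

/-- Programs. Arrays are named by numerals in the program text, cells by computed indices. -/
inductive Prog where
  | skip
  | setNat (a : ℕ) (i : NExpr) (x : NExpr)
  | setReal (a : ℕ) (i : NExpr) (x : RExpr)
  | seq (c d : Prog)
  | ite (b : BExpr) (c d : Prog)
  | loop (b : BExpr) (c : Prog)

def NExpr.eval (m : Mem) : NExpr → ℕ
  | .lit k => k
  | .get a i => m.nat a (i.eval m)
  | .add x y => x.eval m + y.eval m
  | .sub x y => x.eval m - y.eval m

def NExpr.cost : NExpr → ℕ
  | .lit _ => 1
  | .get _ i => i.cost + 1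
  | .add x y => x.cost + y.cost + 1
  | .sub x y => x.cost + y.cost + 1

def RExpr.eval (m : Mem) : RExpr → ℝ
  | .get a i => m.real a (i.eval m)
  | .add x y => x.eval m + y.eval m
  | .sub x y => x.eval m - y.eval m

def RExpr.cost : RExpr → ℕ
  | .get _ i => i.cost + 1
  | .add x y => x.cost + y.cost + 1
  | .sub x y => x.cost + y.cost + 1

def BExpr.eval (m : Mem) : BExpr → Prop
  | .ltNat x y => x.eval m < y.eval m
  | .ltReal x y => x.eval m < y.eval m
  | .not b => ¬ b.eval m
  | .and b c => b.eval m ∧ c.eval m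

def BExpr.cost : BExpr → ℕ
  | .ltNat x y => x.cost + y.cost + 1
  | .ltReal x y => x.cost + y.cost + 1
  | .not b => b.cost + 1
  | .and b c => b.cost + c.cost + 1

def Mem.writeNat (m : Mem) (a i k : ℕ) : Mem :=
  { m with nat := Function.update m.nat a (Function.update (m.nat a) i k) }

def Mem.writeReal (m : Mem) (a i : ℕ) (r : ℝ) : Mem :=
  { m with real := Function.update m.real a (Function.update (m.real a) i r) }

/-- `Exec c m m' t`: started on memory `m`, the program `c` halts after exactly `t` steps with
memory `m'`. -/
inductive Exec : Prog → Mem → Mem → ℕ → Prop where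
  | skip (m : Mem) : Exec .skip m m 1
  | setNat (m : Mem) (a : ℕ) (i x : NExpr) :
      Exec (.setNat a i x) m (m.writeNat a (i.eval m) (x.eval m)) (i.cost + x.cost + 1)
  | setReal (m : Mem) (a : ℕ) (i : NExpr) (x : RExpr) :
      Exec (.setReal a i x) m (m.writeReal a (i.eval m) (x.eval m)) (i.cost + x.cost + 1)
  | seq {c d : Prog} {m m' m'' : Mem} {t t' : ℕ} :
      Exec c m m' t → Exec d m' m'' t' → Exec (.seq c d) m m'' (t + t')
  | iteTrue {b : BExpr} {c d : Prog} {m m' : Mem} {t : ℕ} :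
      b.eval m → Exec c m m' t → Exec (.ite b c d) m m' (b.cost + 1 + t)
  | iteFalse {b : BExpr} {c d : Prog} {m m' : Mem} {t : ℕ} :
      ¬ b.eval m → Exec d m m' t → Exec (.ite b c d) m m' (b.cost + 1 + t)
  | loopDone {b : BExpr} {c : Prog} {m : Mem} :
      ¬ b.eval m → Exec (.loop b c) m m (b.cost + 1)
  | loopStep {b : BExpr} {c : Prog} {m m' m'' : Mem} {t t' : ℕ} :
      b.eval m → Exec c m m' t → Exec (.loop b c) m' m'' t' →
        Exec (.loop b c) m m'' (b.cost + 1 + t + t')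

/-- The machine is deterministic: the result and the running time are determined by the program and
the initial memory. -/
theorem Exec.deterministic {c : Prog} {m m₁ m₂ : Mem} {t₁ t₂ : ℕ}
    (h₁ : Exec c m m₁ t₁) (h₂ : Exec c m m₂ t₂) : m₁ = m₂ ∧ t₁ = t₂ := by
  induction h₁ generalizing m₂ t₂ with
  | skip m => cases h₂; exact ⟨rfl, rfl⟩
  | setNat m a i x => cases h₂; exact ⟨rfl, rfl⟩
  | setReal m a i x => cases h₂; exact ⟨rfl, rfl⟩
  | seq _ _ ih ih' =>
    cases h₂ with
    | seq g g' =>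
      obtain ⟨rfl, rfl⟩ := ih g
      obtain ⟨rfl, rfl⟩ := ih' g'
      exact ⟨rfl, rfl⟩
  | iteTrue hb _ ih =>
    cases h₂ with
    | iteTrue _ g => obtain ⟨rfl, rfl⟩ := ih g; exact ⟨rfl, rfl⟩
    | iteFalse hn _ => exact absurd hb hn
  | iteFalse hb _ ih =>
    cases h₂ with
    | iteTrue hp _ => exact absurd hp hb
    | iteFalse _ g => obtain ⟨rfl, rfl⟩ := ih g; exact ⟨rfl, rfl⟩
  | loopDone hb =>
    cases h₂ with
    | loopDone _ => exact ⟨rfl, rfl⟩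
    | loopStep hp _ _ => exact absurd hp hb
  | loopStep hb _ _ ih ih' =>
    cases h₂ with
    | loopDone hn => exact absurd hb hn
    | loopStep _ g g' =>
      obtain ⟨rfl, rfl⟩ := ih g
      obtain ⟨rfl, rfl⟩ := ih' g'
      exact ⟨rfl, rfl⟩

/-- The initial memory for the points `p 0, …, p (n - 1)`: cell `0` of the natural array `0` holds
`n`, the real arrays `0` and `1` hold the first and the second coordinates; all else is `0`. -/
def inputMem {n : ℕ} (p : Fin n → Pt) : Mem where
  nat a i := if a = 0 ∧ i = 0 then n else 0
  real a i :=
    if hi : i < n then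
      if a = 0 then (p ⟨i, hi⟩).1 else if a = 1 then (p ⟨i, hi⟩).2 else 0
    else 0

/-- The segments written by a program: cell `0` of the natural array `1` holds their number `k`; the
`i`-th of them (`i < k`) joins the points with coordinates in cell `i` of the real arrays `2`, `3`
and `4`, `5`. -/
def outputEdges (m : Mem) : List (Sym2 Pt) :=
  (List.range (m.nat 1 0)).map fun i =>
    s((m.real 2 i, m.real 3 i), (m.real 4 i, m.real 5 i))

/-- The graph with these segments as edges, on the points of `P` and the ends of the segments. -/
def outputGraph (P : Finset Pt) (m : Mem) : PlaneGraph where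
  verts := P ∪ (outputEdges m).toFinset.biUnion fun e => e.toFinset
  edges := (outputEdges m).toFinset

end RST

end

/-! Reduction to the grid. The `l₁` length of a tree splits into a horizontal and a vertical part,
so the two kinds of coordinates can be treated separately. If a coordinate `x₀` is not a grid
coordinate and all vertices on it slide together between the two neighbouring coordinates in use,
the total length is an affine function of the position; hence one of the two neighbours is reached
without an increase. Repeating this yields a retraction onto the coordinates of `P`
(`exists_retraction`). Every edge between the new positions is then replaced by an L-shaped path in
the grid (`exists_isConnecting_of_isSteinerTree`). Conversely, grid edges have positive length, so a
shortest set of grid edges connecting `P` has no cycle and no part away from `P`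
(`IsMinConnecting.isTight`), and is therefore a Steiner tree (`IsTight.isSteinerTree`). What remains
is to minimise over connecting sets of grid edges.

The dynamic program. During the sweep, a state records exactly how the edges chosen so far connect
the frontier vertices (`Describes.step`). An accepted run connects `P`, because no component and no
terminal is left behind (`connects_of_accepts`). A set without superfluous edges is accepted when
its edges are taken one by one (`accepts_of_isTight_aux`). Both minima therefore agree
(`dpValue_eq`).

The number of states. Joining the components of two adjacent rows cannot create a crossing, so all
states are non-crossing (`step_mem_stateSpace`). Such a state is determined by a word with one of
five letters per row: degree zero, only row, first row, intermediate row, or last row of a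
component. Reading the rows upwards, an intermediate or last row belongs to the component opened
most recently among those still open, as in a bracket expression (`IsPartial.label_eq`,
`IsPartial.openTop_succ`, `eq_of_digit_eq`). There are `5 ^ h` words.

The running time. Read in base five, the word is an index below `5 ^ h`. A successor state depends
on the row of the edge but not on its column, so all successors are tabulated once: `h * 5 ^ h`
entries, `O(h)` steps each. Every one of the at most `2 h v` edges then costs `O(1)` per index. The
program computes the costs of best completions from the last layer to the first, so that following
the recorded decisions forward from the empty state produces the tree. As the input is ordered by
`x`, one pass over the points finds the columns; `h + 1` further passes find the rows. With `h ≤ n`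
and `v ≤ n`, everything is `O(n h 5 ^ h)`. -/

noncomputable section

namespace RST

/-! ### Frontier states as partial equivalence relations -/

/-- The frontier vertices of rows `a` and `b` belong to a common component. -/
def SameBlock (ω : FrontierState) (a b : ℕ) : Prop := ∃ A ∈ ω, a ∈ A ∧ b ∈ A

theorem SameBlock.symm {ω : FrontierState} {a b : ℕ} (hab : SameBlock ω a b) :
    SameBlock ω b a := by
  obtain ⟨A, hA, ha, hb⟩ := hab
  exact ⟨A, hA, hb, ha⟩

theorem SameBlock.left {ω : FrontierState} {a b : ℕ} (hab : SameBlock ω a b) :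
    SameBlock ω a a := by
  obtain ⟨A, hA, ha, -⟩ := hab
  exact ⟨A, hA, ha, ha⟩

theorem SameBlock.right {ω : FrontierState} {a b : ℕ} (hab : SameBlock ω a b) :
    SameBlock ω b b := hab.symm.left

theorem mem_covered {ω : FrontierState} {i : ℕ} : i ∈ covered ω ↔ SameBlock ω i i := by
  simp [covered, SameBlock, Finset.mem_sup]

/-- The components are nonempty, pairwise disjoint sets of rows below `h`. -/
structure IsPartial (h : ℕ) (ω : FrontierState) : Prop where
  lt : ∀ A ∈ ω, ∀ a ∈ A, a < h
  nonempty : ∅ ∉ ω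
  disjoint : ∀ A ∈ ω, ∀ B ∈ ω, A ≠ B → Disjoint A B

theorem mem_stateSpace {h : ℕ} {ω : FrontierState} :
    ω ∈ stateSpace h ↔ IsPartial h ω ∧ NonCrossing ω := by
  simp only [stateSpace, Finset.mem_filter, Finset.mem_powerset]
  constructor
  · rintro ⟨h1, h2, h3, h4⟩
    exact ⟨⟨fun A hA a ha => Finset.mem_range.1 (Finset.mem_powerset.1 (h1 hA) ha), h2, h3⟩, h4⟩
  · rintro ⟨⟨h1, h2, h3⟩, h4⟩
    exact ⟨fun A hA => Finset.mem_powerset.2 fun a ha => Finset.mem_range.2 (h1 A hA a ha),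
      h2, h3, h4⟩

namespace IsPartial

variable {h : ℕ} {ω : FrontierState}

theorem eq_of_mem (hω : IsPartial h ω) {A B : Finset ℕ} {a : ℕ} (hA : A ∈ ω) (hB : B ∈ ω)
    (ha : a ∈ A) (hb : a ∈ B) : A = B := by
  by_contra hne
  exact Finset.disjoint_left.1 (hω.disjoint A hA B hB hne) ha hb

theorem trans (hω : IsPartial h ω) {a b c : ℕ} (hab : SameBlock ω a b) (hbc : SameBlock ω b c) :
    SameBlock ω a c := by
  obtain ⟨A, hA, ha, hb⟩ := hab
  obtain ⟨B, hB, hb', hc⟩ := hbc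
  obtain rfl := hω.eq_of_mem hA hB hb hb'
  exact ⟨A, hA, ha, hc⟩

theorem lt_left (hω : IsPartial h ω) {a b : ℕ} (hab : SameBlock ω a b) : a < h := by
  obtain ⟨A, hA, ha, -⟩ := hab
  exact hω.lt A hA a ha

theorem lt_right (hω : IsPartial h ω) {a b : ℕ} (hab : SameBlock ω a b) : b < h :=
  hω.lt_left hab.symm

theorem block_eq (hω : IsPartial h ω) {A : Finset ℕ} {a : ℕ} (hA : A ∈ ω) (ha : a ∈ A) (b : ℕ) :
    b ∈ A ↔ SameBlock ω a b := by
  refine ⟨fun hb => ⟨A, hA, ha, hb⟩, ?_⟩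
  rintro ⟨B, hB, ha', hb⟩
  rwa [hω.eq_of_mem hA hB ha ha']

/-- The state is determined by the relation of being in one component. -/
theorem ext {h' : ℕ} {ω' : FrontierState} (hω : IsPartial h ω) (hω' : IsPartial h' ω')
    (hh : ∀ a b, SameBlock ω a b ↔ SameBlock ω' a b) : ω = ω' := by
  have key : ∀ {h h' : ℕ} {ω ω' : FrontierState}, IsPartial h ω → IsPartial h' ω' →
      (∀ a b, SameBlock ω a b ↔ SameBlock ω' a b) → ω ⊆ ω' := by
    intro h h' ω ω' hω hω' hh A hA
    obtain ⟨a, ha⟩ := Finset.nonempty_iff_ne_empty.2 fun h0 => hω.nonempty (h0 ▸ hA)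
    obtain ⟨B, hB, haB, -⟩ := (hh a a).1 ⟨A, hA, ha, ha⟩
    have : A = B := by
      ext b
      rw [hω.block_eq hA ha, hω'.block_eq hB haB, hh]
    exact this ▸ hB
  exact (key hω hω' hh).antisymm (key hω' hω fun a b => (hh a b).symm)

/-- In this form the condition involves only the relation `SameBlock`, whose behaviour under
transitions is explicit. -/
theorem nonCrossing_iff (hω : IsPartial h ω) : NonCrossing ω ↔
    ∀ a b c d : ℕ, a < b → b < c → c < d → SameBlock ω a c → SameBlock ω b d →
      SameBlock ω a b := by
  constructor
  · rintro hn a b c d hab hbc hcd ⟨A, hA, ha, hc⟩ ⟨B, hB, hb, hd⟩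
    obtain rfl := hn A hA B hB a b c d hab hbc hcd ha hc hb hd
    exact ⟨A, hA, ha, hb⟩
  · intro hn A hA B hB a b c d hab hbc hcd ha hc hb hd
    have := hn a b c d hab hbc hcd ⟨A, hA, ha, hc⟩ ⟨B, hB, hb, hd⟩
    exact hω.eq_of_mem hA hB ((hω.block_eq hA ha b).2 this) hb

theorem singleton_mem_iff (hω : IsPartial h ω) (i : ℕ) :
    {i} ∈ ω ↔ SameBlock ω i i ∧ ∀ k, SameBlock ω i k → k = i := by
  constructor
  · intro hi
    refine ⟨⟨_, hi, by simp, by simp⟩, fun k hk => ?_⟩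
    simpa using (hω.block_eq hi (Finset.mem_singleton_self i) k).2 hk
  · rintro ⟨⟨A, hA, ha, -⟩, hk⟩
    have : A = {i} := by
      ext b
      rw [hω.block_eq hA ha, Finset.mem_singleton]
      refine ⟨hk b, ?_⟩
      rintro rfl
      exact ⟨A, hA, ha, ha⟩
    exact this ▸ hA

theorem card_eq_one_iff (hω : IsPartial h ω) :
    ω.card = 1 ↔ (∃ a, SameBlock ω a a) ∧
      ∀ a b, SameBlock ω a a → SameBlock ω b b → SameBlock ω a b := by
  constructor
  · rw [Finset.card_eq_one]
    rintro ⟨A, rfl⟩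
    obtain ⟨a, ha⟩ := Finset.nonempty_iff_ne_empty.2 fun h0 =>
      hω.nonempty (h0 ▸ Finset.mem_singleton_self A)
    simp only [SameBlock, Finset.mem_singleton, exists_eq_left]
    exact ⟨⟨a, ha, ha⟩, fun a b ha hb => ⟨ha.1, hb.1⟩⟩
  · rintro ⟨⟨a, A, hA, ha, -⟩, hall⟩
    rw [Finset.card_eq_one]
    refine ⟨A, Finset.eq_singleton_iff_unique_mem.2 ⟨hA, fun B hB => ?_⟩⟩
    obtain ⟨b, hb⟩ := Finset.nonempty_iff_ne_empty.2 fun h0 => hω.nonempty (h0 ▸ hB)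
    exact hω.eq_of_mem hB hA hb
      ((hω.block_eq hA ha b).2 (hall a b ⟨A, hA, ha, ha⟩ ⟨B, hB, hb, hb⟩))

end IsPartial

theorem isPartial_empty (h : ℕ) : IsPartial h ∅ := ⟨by simp, by simp, by simp⟩

theorem empty_mem_stateSpace (h : ℕ) : ∅ ∈ stateSpace h :=
  mem_stateSpace.2 ⟨isPartial_empty h, by simp [NonCrossing]⟩

theorem not_sameBlock_empty (a b : ℕ) : ¬ SameBlock ∅ a b := by simp [SameBlock]

/-! ### The transitions in terms of `SameBlock` -/

theorem mem_link_block {ω : FrontierState} {i k a : ℕ} :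
    a ∈ ({i, k} ∪ (ω.filter fun A => i ∈ A ∨ k ∈ A).sup id : Finset ℕ) ↔
      a = i ∨ a = k ∨ SameBlock ω a i ∨ SameBlock ω a k := by
  simp only [SameBlock, Finset.mem_union, Finset.mem_insert, Finset.mem_singleton, Finset.mem_sup,
    Finset.mem_filter, id]
  constructor
  · rintro ((h | h) | ⟨A, ⟨hA, h | h⟩, ha⟩)
    · exact .inl h
    · exact .inr (.inl h)
    · exact .inr (.inr (.inl ⟨A, hA, ha, h⟩))
    · exact .inr (.inr (.inr ⟨A, hA, ha, h⟩))
  · rintro (h | h | ⟨A, hA, ha, h⟩ | ⟨A, hA, ha, h⟩)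
    · exact .inl (.inl h)
    · exact .inl (.inr h)
    · exact .inr ⟨A, ⟨hA, .inl h⟩, ha⟩
    · exact .inr ⟨A, ⟨hA, .inr h⟩, ha⟩

theorem sameBlock_link {ω : FrontierState} {i k a b : ℕ} :
    SameBlock (link ω i k) a b ↔ SameBlock ω a b ∨
      ((a = i ∨ a = k ∨ SameBlock ω a i ∨ SameBlock ω a k) ∧
        (b = i ∨ b = k ∨ SameBlock ω b i ∨ SameBlock ω b k)) := by
  rw [← mem_link_block, ← mem_link_block]
  constructor
  · rintro ⟨A, hA, ha, hb⟩
    rcases Finset.mem_insert.1 hA with rfl | hA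
    · exact .inr ⟨ha, hb⟩
    · exact .inl ⟨A, (Finset.mem_filter.1 hA).1, ha, hb⟩
  · rintro (⟨A, hA, ha, hb⟩ | ⟨ha, hb⟩)
    · by_cases hik : i ∈ A ∨ k ∈ A
      · refine ⟨_, Finset.mem_insert_self _ _, mem_link_block.2 ?_, mem_link_block.2 ?_⟩
        · rcases hik with h | h
          · exact .inr (.inr (.inl ⟨A, hA, ha, h⟩))
          · exact .inr (.inr (.inr ⟨A, hA, ha, h⟩))
        · rcases hik with h | h
          · exact .inr (.inr (.inl ⟨A, hA, hb, h⟩))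
          · exact .inr (.inr (.inr ⟨A, hA, hb, h⟩))
      · exact ⟨A, Finset.mem_insert_of_mem (Finset.mem_filter.2 ⟨hA, hik⟩), ha, hb⟩
    · exact ⟨_, Finset.mem_insert_self _ _, ha, hb⟩

theorem sameBlock_erase {ω : FrontierState} {i j a b : ℕ} :
    SameBlock (step ω (.horiz i j) false) a b ↔ a ≠ i ∧ b ≠ i ∧ SameBlock ω a b := by
  simp only [step, SameBlock, Finset.mem_erase, Finset.mem_image]
  constructor
  · rintro ⟨A, ⟨-, B, hB, rfl⟩, ha, hb⟩
    rw [Finset.mem_erase] at ha hb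
    exact ⟨ha.1, hb.1, B, hB, ha.2, hb.2⟩
  · rintro ⟨ha, hb, A, hA, ha', hb'⟩
    have hm := Finset.mem_erase.2 ⟨ha, ha'⟩
    exact ⟨A.erase i, ⟨Finset.ne_empty_of_mem hm, A, hA, rfl⟩, hm, Finset.mem_erase.2 ⟨hb, hb'⟩⟩

theorem sameBlock_insert {ω : FrontierState} {i j a b : ℕ} :
    SameBlock (step ω (.horiz i j) true) a b ↔ SameBlock ω a b ∨ (a = i ∧ b = i) := by
  simp only [step]
  split_ifs with hi
  · rw [mem_covered] at hi
    constructor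
    · exact .inl
    · rintro (h | ⟨rfl, rfl⟩)
      exacts [h, hi]
  · simp only [SameBlock, Finset.mem_insert, exists_eq_or_imp, Finset.mem_singleton]
    exact or_comm

theorem isPartial_link {h i k : ℕ} {ω : FrontierState} (hω : IsPartial h ω) (hi : i < h)
    (hk : k < h) : IsPartial h (link ω i k) := by
  have hlt : ∀ a, (a = i ∨ a = k ∨ SameBlock ω a i ∨ SameBlock ω a k) → a < h := by
    rintro a (rfl | rfl | h | h)
    exacts [hi, hk, hω.lt_left h, hω.lt_left h]
  have hdis : ∀ B ∈ ω.filter (fun A => ¬ (i ∈ A ∨ k ∈ A)), ∀ a,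
      (a = i ∨ a = k ∨ SameBlock ω a i ∨ SameBlock ω a k) → a ∉ B := by
    intro B hB a ha haB
    obtain ⟨hB, hn⟩ := Finset.mem_filter.1 hB
    rcases ha with rfl | rfl | h | h
    · exact hn (.inl haB)
    · exact hn (.inr haB)
    · exact hn (.inl ((hω.block_eq hB haB _).2 h))
    · exact hn (.inr ((hω.block_eq hB haB _).2 h))
  refine ⟨fun A hA a ha => ?_, fun h0 => ?_, fun A hA B hB hne => ?_⟩
  · rcases Finset.mem_insert.1 hA with rfl | hA
    · exact hlt a (mem_link_block.1 ha)
    · exact hω.lt A (Finset.mem_filter.1 hA).1 a ha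
  · rcases Finset.mem_insert.1 h0 with h0 | h0
    · exact Finset.ne_empty_of_mem (mem_link_block.2 (.inl rfl)) h0.symm
    · exact hω.nonempty (Finset.mem_filter.1 h0).1
  · rcases Finset.mem_insert.1 hA with rfl | hA <;> rcases Finset.mem_insert.1 hB with rfl | hB
    · exact absurd rfl hne
    · exact Finset.disjoint_left.2 fun a ha => hdis B hB a (mem_link_block.1 ha)
    · exact Finset.disjoint_right.2 fun a ha => hdis A hA a (mem_link_block.1 ha)
    · exact hω.disjoint A (Finset.mem_filter.1 hA).1 B (Finset.mem_filter.1 hB).1 hne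

/-- The rows that an edge of the grid touches are below `h`. -/
def GridEdge.RowsLt (h : ℕ) : GridEdge → Prop
  | .vert i _ => i + 1 < h
  | .horiz i _ => i < h

theorem isPartial_step {h : ℕ} {ω : FrontierState} (hω : IsPartial h ω) {e : GridEdge}
    (he : e.RowsLt h) (b : Bool) : IsPartial h (step ω e b) := by
  cases e with
  | vert i j =>
    cases b with
    | false => exact hω
    | true => exact isPartial_link hω (Nat.lt_of_succ_lt he) he
  | horiz i j =>
    cases b with
    | false =>
      refine ⟨fun A hA a ha => ?_, by simp [RST.step], fun A hA B hB hne => ?_⟩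
      · obtain ⟨-, hA⟩ := Finset.mem_erase.1 hA
        obtain ⟨B, hB, rfl⟩ := Finset.mem_image.1 hA
        exact hω.lt B hB a (Finset.mem_of_mem_erase ha)
      · obtain ⟨-, hA⟩ := Finset.mem_erase.1 hA
        obtain ⟨-, hB⟩ := Finset.mem_erase.1 hB
        obtain ⟨A', hA', rfl⟩ := Finset.mem_image.1 hA
        obtain ⟨B', hB', rfl⟩ := Finset.mem_image.1 hB
        have hAB : A' ≠ B' := fun h => hne (h ▸ rfl)
        exact (hω.disjoint A' hA' B' hB' hAB).mono (Finset.erase_subset _ _) (Finset.erase_subset _ _)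
    | true =>
      simp only [RST.step]
      split_ifs with hi
      · exact hω
      · have hi' : ∀ A ∈ ω, i ∉ A := fun A hA hiA => hi (mem_covered.2 ⟨A, hA, hiA, hiA⟩)
        refine ⟨fun A hA a ha => ?_, fun h0 => ?_, fun A hA B hB hne => ?_⟩
        · rcases Finset.mem_insert.1 hA with rfl | hA
          · rw [Finset.mem_singleton.1 ha]; exact he
          · exact hω.lt A hA a ha
        · rcases Finset.mem_insert.1 h0 with h0 | h0
          · exact Finset.singleton_ne_empty i h0.symm
          · exact hω.nonempty h0
        · rcases Finset.mem_insert.1 hA with rfl | hA <;>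
            rcases Finset.mem_insert.1 hB with rfl | hB
          · exact absurd rfl hne
          · exact Finset.disjoint_singleton_left.2 (hi' B hB)
          · exact Finset.disjoint_singleton_right.2 (hi' A hA)
          · exact hω.disjoint A hA B hB hne

/-- Only the linking of rows `i` and `i + 1` needs an argument. These rows are adjacent, so two rows
outside both of them cannot separate one from the other; a crossing with the merged component is
then already a crossing with one of the two old components. -/
theorem step_mem_stateSpace {h : ℕ} {ω : FrontierState} (hω : ω ∈ stateSpace h) {e : GridEdge}
    (he : e.RowsLt h) (b : Bool) : step ω e b ∈ stateSpace h := by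
  obtain ⟨hp, hn⟩ := mem_stateSpace.1 hω
  have hp' := isPartial_step hp he b
  refine mem_stateSpace.2 ⟨hp', hp'.nonCrossing_iff.2 ?_⟩
  rw [hp.nonCrossing_iff] at hn
  cases e with
  | vert i j =>
    cases b with
    | false => exact hn
    | true =>
      intro a b c d hab hbc hcd hac hbd
      simp only [step, sameBlock_link] at hac hbd ⊢
      have T : ∀ {x y z : ℕ}, SameBlock ω x y → SameBlock ω y z → SameBlock ω x z :=
        fun h1 h2 => hp.trans h1 h2
      rcases hac with hac | ⟨ha, hc⟩ <;> rcases hbd with hbd | ⟨hb, hd⟩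
      · exact .inl (hn a b c d hab hbc hcd hac hbd)
      · -- `a, c` in an old block, `b, d` in the linked block
        have key : ∀ r, (r = i ∨ r = i + 1) → SameBlock ω a r → a = i ∨ a = i + 1 ∨
            SameBlock ω a i ∨ SameBlock ω a (i + 1) := by
          rintro r (rfl | rfl) h
          exacts [.inr (.inr (.inl h)), .inr (.inr (.inr h))]
        suffices hs : a = i ∨ a = i + 1 ∨ SameBlock ω a i ∨ SameBlock ω a (i + 1) from
          .inr ⟨hs, hb⟩
        have hb' : ∃ r, (r = i ∨ r = i + 1) ∧ (b = r ∨ SameBlock ω b r) := by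
          rcases hb with h | h | h | h
          exacts [⟨i, .inl rfl, .inl h⟩, ⟨i + 1, .inr rfl, .inl h⟩, ⟨i, .inl rfl, .inr h⟩,
            ⟨i + 1, .inr rfl, .inr h⟩]
        have hd' : ∃ r, (r = i ∨ r = i + 1) ∧ (d = r ∨ SameBlock ω d r) := by
          rcases hd with h | h | h | h
          exacts [⟨i, .inl rfl, .inl h⟩, ⟨i + 1, .inr rfl, .inl h⟩, ⟨i, .inl rfl, .inr h⟩,
            ⟨i + 1, .inr rfl, .inr h⟩]
        -- `b` belongs to the linked row `r` and `d` to the linked row `s`.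
        obtain ⟨r, hr, hbr⟩ := hb'
        obtain ⟨s, hs, hds⟩ := hd'
        -- If `r` is strictly between `a` and `c`, then `s` lies in the closed interval from `a` to
        -- `c`, as it differs from `r` by at most one; unless `s` is an end of the interval, `s, d`
        -- crosses `a, c`. If `r` is outside the interval, `b, r` crosses `a, c`.
        by_cases hin : a ≤ r ∧ r ≤ c
        · -- the end `r` lies between `a` and `c`
          by_cases hra : a = r
          · rcases hr with rfl | rfl
            exacts [.inl hra, .inr (.inl hra)]
          by_cases hrc : c = r
          · exact key r hr (hrc ▸ hac)
          have h1 : a < r := by omega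
          have h2 : r < c := by omega
          by_cases hsc : s = c
          · exact key s hs (hsc ▸ hac)
          have hsc' : s < c := by omega
          by_cases hsa : s = a
          · rcases hs with rfl | rfl
            exacts [.inl hsa.symm, .inr (.inl hsa.symm)]
          have hsa' : a < s := by omega
          rcases hds with rfl | hds
          · omega
          · exact key s hs (hn a s c d hsa' hsc' hcd hac hds.symm)
        · rcases hbr with rfl | hbr
          · omega
          · by_cases hrc : c < r
            · exact key r hr (T (hn a b c r hab hbc hrc hac hbr) hbr)
            · have hra : r < a := by omega
              refine key r hr ?_
              have := hn r a b c hra hab hbc hbr.symm hac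
              exact this.symm
      · have hk : ∀ r, (r = i ∨ r = i + 1) → SameBlock ω b r → (b = i ∨ b = i + 1 ∨
            SameBlock ω b i ∨ SameBlock ω b (i + 1)) := by
          rintro r (rfl | rfl) h
          exacts [.inr (.inr (.inl h)), .inr (.inr (.inr h))]
        suffices hs : b = i ∨ b = i + 1 ∨ SameBlock ω b i ∨ SameBlock ω b (i + 1) from
          .inr ⟨ha, hs⟩
        have ha' : ∃ r, (r = i ∨ r = i + 1) ∧ (a = r ∨ SameBlock ω a r) := by
          rcases ha with h | h | h | h
          exacts [⟨i, .inl rfl, .inl h⟩, ⟨i + 1, .inr rfl, .inl h⟩, ⟨i, .inl rfl, .inr h⟩,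
            ⟨i + 1, .inr rfl, .inr h⟩]
        have hc' : ∃ r, (r = i ∨ r = i + 1) ∧ (c = r ∨ SameBlock ω c r) := by
          rcases hc with h | h | h | h
          exacts [⟨i, .inl rfl, .inl h⟩, ⟨i + 1, .inr rfl, .inl h⟩, ⟨i, .inl rfl, .inr h⟩,
            ⟨i + 1, .inr rfl, .inr h⟩]
        obtain ⟨r, hr, har⟩ := ha'
        obtain ⟨s, hs, hcs⟩ := hc'
        by_cases hrb : r = b
        · rcases hr with rfl | rfl
          exacts [.inl hrb.symm, .inr (.inl hrb.symm)]
        by_cases hrd : r = d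
        · exact hk r hr (hrd ▸ hbd)
        by_cases hsb : s = b
        · rcases hs with rfl | rfl
          exacts [.inl hsb.symm, .inr (.inl hsb.symm)]
        by_cases hsd : s = d
        · exact hk s hs (hsd ▸ hbd)
        -- If `r` is between `b` and `d`, then `a, r` crosses `b, d`. Otherwise `s`, which is at
        -- distance at most one from `r` and is neither `b` nor `d`, is outside as well, and `c, s`
        -- crosses `b, d`.
        by_cases hin : b < r ∧ r < d
        · rcases har with rfl | har
          · omega
          · exact hk r hr (T (hn a b r d hab hin.1 hin.2 har hbd).symm har)
        · have hs' : s < b ∨ d < s := by omega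
          rcases hcs with rfl | hcs
          · omega
          rcases hs' with hs' | hs'
          · exact hk s hs (hn s b c d hs' hbc hcd hcs.symm hbd).symm
          · exact hk s hs (T (hn b c d s hbc hcd hs' hbd hcs) hcs)
      · exact .inr ⟨ha, hb⟩
  | horiz i j =>
    cases b with
    | false =>
      intro a b c d hab hbc hcd hac hbd
      rw [sameBlock_erase] at hac hbd ⊢
      exact ⟨hac.1, hbd.1, hn a b c d hab hbc hcd hac.2.2 hbd.2.2⟩
    | true =>
      intro a b c d hab hbc hcd hac hbd
      rw [sameBlock_insert] at hac hbd ⊢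
      rcases hac with hac | ⟨rfl, rfl⟩ <;> rcases hbd with hbd | ⟨rfl, rfl⟩
      · exact .inl (hn a b c d hab hbc hcd hac hbd)
      all_goals omega

/-! ### The list of grid edges -/

theorem vert_mem_gridEdges {h v i j : ℕ} :
    GridEdge.vert i j ∈ gridEdges h v ↔ i + 1 < h ∧ j < v := by
  simp only [gridEdges, List.mem_flatMap, List.mem_range, List.mem_append, List.mem_map]
  constructor
  · rintro ⟨k, hk, ⟨a, ha, h⟩ | h⟩
    · simp only [GridEdge.vert.injEq] at h
      omega
    · split_ifs at h <;> simp at h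
  · rintro ⟨hi, hj⟩
    exact ⟨j, hj, .inl ⟨i, by omega, rfl⟩⟩

theorem horiz_mem_gridEdges {h v i j : ℕ} :
    GridEdge.horiz i j ∈ gridEdges h v ↔ i < h ∧ j + 1 < v := by
  simp only [gridEdges, List.mem_flatMap, List.mem_range, List.mem_append, List.mem_map]
  constructor
  · rintro ⟨k, hk, ⟨a, ha, h⟩ | h⟩
    · simp at h
    · split_ifs at h with h1
      · simp only [List.mem_map, List.mem_range, GridEdge.horiz.injEq] at h
        obtain ⟨a, ha, rfl, rfl⟩ := h
        exact ⟨ha, h1⟩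
      · simp at h
  · rintro ⟨hi, hj⟩
    refine ⟨j, by omega, .inr ?_⟩
    rw [if_pos hj]
    exact List.mem_map.2 ⟨i, List.mem_range.2 hi, rfl⟩

theorem rowsLt_of_mem_gridEdges {h v : ℕ} {e : GridEdge} (he : e ∈ gridEdges h v) :
    e.RowsLt h := by
  cases e with
  | vert i j => exact (vert_mem_gridEdges.1 he).1
  | horiz i j => exact (horiz_mem_gridEdges.1 he).1

open Classical in
/-- Every state of every layer is a non-crossing partition of a subset of the rows. -/
theorem layer_subset_stateSpace (P : Finset Pt) (l : ℕ) :
    layer P l ⊆ stateSpace (numRows P) := by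
  induction l with
  | zero => simpa [layer] using empty_mem_stateSpace _
  | succ l ih =>
    intro ω hω
    simp only [layer] at hω
    split at hω
    · simp at hω
    · rename_i e he
      obtain ⟨q, hq, rfl⟩ := Finset.mem_image.1 hω
      have hq1 := (Finset.mem_product.1 (Finset.mem_filter.1 hq).1).1
      exact step_mem_stateSpace (ih hq1) (rowsLt_of_mem_gridEdges (List.mem_of_getElem? he)) _

/-! ### Encoding non-crossing states by words over five letters -/

def HasPrev (ω : FrontierState) (k : ℕ) : Prop := ∃ j < k, SameBlock ω j k

def HasNext (ω : FrontierState) (k : ℕ) : Prop := ∃ j, k < j ∧ SameBlock ω k j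

open Classical in
/-- The letter of row `k`: `0` for degree zero, `1` for a component consisting of row `k` only, and
`2`, `3`, `4` for the first, an intermediate and the last row of a component. -/
def digit (ω : FrontierState) (k : ℕ) : ℕ :=
  if SameBlock ω k k then
    if HasPrev ω k then if HasNext ω k then 3 else 4 else if HasNext ω k then 2 else 1
  else 0

open Classical in
/-- One more than the first row of the component of row `k`, and `0` if row `k` has degree zero. -/
def label (ω : FrontierState) (k : ℕ) : ℕ :=
  if SameBlock ω k k then sInf {j | SameBlock ω j k} + 1 else 0

open Classical in
/-- The greatest label of a component with rows below `k` and rows not below `k`, and `0` if there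
is none. -/
def openTop (ω : FrontierState) (k : ℕ) : ℕ :=
  ((Finset.range k).filter fun j => ∃ j', k ≤ j' ∧ SameBlock ω j j').sup (label ω)

theorem digit_lt (ω : FrontierState) (k : ℕ) : digit ω k < 5 := by
  unfold digit; split_ifs <;> omega

theorem digit_ne_zero {ω : FrontierState} {k : ℕ} : digit ω k ≠ 0 ↔ SameBlock ω k k := by
  unfold digit; split_ifs with h1 <;> simp [h1]

theorem label_ne_zero {ω : FrontierState} {k : ℕ} : label ω k ≠ 0 ↔ SameBlock ω k k := by
  unfold label; split_ifs with h1 <;> simp [h1]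

theorem label_le (ω : FrontierState) (k : ℕ) : label ω k ≤ k + 1 := by
  unfold label
  split_ifs with h1
  · have : sInf {j | SameBlock ω j k} ≤ k := Nat.sInf_le h1
    omega
  · omega

theorem label_spec {ω : FrontierState} {k f : ℕ} (hk : label ω k = f + 1) :
    SameBlock ω f k ∧ ∀ j, SameBlock ω j k → f ≤ j := by
  unfold label at hk
  split_ifs at hk with h1
  obtain rfl : sInf {j | SameBlock ω j k} = f := by omega
  exact ⟨Nat.sInf_mem (s := {j | SameBlock ω j k}) ⟨k, h1⟩, fun j hj => Nat.sInf_le hj⟩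

theorem exists_label {ω : FrontierState} {k : ℕ} (hk : SameBlock ω k k) :
    ∃ f, label ω k = f + 1 := Nat.exists_eq_succ_of_ne_zero (label_ne_zero.2 hk)

theorem le_openTop {ω : FrontierState} {j j' k : ℕ} (hj : j < k) (hj' : k ≤ j')
    (hjj : SameBlock ω j j') : label ω j ≤ openTop ω k := by
  classical
  exact Finset.le_sup (f := label ω)
    (Finset.mem_filter.2 ⟨Finset.mem_range.2 hj, j', hj', hjj⟩)

theorem openTop_le_iff {ω : FrontierState} {k x : ℕ} : openTop ω k ≤ x ↔
    ∀ j j', j < k → k ≤ j' → SameBlock ω j j' → label ω j ≤ x := by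
  classical
  simp only [openTop, Finset.sup_le_iff, Finset.mem_filter, Finset.mem_range]
  exact ⟨fun hh j j' h1 h2 h3 => hh j ⟨h1, j', h2, h3⟩, fun hh j ⟨h1, j', h2, h3⟩ => hh j j' h1 h2 h3⟩

namespace IsPartial

variable {h : ℕ} {ω : FrontierState}

theorem label_eq_of_sameBlock (hω : IsPartial h ω) {a b : ℕ} (hab : SameBlock ω a b) :
    label ω a = label ω b := by
  unfold label
  rw [if_pos hab.left, if_pos hab.right]
  have : {j | SameBlock ω j a} = {j | SameBlock ω j b} := by
    ext j
    exact ⟨fun hj => hω.trans hj hab, fun hj => hω.trans hj hab.symm⟩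
  rw [this]

theorem sameBlock_iff_label (hω : IsPartial h ω) {a b : ℕ} :
    SameBlock ω a b ↔ label ω a ≠ 0 ∧ label ω a = label ω b := by
  constructor
  · exact fun hab => ⟨label_ne_zero.2 hab.left, hω.label_eq_of_sameBlock hab⟩
  · rintro ⟨h0, hab⟩
    obtain ⟨f, hf⟩ := exists_label (label_ne_zero.1 h0)
    exact hω.trans (label_spec hf).1.symm (label_spec (hab ▸ hf)).1

/-- A row that is not the first of its component must belong to the open component with the greatest
first row: another open component with a later first row would cross it. Thus labels can be read off
from bottom to top. -/
theorem label_eq (hω : IsPartial h ω) (hn : NonCrossing ω) (k : ℕ) : label ω k =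
    if digit ω k = 0 then 0 else if digit ω k < 3 then k + 1 else openTop ω k := by
  rw [hω.nonCrossing_iff] at hn
  by_cases hk : SameBlock ω k k
  swap
  · rw [if_pos (by_contra fun h => hk (digit_ne_zero.1 h))]
    exact by_contra fun h => hk (label_ne_zero.1 h)
  rw [if_neg (digit_ne_zero.2 hk)]
  obtain ⟨f, hf⟩ := exists_label hk
  obtain ⟨hf1, hf2⟩ := label_spec hf
  by_cases hp : HasPrev ω k
  · rw [if_neg (by unfold digit; split_ifs <;> omega)]
    apply le_antisymm
    · obtain ⟨j, hj, hjk⟩ := hp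
      rw [← hω.label_eq_of_sameBlock hjk]
      exact le_openTop hj le_rfl hjk
    · rw [openTop_le_iff]
      intro j j' hj hj' hjj
      obtain ⟨g, hg⟩ := exists_label hjj.left
      obtain ⟨hg1, hg2⟩ := label_spec hg
      by_contra hlt
      have hgj := hg2 j hjj.left
      have hne : ¬ SameBlock ω f g := fun hfg => by
        have := hω.label_eq_of_sameBlock (hω.trans (hω.trans hf1.symm hfg) hg1)
        omega
      -- Now `f < g ≤ j < k ≤ j'`, where `f, k` and `g, j'` lie in different components; for `k <
      -- j'` they cross.
      rcases hj'.eq_or_lt with rfl | hlt'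
      · have := hω.label_eq_of_sameBlock hjj
        omega
      · exact hne (hn f g k j' (by omega) (by omega) hlt' hf1 (hω.trans hg1 hjj))
  · rw [if_pos (by unfold digit; split_ifs <;> omega)]
    have h1 := hf2 k hk
    have h2 : ¬ f < k := fun hlt => hp ⟨f, hlt, hf1⟩
    omega

/-- This is the stack of open components. When row `k` closes the component with first row `f`, the
components still open are exactly those that were open before `f`: one opened after `f` would have
to end before `k`, and one open at `f` cannot end before `k`. The label of row `k` is `f + 1`,
whence the subtraction of `1`. -/
theorem openTop_succ (hω : IsPartial h ω) (hn : NonCrossing ω) (k : ℕ) : openTop ω (k + 1) =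
    if digit ω k = 2 then k + 1
    else if digit ω k = 4 then openTop ω (label ω k - 1) else openTop ω k := by
  rw [hω.nonCrossing_iff] at hn
  by_cases hp : HasPrev ω k <;> by_cases hx : HasNext ω k
  · -- intermediate row
    have hk : SameBlock ω k k := by
      obtain ⟨j, -, hj⟩ := hp
      exact hj.right
    have hd : digit ω k = 3 := by simp [digit, hp, hx, hk]
    rw [hd, if_neg (by omega), if_neg (by omega)]
    apply le_antisymm
    · rw [openTop_le_iff]
      intro j j' hj hj' hjj
      rcases (Nat.lt_succ_iff.1 hj).eq_or_lt with rfl | hlt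
      · obtain ⟨i, hi, hik⟩ := hp
        rw [← hω.label_eq_of_sameBlock hik]
        exact le_openTop hi le_rfl hik
      · exact le_openTop hlt (by omega) hjj
    · rw [openTop_le_iff]
      intro j j' hj hj' hjj
      rcases hj'.eq_or_lt with rfl | hlt
      · obtain ⟨i, hi, hik⟩ := hx
        exact le_openTop (by omega) (by omega) (hω.trans hjj hik)
      · exact le_openTop (by omega) (by omega) hjj
  · -- last row
    have hk : SameBlock ω k k := by
      obtain ⟨j, -, hj⟩ := hp
      exact hj.right
    have hd : digit ω k = 4 := by simp [digit, hp, hx, hk]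
    rw [hd, if_neg (by omega), if_pos rfl]
    obtain ⟨f, hf⟩ := exists_label hk
    obtain ⟨hf1, hf2⟩ := label_spec hf
    rw [hf, Nat.add_sub_cancel]
    have hfk : f < k := by
      obtain ⟨j, hj, hjk⟩ := hp
      exact (hf2 j hjk).trans_lt hj
    apply le_antisymm
    · rw [openTop_le_iff]
      intro j j' hj hj' hjj
      obtain ⟨g, hg⟩ := exists_label hjj.left
      obtain ⟨hg1, hg2⟩ := label_spec hg
      have hgj := hg2 j hjj.left
      have hjk : j ≠ k := by
        rintro rfl
        exact hx ⟨j', by omega, hjj⟩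
      have hne : ¬ SameBlock ω f g := fun hfg =>
        hx ⟨j', by omega, hω.trans (hω.trans (hω.trans hf1.symm hfg) hg1) hjj⟩
      have h1 : f ≠ g := by
        rintro rfl
        exact hne hf1.left
      have h2 : ¬ f < g := fun hlt =>
        hne (hn f g k j' hlt (by omega) (by omega) hf1 (hω.trans hg1 hjj))
      rw [← hω.label_eq_of_sameBlock hg1]
      exact le_openTop (by omega) (by omega) (hω.trans hg1 hjj)
    · rw [openTop_le_iff]
      intro j j' hj hj' hjj
      have hne : ¬ SameBlock ω j f := fun hjf => by
        have := hf2 j (hω.trans hjf hf1)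
        omega
      have h1 : j' ≠ f := by
        rintro rfl
        exact hne hjj
      have h2 : j' ≠ k := by
        rintro rfl
        have := hf2 j hjj
        omega
      have h3 : ¬ j' < k := fun hlt =>
        hne (hn j f j' k hj (by omega) hlt hjj hf1)
      exact le_openTop (by omega) (by omega) hjj
  · -- first row
    have hk : SameBlock ω k k := by
      obtain ⟨j, -, hj⟩ := hx
      exact hj.left
    have hd : digit ω k = 2 := by simp [digit, hp, hx, hk]
    rw [hd, if_pos rfl]
    apply le_antisymm
    · rw [openTop_le_iff]
      intro j j' hj hj' hjj
      have := label_le ω j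
      omega
    · obtain ⟨j, hj, hkj⟩ := hx
      have h1 := le_openTop (lt_add_one k) hj hkj
      obtain ⟨f, hf⟩ := exists_label hk
      obtain ⟨hf1, hf2⟩ := label_spec hf
      have h2 : ¬ f < k := fun hlt => hp ⟨f, hlt, hf1⟩
      omega
  · have hd : digit ω k ≠ 2 ∧ digit ω k ≠ 4 := by
      unfold digit; split_ifs <;> omega
    rw [if_neg hd.1, if_neg hd.2]
    apply le_antisymm
    · rw [openTop_le_iff]
      intro j j' hj hj' hjj
      rcases (Nat.lt_succ_iff.1 hj).eq_or_lt with rfl | hlt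
      · exact absurd ⟨j', hj', hjj⟩ hx
      · exact le_openTop hlt (by omega) hjj
    · rw [openTop_le_iff]
      intro j j' hj hj' hjj
      rcases hj'.eq_or_lt with rfl | hlt
      · exact absurd ⟨j, hj, hjj⟩ hp
      · exact le_openTop (by omega) (by omega) hjj

theorem digit_eq_zero (hω : IsPartial h ω) {k : ℕ} (hk : h ≤ k) : digit ω k = 0 :=
  by_contra fun h0 => (hω.lt_left (digit_ne_zero.1 h0)).not_ge hk

/-- This lets the program test a single letter to see whether a component would lose its last
frontier vertex. -/
theorem singleton_mem_iff_digit (hω : IsPartial h ω) (i : ℕ) : {i} ∈ ω ↔ digit ω i = 1 := by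
  rw [hω.singleton_mem_iff]
  constructor
  · rintro ⟨hi, hk⟩
    have hp : ¬ HasPrev ω i := fun ⟨j, hj, hij⟩ => hj.ne (hk j hij.symm)
    have hx : ¬ HasNext ω i := fun ⟨j, hj, hij⟩ => hj.ne' (hk j hij)
    simp [digit, hi, hp, hx]
  · intro hd
    have hi : SameBlock ω i i := digit_ne_zero.1 (by omega)
    refine ⟨hi, fun k hk => ?_⟩
    rcases lt_trichotomy k i with hlt | heq | hlt
    · have hp : HasPrev ω i := ⟨k, hlt, hk.symm⟩
      unfold digit at hd
      split_ifs at hd <;> omega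
    · exact heq
    · have hx : HasNext ω i := ⟨k, hlt, hk⟩
      unfold digit at hd
      split_ifs at hd <;> omega

end IsPartial

theorem openTop_zero (ω : FrontierState) : openTop ω 0 = 0 := by simp [openTop]

/-- A non-crossing state is determined by its word. -/
theorem eq_of_digit_eq {h : ℕ} {ω ω' : FrontierState} (hω : ω ∈ stateSpace h)
    (hω' : ω' ∈ stateSpace h) (hd : ∀ k < h, digit ω k = digit ω' k) : ω = ω' := by
  obtain ⟨hp, hn⟩ := mem_stateSpace.1 hω
  obtain ⟨hp', hn'⟩ := mem_stateSpace.1 hω'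
  have hd' : ∀ k, digit ω k = digit ω' k := fun k => by
    rcases lt_or_ge k h with hk | hk
    · exact hd k hk
    · rw [hp.digit_eq_zero hk, hp'.digit_eq_zero hk]
  have key : ∀ k, openTop ω k = openTop ω' k := by
    intro k
    -- Strong induction, since closing a component returns to the value of `openTop` at its first
    -- row, arbitrarily far back.
    induction k using Nat.strong_induction_on with
    | _ k ih =>
      cases k with
      | zero => rw [openTop_zero, openTop_zero]
      | succ k =>
        have hl : label ω k = label ω' k := by
          rw [hp.label_eq hn, hp'.label_eq hn', hd', ih k (Nat.lt_succ_self k)]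
        have hlt : label ω k - 1 < k + 1 := by
          have := label_le ω k
          omega
        rw [hp.openTop_succ hn, hp'.openTop_succ hn', hd', ih k (Nat.lt_succ_self k),
          ih _ hlt, hl]
  have hl : ∀ k, label ω k = label ω' k := fun k => by
    rw [hp.label_eq hn, hp'.label_eq hn', hd', key]
  exact hp.ext hp' fun a b => by rw [hp.sameBlock_iff_label, hp'.sameBlock_iff_label, hl, hl]

theorem card_stateSpace_le (h : ℕ) : (stateSpace h).card ≤ 5 ^ h := by
  have : (stateSpace h).card ≤ (Finset.univ : Finset (Fin h → Fin 5)).card := by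
    refine Finset.card_le_card_of_injOn (fun ω k => ⟨digit ω k, digit_lt ω k⟩)
      (fun _ _ => Finset.mem_coe.2 (Finset.mem_univ _)) ?_
    intro ω hω ω' hω' heq
    refine eq_of_digit_eq hω hω' fun k hk => ?_
    simpa using congrFun heq ⟨k, hk⟩
  simpa using this

/-! ### Labellings of the rows -/

/-- `f` labels the rows so that the components are the rows with a common nonzero label. -/
def IsLabelling (h : ℕ) (ω : FrontierState) (f : ℕ → ℕ) : Prop :=
  ∀ a < h, ∀ b < h, SameBlock ω a b ↔ f a ≠ 0 ∧ f a = f b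

open Classical in
/-- The letter of row `k` in terms of a labelling of the rows. -/
def digitOf (h : ℕ) (f : ℕ → ℕ) (k : ℕ) : ℕ :=
  if f k = 0 then 0
  else if ∃ j < k, f j = f k then if ∃ j, k < j ∧ j < h ∧ f j = f k then 3 else 4
  else if ∃ j, k < j ∧ j < h ∧ f j = f k then 2 else 1

/-- The letters depend only on which rows share a nonzero label. A successor state can therefore be
encoded directly from the changed labels, although these need not be the canonical values `label`.
-/
theorem IsLabelling.digit_eq {h : ℕ} {ω : FrontierState} {f : ℕ → ℕ} (hf : IsLabelling h ω f)
    (hω : IsPartial h ω) {k : ℕ} (hk : k < h) : digit ω k = digitOf h f k := by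
  have h1 : SameBlock ω k k ↔ ¬ f k = 0 := by simpa using hf k hk k hk
  by_cases h0 : f k = 0
  · simp [digit, digitOf, h1, h0]
  have h2 : HasPrev ω k ↔ ∃ j < k, f j = f k := by
    refine exists_congr fun j => and_congr_right fun hj => ?_
    rw [hf j (hj.trans hk) k hk]
    exact ⟨fun h => h.2, fun h => ⟨h ▸ h0, h⟩⟩
  have h3 : HasNext ω k ↔ ∃ j, k < j ∧ j < h ∧ f j = f k := by
    refine exists_congr fun j => and_congr_right fun hj => ?_
    constructor
    · intro hkj
      have hjh := hω.lt_right hkj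
      exact ⟨hjh, ((hf k hk j hjh).1 hkj).2.symm⟩
    · rintro ⟨hjh, hkj⟩
      exact (hf k hk j hjh).2 ⟨h0, hkj.symm⟩
  unfold digit digitOf
  rw [if_pos (h1.2 h0), if_neg h0]
  split_ifs <;> first | rfl | (exfalso; clear h1 hf; simp_all only)

/-- The labels after row `i` has left its component. -/
def relabelErase (i : ℕ) (f : ℕ → ℕ) (k : ℕ) : ℕ := if k = i then 0 else f k

/-- The labels after row `i`, if of degree zero, has become a component. -/
def relabelInsert (i : ℕ) (f : ℕ → ℕ) (k : ℕ) : ℕ := if k = i ∧ f k = 0 then i + 1 else f k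

/-- The labels after rows `i` and `i + 1` have been joined. -/
def relabelLink (i : ℕ) (f : ℕ → ℕ) (k : ℕ) : ℕ :=
  if k = i ∨ k = i + 1 ∨ (f k ≠ 0 ∧ (f k = f i ∨ f k = f (i + 1))) then i + 1 else f k

namespace IsPartial

variable {h : ℕ} {ω : FrontierState}

theorem isLabelling_erase (hω : IsPartial h ω) (i j : ℕ) :
    IsLabelling h (step ω (.horiz i j) false) (relabelErase i (label ω)) := by
  intro a _ b _
  rw [sameBlock_erase, hω.sameBlock_iff_label]
  unfold relabelErase
  by_cases h1 : a = i <;> by_cases h2 : b = i <;> simp [h1, h2]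

/-- A label is one more than the first row of its component, so `i + 1` is in use only if row `i`
itself carries it. Hence `i + 1` is a safe label for a new component at row `i` and for the
component that results from linking rows `i` and `i + 1`. -/
theorem label_eq_succ (hω : IsPartial h ω) {i k : ℕ} (hk : label ω k = i + 1) :
    label ω i = i + 1 := by
  rw [hω.label_eq_of_sameBlock (label_spec hk).1, hk]

theorem isLabelling_insert (hω : IsPartial h ω) (i j : ℕ) :
    IsLabelling h (step ω (.horiz i j) true) (relabelInsert i (label ω)) := by
  intro a _ b _
  rw [sameBlock_insert, hω.sameBlock_iff_label]
  unfold relabelInsert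
  have ha := @label_eq_succ h ω hω i a
  have hb := @label_eq_succ h ω hω i b
  by_cases h1 : a = i
  · by_cases h2 : b = i
    · subst h1; subst h2
      by_cases h3 : label ω b = 0 <;> simp [h3]
    · subst h1
      by_cases h3 : label ω a = 0
      · simp only [h3, h2, and_false, false_and, if_false, and_self, if_true]
        constructor
        · rintro (h | h)
          · exact absurd rfl h.1
          · exact h.elim
        · rintro ⟨-, h⟩
          have := hb h.symm
          omega
      · simp [h2, h3]
  · by_cases h2 : b = i
    · subst h2
      by_cases h3 : label ω b = 0
      · simp only [h3, h1, false_and, if_false, and_self, if_true]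
        constructor
        · rintro (h | h)
          · exact absurd h.2 h.1
          · exact h.elim
        · rintro ⟨-, h⟩
          have := ha h
          omega
      · simp [h1, h3]
    · simp [h1, h2]

theorem isLabelling_link (hω : IsPartial h ω) (i j : ℕ) :
    IsLabelling h (step ω (.vert i j) true) (relabelLink i (label ω)) := by
  intro a _ b _
  have hJ : ∀ a, (a = i ∨ a = i + 1 ∨ SameBlock ω a i ∨ SameBlock ω a (i + 1)) ↔
      (a = i ∨ a = i + 1 ∨
        (label ω a ≠ 0 ∧ (label ω a = label ω i ∨ label ω a = label ω (i + 1)))) := by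
    intro a
    rw [hω.sameBlock_iff_label, hω.sameBlock_iff_label]
    tauto
  have hne : ∀ a, ¬ (a = i ∨ a = i + 1 ∨
        (label ω a ≠ 0 ∧ (label ω a = label ω i ∨ label ω a = label ω (i + 1)))) →
      label ω a ≠ i + 1 := by
    intro a ha h1
    have := hω.label_eq_succ h1
    exact ha (.inr (.inr ⟨by omega, .inl (by omega)⟩))
  simp only [step, sameBlock_link]
  rw [hJ, hJ]
  unfold relabelLink
  split_ifs with h1 h2 h2
  · simp only [h1, h2]; simp
  · have h3 := hne b h2
    have h4 : ¬ SameBlock ω a b := fun hab => by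
      rw [← hJ] at h1 h2
      have hba := hab.symm
      rcases h1 with rfl | rfl | h1 | h1
      · exact h2 (.inr (.inr (.inl hba)))
      · exact h2 (.inr (.inr (.inr hba)))
      · exact h2 (.inr (.inr (.inl (hω.trans hba h1))))
      · exact h2 (.inr (.inr (.inr (hω.trans hba h1))))
    simp only [h4, h2, and_false, or_false, false_iff, not_and]
    intro _ h; exact h3 h.symm
  · have h3 := hne a h1
    have h4 : ¬ SameBlock ω a b := fun hab => by
      rw [← hJ] at h1 h2
      rcases h2 with rfl | rfl | h2 | h2
      · exact h1 (.inr (.inr (.inl hab)))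
      · exact h1 (.inr (.inr (.inr hab)))
      · exact h1 (.inr (.inr (.inl (hω.trans hab h2))))
      · exact h1 (.inr (.inr (.inr (hω.trans hab h2))))
    simp only [h4, h1, false_and, or_false, false_iff, not_and]
    intro _ h; exact h3 h
  · simp only [h1, false_and, or_false]
    exact hω.sameBlock_iff_label

end IsPartial

/-! ### The code of a word -/

/-- The number with base-five digits `d 0, …, d (k - 1)`. -/
def horner (d : ℕ → ℕ) : ℕ → ℕ
  | 0 => 0
  | k + 1 => 5 * horner d k + d k

theorem horner_lt {d : ℕ → ℕ} (hd : ∀ k, d k < 5) (k : ℕ) : horner d k < 5 ^ k := by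
  induction k with
  | zero => simp [horner]
  | succ k ih =>
    have := hd k
    rw [horner, pow_succ]
    omega

theorem horner_congr {d d' : ℕ → ℕ} {k : ℕ} (hd : ∀ j < k, d j = d' j) :
    horner d k = horner d' k := by
  induction k with
  | zero => rfl
  | succ k ih =>
    rw [horner, horner, ih fun j hj => hd j (by omega), hd k (by omega)]

/-- The number of the state in the tables of the algorithm. -/
def code (h : ℕ) (ω : FrontierState) : ℕ := horner (digit ω) h

theorem code_lt (h : ℕ) (ω : FrontierState) : code h ω < 5 ^ h := horner_lt (digit_lt ω) h

theorem IsLabelling.code_eq {h : ℕ} {ω : FrontierState} {f : ℕ → ℕ} (hf : IsLabelling h ω f)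
    (hω : IsPartial h ω) : code h ω = horner (digitOf h f) h :=
  horner_congr fun _ hj => hf.digit_eq hω hj

/-- The trace through the tables thus starts at the number `0`. -/
theorem code_empty (h : ℕ) : code h ∅ = 0 := by
  have : ∀ k, horner (digit ∅) k = 0 := fun k => by
    induction k with
    | zero => rfl
    | succ k ih =>
      have : digit ∅ k = 0 := by
        by_contra h0
        exact not_sameBlock_empty _ _ (digit_ne_zero.1 h0)
      rw [horner, ih, this]
  exact this h

/-! ### Connectivity in the grid graph -/

/-- The lower or left end of a grid edge, as (row, column). -/
def GridEdge.src : GridEdge → ℕ × ℕ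
  | .vert i j => (i, j)
  | .horiz i j => (i, j)

/-- The upper or right end of a grid edge, as (row, column). -/
def GridEdge.tgt : GridEdge → ℕ × ℕ
  | .vert i j => (i + 1, j)
  | .horiz i j => (i, j + 1)

/-- Two grid vertices are connected by edges of `S`. -/
def Conn (S : Set GridEdge) : ℕ × ℕ → ℕ × ℕ → Prop :=
  Relation.EqvGen fun u w => ∃ e ∈ S, u = e.src ∧ w = e.tgt

/-- The grid vertex `u` is an end of an edge of `S`. -/
def Touched (S : Set GridEdge) (u : ℕ × ℕ) : Prop := ∃ e ∈ S, u = e.src ∨ u = e.tgt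

theorem Conn.refl (S : Set GridEdge) (u : ℕ × ℕ) : Conn S u u := Relation.EqvGen.refl u

theorem Conn.symm {S : Set GridEdge} {u w : ℕ × ℕ} (h : Conn S u w) : Conn S w u :=
  Relation.EqvGen.symm _ _ h

theorem Conn.trans {S : Set GridEdge} {u w x : ℕ × ℕ} (h : Conn S u w) (h' : Conn S w x) :
    Conn S u x := Relation.EqvGen.trans _ _ _ h h'

theorem Conn.of_mem {S : Set GridEdge} {e : GridEdge} (he : e ∈ S) : Conn S e.src e.tgt :=
  Relation.EqvGen.rel _ _ ⟨e, he, rfl, rfl⟩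

/-- An equivalence relation that relates the ends of every edge contains `Conn`. -/
theorem Conn.lift {S : Set GridEdge} {r : ℕ × ℕ → ℕ × ℕ → Prop} (hr : Equivalence r)
    (he : ∀ e ∈ S, r e.src e.tgt) {u w : ℕ × ℕ} (h : Conn S u w) : r u w := by
  induction h with
  | rel u w h =>
    obtain ⟨e, heS, rfl, rfl⟩ := h
    exact he e heS
  | refl u => exact hr.refl u
  | symm u w _ ih => exact hr.symm ih
  | trans u w x _ _ ih ih' => exact hr.trans ih ih'

theorem conn_equivalence (S : Set GridEdge) : Equivalence (Conn S) :=
  ⟨Conn.refl S, Conn.symm, Conn.trans⟩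

theorem Conn.mono {S S' : Set GridEdge} (hS : S ⊆ S') {u w : ℕ × ℕ} (h : Conn S u w) :
    Conn S' u w :=
  h.lift (conn_equivalence S') fun _ he => Conn.of_mem (hS he)

theorem Touched.mono {S S' : Set GridEdge} (hS : S ⊆ S') {u : ℕ × ℕ} (h : Touched S u) :
    Touched S' u := by
  obtain ⟨e, he, h⟩ := h
  exact ⟨e, hS he, h⟩

/-- A vertex that is not an end of an edge is isolated, and `Conn` relates it only to itself. -/
theorem Conn.eq_or_touched {S : Set GridEdge} {u w : ℕ × ℕ} (h : Conn S u w) :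
    u = w ∨ (Touched S u ∧ Touched S w) := by
  refine h.lift (r := fun u w => u = w ∨ (Touched S u ∧ Touched S w)) ⟨fun _ => .inl rfl, ?_, ?_⟩
    fun e he => .inr ⟨⟨e, he, .inl rfl⟩, ⟨e, he, .inr rfl⟩⟩
  · rintro u w (rfl | h)
    exacts [.inl rfl, .inr h.symm]
  · rintro u w x (rfl | h) (rfl | h')
    exacts [.inl rfl, .inr h', .inr h, .inr ⟨h.1, h'.2⟩]

/-- A set of vertices that no edge leaves is a union of components. -/
theorem Conn.exists_of_closed {S : Set GridEdge} {K : ℕ × ℕ → Prop}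
    (hK : ∀ e ∈ S, K e.src ↔ K e.tgt) {u w : ℕ × ℕ} (h : Conn S u w) : K u ↔ K w :=
  h.lift (r := fun u w => (K u ↔ K w))
    ⟨fun _ => Iff.rfl, fun h => h.symm, fun h h' => h.trans h'⟩ hK

/-- A new edge merges the components of its two ends and changes nothing else: the right-hand side
is already an equivalence relation. -/
theorem conn_insert {S : Set GridEdge} {e : GridEdge} {u w : ℕ × ℕ} :
    Conn (insert e S) u w ↔ Conn S u w ∨
      ((Conn S u e.src ∨ Conn S u e.tgt) ∧ (Conn S w e.src ∨ Conn S w e.tgt)) := by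
  constructor
  · intro h
    refine h.lift (r := fun u w => Conn S u w ∨
      ((Conn S u e.src ∨ Conn S u e.tgt) ∧ (Conn S w e.src ∨ Conn S w e.tgt)))
      ⟨fun u => .inl (Conn.refl S u), ?_, ?_⟩ ?_
    · rintro u w (h | h)
      exacts [.inl h.symm, .inr h.symm]
    · rintro u w x (h | h) (h' | h')
      · exact .inl (h.trans h')
      · exact .inr ⟨h'.1.imp h.trans h.trans, h'.2⟩
      · exact .inr ⟨h.1, h.2.imp h'.symm.trans h'.symm.trans⟩
      · exact .inr ⟨h.1, h'.2⟩
    · rintro e' (rfl | he')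
      · exact .inr ⟨.inl (Conn.refl _ _), .inr (Conn.refl _ _)⟩
      · exact .inl (Conn.of_mem he')
  · have hm : ∀ {u w}, Conn S u w → Conn (insert e S) u w :=
      fun h => h.mono (Set.subset_insert e S)
    have he : Conn (insert e S) e.src e.tgt := Conn.of_mem (Set.mem_insert e S)
    rintro (h | ⟨h | h, h' | h'⟩)
    · exact hm h
    · exact (hm h).trans (hm h').symm
    · exact ((hm h).trans he).trans (hm h').symm
    · exact ((hm h).trans he.symm).trans (hm h').symm
    · exact (hm h).trans (hm h').symm

theorem touched_insert {S : Set GridEdge} {e : GridEdge} {u : ℕ × ℕ} :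
    Touched (insert e S) u ↔ Touched S u ∨ u = e.src ∨ u = e.tgt := by
  simp only [Touched, Set.mem_insert_iff, exists_eq_or_imp]
  exact or_comm

/-! ### The frontier -/

/-- The columns of the frontier vertices after an edge has been processed. -/
def advance (f : ℕ → ℕ) : GridEdge → ℕ → ℕ
  | .vert _ _ => f
  | .horiz i j => Function.update f i (j + 1)

/-- The edge starts at the frontier. -/
def Ready (f : ℕ → ℕ) : GridEdge → Prop
  | .vert i j => f i = j ∧ f (i + 1) = j
  | .horiz i j => f i = j

/-- Processing the grid edges `es` one by one moves the frontier from `f` to `g`. -/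
def Sched (h v : ℕ) (g : ℕ → ℕ) : (ℕ → ℕ) → List GridEdge → Prop
  | f, [] => f = g
  | f, e :: es => e ∈ gridEdges h v ∧ Ready f e ∧ Sched h v g (advance f e) es

theorem Sched.append {h v : ℕ} {f g k : ℕ → ℕ} {a b : List GridEdge} (ha : Sched h v g f a)
    (hb : Sched h v k g b) : Sched h v k f (a ++ b) := by
  induction a generalizing f with
  | nil =>
    obtain rfl : f = g := ha
    exact hb
  | cons e a ih => exact ⟨ha.1, ha.2.1, ih ha.2.2⟩

/-- The frontier that consists of the vertices of column `j`. -/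
def columnFrontier (h j i : ℕ) : ℕ := if i < h then j else 0

theorem sched_gridEdges {h v : ℕ} (hv : 1 ≤ v) :
    Sched h v (columnFrontier h (v - 1)) (columnFrontier h 0) (gridEdges h v) := by
  have hvert : ∀ j < v, ∀ m ≤ h - 1, Sched h v (columnFrontier h j) (columnFrontier h j)
      ((List.range m).map fun i => GridEdge.vert i j) := by
    intro j hj m hm
    induction m with
    | zero => simp [Sched]
    | succ m ih =>
      rw [List.range_succ, List.map_append]
      refine (ih (by omega)).append ⟨vert_mem_gridEdges.2 (by omega), ?_, rfl⟩
      simp only [Ready, columnFrontier]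
      constructor <;> rw [if_pos (by omega)]
  have hhoriz : ∀ j, j + 1 < v → ∀ m ≤ h,
      Sched h v (fun i => if i < m then j + 1 else columnFrontier h j i) (columnFrontier h j)
        ((List.range m).map fun i => GridEdge.horiz i j) := by
    intro j hj m hm
    induction m with
    | zero => simp [Sched]
    | succ m ih =>
      rw [List.range_succ, List.map_append]
      refine (ih (by omega)).append ⟨horiz_mem_gridEdges.2 (by omega), ?_, ?_⟩
      · simp only [Ready, columnFrontier]
        rw [if_neg (by omega), if_pos (by omega)]
      · funext i
        simp only [advance, Function.update_apply]
        split_ifs <;> first | rfl | omega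
  -- The minimum accounts for the last column, from which no horizontal edges start and where the
  -- frontier stays.
  have hcol : ∀ m ≤ v, Sched h v (columnFrontier h (min m (v - 1))) (columnFrontier h 0)
      ((List.range m).flatMap fun j =>
        (List.range (h - 1)).map (fun i => GridEdge.vert i j) ++
          if j + 1 < v then (List.range h).map (fun i => GridEdge.horiz i j) else []) := by
    intro m hm
    induction m with
    | zero => simp [Sched]
    | succ m ih =>
      rw [List.range_succ, List.flatMap_append]
      refine (ih (by omega)).append ?_
      rw [show min m (v - 1) = m by omega]
      simp only [List.flatMap_cons, List.flatMap_nil, List.append_nil]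
      refine (hvert m (by omega) _ le_rfl).append ?_
      split_ifs with hm'
      · have := hhoriz m hm' h le_rfl
        convert this using 1
        funext i
        simp only [columnFrontier]
        split_ifs <;> omega
      · have : min (m + 1) (v - 1) = m := by omega
        rw [this]
        rfl
  have := hcol v le_rfl
  rwa [min_eq_right (by omega)] at this

theorem le_advance {f : ℕ → ℕ} {e : GridEdge} (he : Ready f e) (i : ℕ) : f i ≤ advance f e i := by
  cases e with
  | vert _ _ => exact le_rfl
  | horiz k j =>
    simp only [advance, Function.update_apply]
    simp only [Ready] at he
    split_ifs with h
    · subst h; omega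
    · exact le_rfl

theorem Sched.le {h v : ℕ} {f g : ℕ → ℕ} {es : List GridEdge} (hs : Sched h v g f es) (i : ℕ) :
    f i ≤ g i := by
  induction es generalizing f with
  | nil => exact (congrFun hs i).le
  | cons e es ih => exact (le_advance hs.2.1 i).trans (ih hs.2.2)

/-- The edges still to be processed have no ends left of the frontier. -/
theorem Sched.le_of_mem {h v : ℕ} {f g : ℕ → ℕ} {es : List GridEdge} (hs : Sched h v g f es)
    {e : GridEdge} (he : e ∈ es) : f e.src.1 ≤ e.src.2 ∧ f e.tgt.1 ≤ e.tgt.2 := by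
  induction es generalizing f with
  | nil => simp at he
  | cons e' es ih =>
    rcases List.mem_cons.1 he with rfl | he
    · have := hs.2.1
      cases e <;> simp only [Ready] at this <;> simp only [GridEdge.src, GridEdge.tgt] <;> omega
    · have := ih hs.2.2 he
      exact ⟨(le_advance hs.2.1 _).trans this.1, (le_advance hs.2.1 _).trans this.2⟩

/-- The state `ω` describes the components of the graph with edges `S` at the frontier `f`. -/
structure Describes (h : ℕ) (f : ℕ → ℕ) (S : Set GridEdge) (ω : FrontierState) : Prop where
  isPartial : IsPartial h ω
  sameBlock_iff : ∀ a < h, ∀ b < h,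
    SameBlock ω a b ↔ Touched S (a, f a) ∧ Conn S (a, f a) (b, f b)
  row_lt : ∀ u, Touched S u → u.1 < h
  col_le : ∀ u, Touched S u → u.2 ≤ f u.1

theorem describes_empty (h : ℕ) (f : ℕ → ℕ) : Describes h f ∅ ∅ where
  isPartial := isPartial_empty h
  sameBlock_iff := fun a _ b _ => by simp [not_sameBlock_empty, Touched]
  row_lt := fun u hu => by simp [Touched] at hu
  col_le := fun u hu => by simp [Touched] at hu

/-- The edges chosen so far, after a decision about the edge `e`. -/
def extend (S : Set GridEdge) (e : GridEdge) : Bool → Set GridEdge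
  | false => S
  | true => insert e S

theorem subset_extend (S : Set GridEdge) (e : GridEdge) (b : Bool) : S ⊆ extend S e b := by
  cases b
  exacts [subset_rfl, Set.subset_insert e S]

/-- A vertical edge joins two frontier vertices, and `conn_insert` turns into `sameBlock_link`. At a
horizontal edge the new frontier vertex is still untouched, because by `col_le` nothing to the right
of the frontier is touched. If the edge is not taken, the new vertex is isolated and its row drops
out of the state; if it is taken, the new vertex joins the component of the vertex it replaces. -/
theorem Describes.step {h v : ℕ} {f : ℕ → ℕ} {S : Set GridEdge} {ω : FrontierState}
    (hd : Describes h f S ω) {e : GridEdge} (he : e ∈ gridEdges h v) (hr : Ready f e) (b : Bool) :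
    Describes h (advance f e) (extend S e b) (step ω e b) := by
  refine ⟨isPartial_step hd.isPartial (rowsLt_of_mem_gridEdges he) b, ?_, ?_, ?_⟩
  · have hB := hd.sameBlock_iff
    cases e with
    | vert i j =>
      obtain ⟨h1, h2⟩ := hr
      obtain ⟨h3, h4⟩ := vert_mem_gridEdges.1 he
      cases b with
      | false => exact hB
      | true =>
        intro a ha b hb
        simp only [RST.step, advance, extend, sameBlock_link]
        rw [conn_insert, touched_insert]
        have hs : (GridEdge.vert i j).src = (i, f i) := by simp [GridEdge.src, h1]
        have ht : (GridEdge.vert i j).tgt = (i + 1, f (i + 1)) := by simp [GridEdge.tgt, h2]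
        rw [hs, ht]
        have key : ∀ a < h, (a = i ∨ a = i + 1 ∨ SameBlock ω a i ∨ SameBlock ω a (i + 1)) ↔
            (Conn S (a, f a) (i, f i) ∨ Conn S (a, f a) (i + 1, f (i + 1))) := by
          intro a ha
          rw [hB a ha i (by omega), hB a ha (i + 1) h3]
          constructor
          · rintro (rfl | rfl | h | h)
            exacts [.inl (Conn.refl _ _), .inr (Conn.refl _ _), .inl h.2, .inr h.2]
          · rintro (h | h)
            · rcases h.eq_or_touched with h' | h'
              · exact .inl (congrArg Prod.fst h')
              · exact .inr (.inr (.inl ⟨h'.1, h⟩))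
            · rcases h.eq_or_touched with h' | h'
              · exact .inr (.inl (congrArg Prod.fst h'))
              · exact .inr (.inr (.inr ⟨h'.1, h⟩))
        rw [key a ha, key b hb, hB a ha b hb]
        constructor
        · rintro (⟨h, h'⟩ | ⟨h, h'⟩)
          · exact ⟨.inl h, .inl h'⟩
          · refine ⟨?_, .inr ⟨h, h'⟩⟩
            rcases h with h | h
            · rcases h.eq_or_touched with h' | h'
              exacts [.inr (.inl h'), .inl h'.1]
            · rcases h.eq_or_touched with h' | h'
              exacts [.inr (.inr h'), .inl h'.1]
        · rintro ⟨h, h' | h'⟩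
          · rcases h with h | h | h
            · exact .inl ⟨h, h'⟩
            · have hb' := h'.symm
              rw [h] at h' hb'
              exact .inr ⟨.inl (h ▸ Conn.refl _ _), .inl hb'⟩
            · have hb' := h'.symm
              rw [h] at h' hb'
              exact .inr ⟨.inr (h ▸ Conn.refl _ _), .inr hb'⟩
          · exact .inr h'
    | horiz i j =>
      have h1 : f i = j := hr
      obtain ⟨h3, h4⟩ := horiz_mem_gridEdges.1 he
      have hnew : ¬ Touched S (i, j + 1) := fun ht => by
        have := hd.col_le _ ht
        simp only [h1] at this
        omega
      have hnew' : ∀ w, Conn S (i, j + 1) w ↔ w = (i, j + 1) := fun w => by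
        constructor
        · intro hc
          rcases hc.eq_or_touched with h | h
          exacts [h.symm, absurd h.1 hnew]
        · rintro rfl
          exact Conn.refl _ _
      have hfi : advance f (.horiz i j) i = j + 1 := by simp [advance]
      have hfn : ∀ a, a ≠ i → advance f (.horiz i j) a = f a := fun a ha => by simp [advance, ha]
      intro a ha b' hb
      cases b with
      | false =>
        simp only [extend]
        rw [sameBlock_erase]
        by_cases hai : a = i
        · subst hai
          simp only [hfi, hnew, ne_eq, not_true_eq_false, false_and]
        · rw [hfn a hai]
          by_cases hbi : b' = i
          · subst hbi
            rw [hfi]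
            simp only [ne_eq, not_true_eq_false, false_and, and_false, false_iff, not_and]
            intro _ hc
            have := (hnew' _).1 hc.symm
            exact hai (congrArg Prod.fst this)
          · rw [hfn b' hbi, hB a ha b' hb]
            simp [hai, hbi]
      | true =>
        have hs : (GridEdge.horiz i j).src = (i, j) := rfl
        have ht : (GridEdge.horiz i j).tgt = (i, j + 1) := rfl
        have hold : ∀ a, a ≠ i → ¬ Conn S (a, f a) (i, j + 1) := fun a ha hc =>
          ha (congrArg Prod.fst ((hnew' _).1 hc.symm))
        simp only [extend]
        rw [sameBlock_insert, touched_insert, conn_insert, hs, ht, hB a ha b' hb]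
        by_cases hai : a = i
        · subst hai
          rw [hfi, h1]
          by_cases hbi : b' = a
          · subst hbi
            simp only [hfi, and_self, or_true, true_iff, true_and]
            exact .inl (Conn.refl _ _)
          · have hba := hold b' hbi
            have hne : ¬ Conn S (a, j + 1) (b', f b') := fun hc => hba hc.symm
            rw [hfn b' hbi]
            simp only [hbi, and_false, or_false, or_true, true_and, hne, false_or, hba,
              Conn.refl, or_true]
            constructor
            · exact fun h => h.2.symm
            · intro h
              rcases h.eq_or_touched with h' | h'
              · exact absurd (congrArg Prod.fst h') hbi
              · exact ⟨h'.2, h.symm⟩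
        · rw [hfn a hai]
          have e1 : (a, f a) ≠ (i, j) := fun h => hai (congrArg Prod.fst h)
          have e2 : (a, f a) ≠ (i, j + 1) := fun h => hai (congrArg Prod.fst h)
          have e3 := hold a hai
          by_cases hbi : b' = i
          · subst hbi
            rw [hfi, h1]
            simp only [hai, or_false, e1, e2, e3, false_or, Conn.refl, or_true, and_true]
          · rw [hfn b' hbi]
            have e4 := hold b' hbi
            simp only [hai, false_and, or_false, e1, e2, e3, e4]
            constructor
            · exact fun h => ⟨h.1, .inl h.2⟩
            · rintro ⟨h, h' | h'⟩
              · exact ⟨h, h'⟩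
              · exact ⟨h, h'.1.trans h'.2.symm⟩
  · intro u hu
    cases b with
    | false => exact hd.row_lt u hu
    | true =>
      rcases touched_insert.1 hu with hu | rfl | rfl
      · exact hd.row_lt u hu
      all_goals
        have := rowsLt_of_mem_gridEdges he
        cases e <;> simp only [GridEdge.RowsLt, GridEdge.src, GridEdge.tgt] at this ⊢ <;> omega
  · intro u hu
    have hle := le_advance hr
    cases b with
    | false => exact (hd.col_le u hu).trans (hle _)
    | true =>
      rcases touched_insert.1 hu with hu | rfl | rfl
      · exact (hd.col_le u hu).trans (hle _)
      all_goals
        cases e <;> simp only [Ready] at hr <;>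
          simp only [GridEdge.src, GridEdge.tgt, advance, Function.update_self] <;> omega

/-! ### Accepted sequences of decisions -/

/-- The decisions in the list are possible one after the other, for the edges in the list, from the
given state, and lead to an admissible final state. -/
def Accepts (P : Finset Pt) : List GridEdge → FrontierState → List Bool → Prop
  | [], ω, [] => finalOK P ω
  | e :: es, ω, b :: bs => stepOK P ω e b ∧ Accepts P es (step ω e b) bs
  | _, _, _ => False

/-- The edges that are taken. -/
def chosen : List GridEdge → List Bool → List GridEdge
  | e :: es, true :: bs => e :: chosen es bs
  | _ :: es, false :: bs => chosen es bs
  | _, _ => []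

/-- The length of a grid edge. -/
def weight (P : Finset Pt) (e : GridEdge) : ℝ := segLength (e.seg P)

/-- The total length of the edges taken. -/
def cost (P : Finset Pt) (es : List GridEdge) (bs : List Bool) : ℝ :=
  ((chosen es bs).map (weight P)).sum

theorem cost_cons (P : Finset Pt) (e : GridEdge) (es : List GridEdge) (b : Bool)
    (bs : List Bool) : cost P (e :: es) (b :: bs) = transCost P e b + cost P es bs := by
  cases b <;> simp [cost, chosen, transCost, weight]

theorem chosen_sublist (es : List GridEdge) (bs : List Bool) : (chosen es bs).Sublist es := by
  induction es generalizing bs with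
  | nil => simp [chosen]
  | cons e es ih =>
    match bs with
    | [] => simp [chosen]
    | true :: bs => exact (ih bs).cons_cons e
    | false :: bs => exact (ih bs).cons e

/-- The grid vertices that are points of `P`, as (row, column). -/
def terminals (P : Finset Pt) : Set (ℕ × ℕ) :=
  {u | u.1 < numRows P ∧ u.2 < numCols P ∧ gridPt P u.1 u.2 ∈ P}

/-- The edges in `S` connect all points of `P`. -/
def Connects (P : Finset Pt) (S : Set GridEdge) : Prop :=
  ∀ u ∈ terminals P, ∀ w ∈ terminals P, Conn S u w

theorem extend_union_chosen (S : Set GridEdge) (e : GridEdge) (es : List GridEdge) (b : Bool)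
    (bs : List Bool) : extend S e b ∪ {x | x ∈ chosen es bs} =
      S ∪ {x | x ∈ chosen (e :: es) (b :: bs)} := by
  cases b
  · rfl
  · ext x
    simp only [extend, chosen, Set.mem_union, Set.mem_insert_iff, Set.mem_ofPred_eq, List.mem_cons]
    tauto

/-- Two properties persist along an accepted run: every touched vertex is connected to the frontier,
and every terminal behind the frontier is touched. At the end the frontier carries a single
component, so all terminals are connected to each other. -/
theorem connects_of_accepts_aux {P : Finset Pt} {es : List GridEdge} :
    ∀ {f : ℕ → ℕ} {S : Set GridEdge} {ω : FrontierState} {bs : List Bool},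
      Sched (numRows P) (numCols P) (columnFrontier (numRows P) (numCols P - 1)) f es →
      Describes (numRows P) f S ω →
      (∀ u, Touched S u → ∃ k < numRows P, Conn S u (k, f k)) →
      (∀ u ∈ terminals P, u.2 < f u.1 → Touched S u) →
      Accepts P es ω bs → Connects P (S ∪ {x | x ∈ chosen es bs}) := by
  induction es with
  | nil =>
    intro f S ω bs hs hd hlive hterm hacc
    cases bs with
    | cons b bs => exact hacc.elim
    | nil =>
      have hf : f = columnFrontier (numRows P) (numCols P - 1) := hs
      subst hf
      obtain ⟨hcard, hlast⟩ : finalOK P ω := hacc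
      have hall := ((hd.isPartial.card_eq_one_iff).1 hcard).2
      have ht : ∀ u ∈ terminals P, Touched S u := by
        rintro ⟨i, j⟩ hu
        obtain ⟨hi, hj, hm⟩ := hu
        simp only at hi hj hm
        rcases lt_or_ge j (numCols P - 1) with hlt | hge
        · exact hterm _ ⟨hi, hj, hm⟩ (by simpa [columnFrontier, hi] using hlt)
        · obtain rfl : j = numCols P - 1 := by omega
          have := ((hd.sameBlock_iff i hi i hi).1 (mem_covered.1 (hlast i hi hm))).1
          simpa [columnFrontier, hi] using this
      have hfr : ∀ u ∈ terminals P, ∃ k < numRows P, SameBlock ω k k ∧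
          Conn S u (k, columnFrontier (numRows P) (numCols P - 1) k) := by
        intro u hu
        obtain ⟨k, hk, hc⟩ := hlive u (ht u hu)
        refine ⟨k, hk, (hd.sameBlock_iff k hk k hk).2 ⟨?_, Conn.refl _ _⟩, hc⟩
        rcases hc.eq_or_touched with h | h
        exacts [h ▸ ht u hu, h.2]
      intro u hu w hw
      obtain ⟨k, hk, hkk, hc⟩ := hfr u hu
      obtain ⟨k', hk', hkk', hc'⟩ := hfr w hw
      have := ((hd.sameBlock_iff k hk k' hk').1 (hall k k' hkk hkk')).2
      exact ((hc.trans this).trans hc'.symm).mono Set.subset_union_left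
  | cons e es ih =>
    intro f S ω bs hs hd hlive hterm hacc
    cases bs with
    | nil => exact hacc.elim
    | cons b bs =>
      obtain ⟨he, hr, hs'⟩ := hs
      obtain ⟨hok, hacc⟩ := hacc
      rw [← extend_union_chosen]
      refine ih hs' (hd.step he hr b) ?_ ?_ hacc
      · -- every touched vertex is still connected to the frontier
        have hmono := subset_extend S e b
        cases e with
        | vert i j =>
          have hr' : f i = j ∧ f (i + 1) = j := hr
          obtain ⟨hi, hj⟩ := vert_mem_gridEdges.1 he
          intro u hu
          cases b with
          | false => exact hlive u hu
          | true =>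
            rcases touched_insert.1 hu with hu | rfl | rfl
            · obtain ⟨k, hk, hc⟩ := hlive u hu
              exact ⟨k, hk, hc.mono hmono⟩
            · exact ⟨i, by omega, by simp [advance, GridEdge.src, hr'.1, Conn.refl]⟩
            · exact ⟨i + 1, hi, by simp [advance, GridEdge.tgt, hr'.2, Conn.refl]⟩
        | horiz i j =>
          have hr' : f i = j := hr
          obtain ⟨hi, hj⟩ := horiz_mem_gridEdges.1 he
          have hfi : advance f (.horiz i j) i = j + 1 := by simp [advance]
          have hfn : ∀ a, a ≠ i → advance f (.horiz i j) a = f a :=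
            fun a ha => by simp [advance, ha]
          intro u hu
          cases b with
          | false =>
            obtain ⟨k, hk, hc⟩ := hlive u hu
            by_cases hki : k = i
            · subst hki
              have hT : Touched S (k, f k) := by
                rcases hc.eq_or_touched with h | h
                exacts [h ▸ hu, h.2]
              have hB := (hd.sameBlock_iff k hk k hk).2 ⟨hT, Conn.refl _ _⟩
              -- Since the component is not `{k}`, it has another frontier vertex, to which the
              -- connection is transferred.
              have hns := hok.2
              rw [hd.isPartial.singleton_mem_iff] at hns
              obtain ⟨k', hkk', hne⟩ : ∃ k', SameBlock ω k k' ∧ k' ≠ k := by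
                by_contra hcon
                exact hns ⟨hB, fun k' hk' => by_contra fun hne => hcon ⟨k', hk', hne⟩⟩
              have hk' := hd.isPartial.lt_right hkk'
              refine ⟨k', hk', ?_⟩
              rw [hfn k' hne]
              exact hc.trans ((hd.sameBlock_iff k hk k' hk').1 hkk').2
            · exact ⟨k, hk, by rw [hfn k hki]; exact hc⟩
          | true =>
            have hstep : Conn (extend S (.horiz i j) true) (i, j) (i, j + 1) :=
              Conn.of_mem (e := .horiz i j) (Set.mem_insert _ _)
            rcases touched_insert.1 hu with hu | rfl | rfl
            · obtain ⟨k, hk, hc⟩ := hlive u hu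
              refine ⟨k, hk, (hc.mono hmono).trans ?_⟩
              by_cases hki : k = i
              · subst hki
                rw [hfi, hr']
                exact hstep
              · rw [hfn k hki]
                exact Conn.refl _ _
            · exact ⟨i, hi, by rw [hfi]; exact hstep⟩
            · exact ⟨i, hi, by rw [hfi]; exact Conn.refl _ _⟩
      · cases e with
        | vert i j =>
          intro u hu hlt
          exact (hterm u hu hlt).mono (subset_extend _ _ _)
        | horiz i j =>
          have hr' : f i = j := hr
          rintro ⟨a, c⟩ hu hlt
          -- The only vertex that has just moved behind the frontier is `(i, j)`.
          by_cases hac : c < f a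
          · exact (hterm _ hu hac).mono (subset_extend _ _ _)
          · by_cases hai : a = i
            · subst hai
              have hlt' : c < j + 1 := by simpa [advance] using hlt
              obtain rfl : c = j := by omega
              cases b with
              | true => exact ⟨.horiz a c, Set.mem_insert _ _, .inl rfl⟩
              | false =>
                have := ((hd.sameBlock_iff a hu.1 a hu.1).1
                  (mem_covered.1 (hok.1 hu.2.2))).1
                rwa [hr'] at this
            · simp only [advance, Function.update_of_ne hai] at hlt
              exact absurd hlt hac

/-- The edges taken in an accepted run connect all points of `P`. -/
theorem connects_of_accepts {P : Finset Pt} (hP : P.Nonempty) {bs : List Bool}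
    (hacc : Accepts P (gridEdges (numRows P) (numCols P)) ∅ bs) :
    Connects P {x | x ∈ chosen (gridEdges (numRows P) (numCols P)) bs} := by
  have hv : 1 ≤ numCols P := Finset.card_pos.2 (hP.image _)
  have := connects_of_accepts_aux (sched_gridEdges hv) (describes_empty _ _)
    (fun u hu => by simp [Touched] at hu) (fun u _ hu => by
      simp only [columnFrontier, ite_self] at hu
      omega) hacc
  rwa [Set.empty_union] at this

/-! ### Connecting sets without superfluous edges are accepted -/

/-- A set of grid edges that connects `P` and has no superfluous edges. -/
structure IsTight (P : Finset Pt) (S : Set GridEdge) : Prop where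
  mem : ∀ e ∈ S, e ∈ gridEdges (numRows P) (numCols P)
  connects : Connects P S
  bridge : ∀ e ∈ S, ¬ Conn (S \ {e}) e.src e.tgt
  reach : ∀ e ∈ S, ∀ u ∈ terminals P, Conn S e.src u

theorem IsTight.conn_of_touched {P : Finset Pt} {S : Set GridEdge} (hS : IsTight P S)
    {u w : ℕ × ℕ} (hu : Touched S u) (hw : w ∈ terminals P) : Conn S u w := by
  obtain ⟨e, he, rfl | rfl⟩ := hu
  · exact hS.reach e he w hw
  · exact (Conn.of_mem he).symm.trans (hS.reach e he w hw)

-- Each decision follows membership in `S₀`. A taken vertical edge joins different components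
-- because it is a bridge of `S₀`. A terminal that leaves the frontier has all its edges processed,
-- hence positive degree. A component cannot lose its last frontier vertex, because it is still to
-- be connected to a terminal of the last column.
open Classical in
theorem accepts_of_isTight_aux {P : Finset Pt} {S₀ : Set GridEdge} (hS : IsTight P S₀)
    (hlast : ∃ r, (r, numCols P - 1) ∈ terminals P)
    (htouch : ∀ u ∈ terminals P, Touched S₀ u) {es : List GridEdge} (hnd : es.Nodup) :
    ∀ {f : ℕ → ℕ} {ω : FrontierState},
      Sched (numRows P) (numCols P) (columnFrontier (numRows P) (numCols P - 1)) f es →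
      Describes (numRows P) f {e ∈ S₀ | e ∉ es} ω →
      Accepts P es ω (es.map fun e => decide (e ∈ S₀)) := by
  induction es with
  | nil =>
    intro f ω hs hd
    have hf : f = columnFrontier (numRows P) (numCols P - 1) := hs
    subst hf
    simp only [List.not_mem_nil, not_false_eq_true, and_true, Set.ofPred_mem_eq] at hd
    have hcov : ∀ i < numRows P, gridPt P i (numCols P - 1) ∈ P → i ∈ covered ω := by
      intro i hi hm
      rw [mem_covered, hd.sameBlock_iff i hi i hi]
      refine ⟨?_, Conn.refl _ _⟩
      rw [columnFrontier, if_pos hi]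
      refine htouch _ ⟨hi, ?_, hm⟩
      obtain ⟨r, hr⟩ := hlast
      exact hr.2.1
    refine ⟨(hd.isPartial.card_eq_one_iff).2 ⟨?_, ?_⟩, hcov⟩
    · obtain ⟨r, hr⟩ := hlast
      exact ⟨r, mem_covered.1 (hcov r hr.1 hr.2.2)⟩
    · intro a b ha hb
      have hal := hd.isPartial.lt_left ha
      have hbl := hd.isPartial.lt_left hb
      rw [hd.sameBlock_iff _ hal _ hal] at ha
      rw [hd.sameBlock_iff _ hbl _ hbl] at hb
      rw [hd.sameBlock_iff _ hal _ hbl]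
      obtain ⟨r, hr⟩ := hlast
      exact ⟨ha.1, (hS.conn_of_touched ha.1 hr).trans (hS.conn_of_touched hb.1 hr).symm⟩
  | cons e es ih =>
    intro f ω hs hd
    obtain ⟨he, hr, hs'⟩ := hs
    obtain ⟨hne, hnd⟩ := List.nodup_cons.1 hnd
    have hsub : {x ∈ S₀ | x ∉ e :: es} ⊆ S₀ \ {e} := fun x hx =>
      ⟨hx.1, fun h => hx.2 (List.mem_cons.2 (.inl h))⟩
    have hext : extend {x ∈ S₀ | x ∉ e :: es} e (decide (e ∈ S₀)) = {x ∈ S₀ | x ∉ es} := by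
      by_cases h : e ∈ S₀
      · simp only [h, decide_true, extend]
        ext x
        simp only [Set.mem_insert_iff, Set.mem_ofPred_eq, List.mem_cons]
        by_cases hx : x = e
        · subst hx
          simp [h, hne]
        · simp [hx]
      · simp only [h, decide_false, extend]
        ext x
        simp only [Set.mem_ofPred_eq, List.mem_cons]
        by_cases hx : x = e
        · subst hx
          simp [h]
        · simp [hx]
    have hstep := hd.step he hr (decide (e ∈ S₀))
    rw [hext] at hstep
    refine ⟨?_, ih hnd hs' hstep⟩
    by_cases heS : e ∈ S₀
    · simp only [heS, decide_true]
      cases e with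
      | horiz i j => trivial
      | vert i j =>
        have hr' : f i = j ∧ f (i + 1) = j := hr
        obtain ⟨hi, hj⟩ := vert_mem_gridEdges.1 he
        intro hB
        have hB' : SameBlock ω i (i + 1) := hB
        rw [hd.sameBlock_iff i (by omega) (i + 1) hi, hr'.1, hr'.2] at hB'
        exact hS.bridge _ heS (hB'.2.mono hsub)
    · simp only [heS, decide_false]
      cases e with
      | vert i j => trivial
      | horiz i j =>
        have hr' : f i = j := hr
        obtain ⟨hi, hj⟩ := horiz_mem_gridEdges.1 he
        have hfi : advance f (.horiz i j) i = j + 1 := by simp [advance]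
        have hfn : ∀ a, a ≠ i → advance f (.horiz i j) a = f a :=
          fun a ha => by simp [advance, ha]
        -- edges that are still to come do not touch the vertex that leaves the frontier
        have hdone : ∀ x ∈ S₀, (i, j) = x.src ∨ (i, j) = x.tgt →
            x ∈ {x ∈ S₀ | x ∉ GridEdge.horiz i j :: es} := by
          intro x hx hend
          refine ⟨hx, fun hmem => ?_⟩
          rcases List.mem_cons.1 hmem with rfl | hmem
          · exact heS hx
          · have hle := hs'.le_of_mem hmem
            rcases hend with h | h <;> rw [← h, hfi] at hle <;> simp only at hle <;> omega
        refine ⟨fun hm => ?_, fun hsing => ?_⟩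
        · obtain ⟨x, hx, hend⟩ := htouch (i, j) ⟨hi, by simp only; omega, hm⟩
          rw [mem_covered, hd.sameBlock_iff i hi i hi, hr']
          exact ⟨⟨x, hdone x hx hend, hend⟩, Conn.refl _ _⟩
        -- Suppose `(i, j)` is the only frontier vertex of its component. It is shown that no edge
        -- of `S₀` still to come touches this component. It is then a whole component of `S₀` and
        -- contains the terminal `(r, numCols P - 1)`, which must be on the frontier, so that `r =
        -- i` and `j` is the last column.
        · rw [hd.isPartial.singleton_mem_iff] at hsing
          obtain ⟨hii, hk⟩ := hsing
          have hT := ((hd.sameBlock_iff i hi i hi).1 hii).1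
          rw [hr'] at hT
          obtain ⟨r, hrT⟩ := hlast
          have hfront : ∀ k, k < numRows P →
              Conn {x ∈ S₀ | x ∉ GridEdge.horiz i j :: es} (i, j) (k, f k) → k = i := by
            intro k hkh hc
            refine hk k ((hd.sameBlock_iff i hi k hkh).2 ⟨?_, ?_⟩) <;> rw [hr']
            exacts [hT, hc]
          have hend : ∀ x ∈ S₀, ∀ u, (u = x.src ∨ u = x.tgt) →
              Conn {x ∈ S₀ | x ∉ GridEdge.horiz i j :: es} (i, j) u →
              x ∈ {x ∈ S₀ | x ∉ GridEdge.horiz i j :: es} := by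
            intro x hx u hu hc
            have huT : Touched {x ∈ S₀ | x ∉ GridEdge.horiz i j :: es} u := by
              rcases hc.eq_or_touched with h | h
              exacts [h ▸ hT, h.2]
            have h1 := hd.col_le u huT
            have h2 := hd.row_lt u huT
            by_cases hui : u.1 = i
            · by_cases huj : u.2 = j
              · have : (i, j) = u := by ext <;> simp [hui, huj]
                exact hdone x hx (this ▸ hu)
              · refine ⟨hx, fun hmem => ?_⟩
                rcases List.mem_cons.1 hmem with rfl | hmem
                · exact heS hx
                · have hle := hs'.le_of_mem hmem
                  rw [hui, hr'] at h1
                  rcases hu with rfl | rfl <;> rw [hui, hfi] at hle <;> omega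
            · refine ⟨hx, fun hmem => ?_⟩
              rcases List.mem_cons.1 hmem with rfl | hmem
              · exact heS hx
              · have hle := hs'.le_of_mem hmem
                -- A pending edge has no end behind the frontier, and a touched vertex is not ahead
                -- of it.
                have hue : u.2 = f u.1 := by
                  rcases hu with rfl | rfl <;> rw [hfn _ hui] at hle <;> omega
                refine hui (hfront u.1 h2 ?_)
                rw [← hue]
                exact hc
          have hclosed := Conn.exists_of_closed (S := S₀)
            (K := fun w => Conn {x ∈ S₀ | x ∉ GridEdge.horiz i j :: es} (i, j) w)
            (fun x hx => ⟨fun hc => hc.trans (Conn.of_mem (hend x hx _ (.inl rfl) hc)),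
              fun hc => hc.trans (Conn.of_mem (hend x hx _ (.inr rfl) hc)).symm⟩)
            (hS.conn_of_touched (hT.mono fun x hx => hx.1) hrT)
          have hc := hclosed.1 (Conn.refl _ _)
          have hrt : Touched {x ∈ S₀ | x ∉ GridEdge.horiz i j :: es} (r, numCols P - 1) := by
            rcases hc.eq_or_touched with h | h
            exacts [h ▸ hT, h.2]
          have h1 := hd.col_le _ hrt
          simp only at h1
          have h2 : f r ≤ numCols P - 1 := by
            have h3 := (le_advance hr r).trans (hs'.le r)
            rwa [columnFrontier, if_pos hrT.1] at h3
          -- The touched terminal is not ahead of the frontier, and the frontier never passes the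
          -- last column.
          have h4 : f r = numCols P - 1 := by omega
          have h5 := hfront r hrT.1 (by rw [h4]; exact hc)
          subst h5
          omega

theorem nodup_gridEdges (h v : ℕ) : (gridEdges h v).Nodup := by
  rw [gridEdges, List.nodup_flatMap]
  constructor
  · intro j _
    refine List.Nodup.append ?_ ?_ ?_
    · exact List.nodup_range.map fun a b h => by simpa using h
    · split_ifs
      · exact List.nodup_range.map fun a b h => by simpa using h
      · exact List.nodup_nil
    · intro e he he'
      split_ifs at he'
      · simp only [List.mem_map] at he he'
        obtain ⟨a, -, rfl⟩ := he
        obtain ⟨b, -, hb⟩ := he'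
        simp at hb
      · simp at he'
  · refine List.nodup_range.imp fun {a b} hab e he he' => hab ?_
    -- The column of the source separates the sublists of different columns.
    have key : ∀ j, e ∈ (List.range (h - 1)).map (fun i => GridEdge.vert i j) ++
        (if j + 1 < v then (List.range h).map (fun i => GridEdge.horiz i j) else []) →
        e.src.2 = j := by
      intro j hj
      rcases List.mem_append.1 hj with hj | hj
      · obtain ⟨i, -, rfl⟩ := List.mem_map.1 hj
        rfl
      · split_ifs at hj
        · obtain ⟨i, -, rfl⟩ := List.mem_map.1 hj
          rfl
        · simp at hj
    rw [← key a he, ← key b he']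

theorem chosen_map_decide (es : List GridEdge) (p : GridEdge → Bool) :
    chosen es (es.map p) = es.filter p := by
  induction es with
  | nil => rfl
  | cons e es ih =>
    cases hp : p e <;> simp [chosen, hp, ih]

/-! ### Moving coordinates onto the Hanan grid -/

/-- Moving the coordinate `x₀` to `z`. -/
def moveTo (x₀ z p : ℝ) : ℝ := if p = x₀ then z else p

/-- The greatest coordinate in use moves inward to a value that is still at least all others, so no
distance grows. -/
theorem abs_moveTo_le_of_forall_le {x₀ L p q : ℝ} (hL : L < x₀) (hp : p = x₀ ∨ p ≤ L)
    (hq : q = x₀ ∨ q ≤ L) : |moveTo x₀ L p - moveTo x₀ L q| ≤ |p - q| := by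
  unfold moveTo
  split_ifs with h1 h2 h2
  · simp
  · have hq' := hq.resolve_left h2
    rw [abs_of_nonneg (by linarith), abs_of_nonneg (by linarith)]
    linarith
  · have hp' := hp.resolve_left h1
    rw [abs_of_nonpos (by linarith), abs_of_nonpos (by linarith)]
    linarith
  · exact le_rfl

theorem abs_moveTo_le_of_forall_ge {x₀ R p q : ℝ} (hR : x₀ < R) (hp : p = x₀ ∨ R ≤ p)
    (hq : q = x₀ ∨ R ≤ q) : |moveTo x₀ R p - moveTo x₀ R q| ≤ |p - q| := by
  unfold moveTo
  split_ifs with h1 h2 h2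
  · simp
  · have hq' := hq.resolve_left h2
    rw [abs_of_nonpos (by linarith), abs_of_nonpos (by linarith)]
    linarith
  · have hp' := hp.resolve_left h1
    rw [abs_of_nonneg (by linarith), abs_of_nonneg (by linarith)]
    linarith
  · exact le_rfl

/-- For `q` outside the open interval from `L` to `R`, the distance from `q` is affine on that
interval. Its value at `x₀` is therefore the average of the values at `L` and `R` with weights
proportional to `R - x₀` and `x₀ - L`. -/
theorem abs_moveTo_add_le {x₀ L R p q : ℝ} (hL : L < x₀) (hR : x₀ < R)
    (hp : p = x₀ ∨ p ≤ L ∨ R ≤ p) (hq : q = x₀ ∨ q ≤ L ∨ R ≤ q) :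
    (R - x₀) * |moveTo x₀ L p - moveTo x₀ L q| + (x₀ - L) * |moveTo x₀ R p - moveTo x₀ R q| ≤
      (R - L) * |p - q| := by
  have key : ∀ q, q ≤ L ∨ R ≤ q →
      (R - x₀) * |L - q| + (x₀ - L) * |R - q| = (R - L) * |x₀ - q| := by
    rintro q (h | h)
    · rw [abs_of_nonneg (by linarith), abs_of_nonneg (by linarith), abs_of_nonneg (by linarith)]
      ring
    · rw [abs_of_nonpos (by linarith), abs_of_nonpos (by linarith), abs_of_nonpos (by linarith)]
      ring
  unfold moveTo
  split_ifs with h1 h2 h2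
  · simp [h1, h2]
  · rw [key q (hq.resolve_left h2), h1]
  · rw [abs_sub_comm p L, abs_sub_comm p R, abs_sub_comm p q, h2, key p (hp.resolve_left h1)]
  · exact le_of_eq (by ring)

/-- A coordinate can be moved to another one without increasing the total distance. -/
theorem exists_moveTo_le {ι : Type*} (s : Finset ι) (a b : ι → ℝ) (x₀ : ℝ) (Y : Finset ℝ)
    (hY : Y.Nonempty) (hx : x₀ ∉ Y) (ha : ∀ i ∈ s, a i = x₀ ∨ a i ∈ Y)
    (hb : ∀ i ∈ s, b i = x₀ ∨ b i ∈ Y) :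
    ∃ z ∈ Y, ∑ i ∈ s, |moveTo x₀ z (a i) - moveTo x₀ z (b i)| ≤ ∑ i ∈ s, |a i - b i| := by
  -- With coordinates on one side only, `x₀` moves to the nearest of them. With coordinates on both
  -- sides, one of the two nearest ones will do.
  rcases (Y.filter (· < x₀)).eq_empty_or_nonempty with hl | hl <;>
    rcases (Y.filter (x₀ < ·)).eq_empty_or_nonempty with hr | hr
  · obtain ⟨y, hy⟩ := hY
    rcases lt_trichotomy y x₀ with h | h | h
    · exact (Finset.eq_empty_iff_forall_notMem.1 hl y (Finset.mem_filter.2 ⟨hy, h⟩)).elim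
    · exact absurd (h ▸ hy) hx
    · exact (Finset.eq_empty_iff_forall_notMem.1 hr y (Finset.mem_filter.2 ⟨hy, h⟩)).elim
  · obtain ⟨R, hR, hmin⟩ := Finset.exists_min_image _ id hr
    obtain ⟨hRY, hRx⟩ := Finset.mem_filter.1 hR
    have hall : ∀ p, p = x₀ ∨ p ∈ Y → p = x₀ ∨ R ≤ p := by
      rintro p (h | h)
      · exact .inl h
      · rcases lt_trichotomy p x₀ with h' | h' | h'
        · exact (Finset.eq_empty_iff_forall_notMem.1 hl p (Finset.mem_filter.2 ⟨h, h'⟩)).elim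
        · exact .inl h'
        · exact .inr (hmin p (Finset.mem_filter.2 ⟨h, h'⟩))
    exact ⟨R, hRY, Finset.sum_le_sum fun i hi =>
      abs_moveTo_le_of_forall_ge hRx (hall _ (ha i hi)) (hall _ (hb i hi))⟩
  · obtain ⟨L, hL, hmax⟩ := Finset.exists_max_image _ id hl
    obtain ⟨hLY, hLx⟩ := Finset.mem_filter.1 hL
    have hall : ∀ p, p = x₀ ∨ p ∈ Y → p = x₀ ∨ p ≤ L := by
      rintro p (h | h)
      · exact .inl h
      · rcases lt_trichotomy p x₀ with h' | h' | h'
        · exact .inr (hmax p (Finset.mem_filter.2 ⟨h, h'⟩))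
        · exact .inl h'
        · exact (Finset.eq_empty_iff_forall_notMem.1 hr p (Finset.mem_filter.2 ⟨h, h'⟩)).elim
    exact ⟨L, hLY, Finset.sum_le_sum fun i hi =>
      abs_moveTo_le_of_forall_le hLx (hall _ (ha i hi)) (hall _ (hb i hi))⟩
  · obtain ⟨L, hL, hmax⟩ := Finset.exists_max_image _ id hl
    obtain ⟨hLY, hLx⟩ := Finset.mem_filter.1 hL
    obtain ⟨R, hR, hmin⟩ := Finset.exists_min_image _ id hr
    obtain ⟨hRY, hRx⟩ := Finset.mem_filter.1 hR
    have hall : ∀ p, p = x₀ ∨ p ∈ Y → p = x₀ ∨ p ≤ L ∨ R ≤ p := by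
      rintro p (h | h)
      · exact .inl h
      · rcases lt_trichotomy p x₀ with h' | h' | h'
        · exact .inr (.inl (hmax p (Finset.mem_filter.2 ⟨h, h'⟩)))
        · exact .inl h'
        · exact .inr (.inr (hmin p (Finset.mem_filter.2 ⟨h, h'⟩)))
    have hsum := Finset.sum_le_sum fun i hi =>
      abs_moveTo_add_le hLx hRx (hall _ (ha i hi)) (hall _ (hb i hi))
    rw [Finset.sum_add_distrib, ← Finset.mul_sum, ← Finset.mul_sum, ← Finset.mul_sum] at hsum
    -- If both moves increased the total, so would their weighted average, against the summed
    -- estimate.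
    by_contra hcon
    have h1 := lt_of_not_ge fun h => hcon ⟨L, hLY, h⟩
    have h2 := lt_of_not_ge fun h => hcon ⟨R, hRY, h⟩
    have h3 := mul_lt_mul_of_pos_left h1 (sub_pos.2 hRx)
    have h4 := mul_lt_mul_of_pos_left h2 (sub_pos.2 hLx)
    have h5 : (R - L) * ∑ i ∈ s, |a i - b i| =
      (R - x₀) * ∑ i ∈ s, |a i - b i| + (x₀ - L) * ∑ i ∈ s, |a i - b i| := by ring
    linarith

/-- Finitely many distances do not increase in total under a suitable retraction onto a finite
set of coordinates. -/
theorem exists_retraction {ι : Type*} (H : Finset ℝ) (hH : H.Nonempty) (s : Finset ι) :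
    ∀ (n : ℕ) (a b : ι → ℝ), ((s.image a ∪ s.image b) \ H).card = n →
      ∃ f : ℝ → ℝ, (∀ x, f x ∈ H) ∧ (∀ x ∈ H, f x = x) ∧
        ∑ i ∈ s, |f (a i) - f (b i)| ≤ ∑ i ∈ s, |a i - b i| := by
  intro n
  induction n using Nat.strong_induction_on with
  | _ n ih =>
    intro a b hn
    rcases ((s.image a ∪ s.image b) \ H).eq_empty_or_nonempty with h0 | ⟨x₀, hx₀⟩
    · obtain ⟨y, hy⟩ := hH
      have hmem : ∀ x ∈ s.image a ∪ s.image b, x ∈ H := fun x hx => by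
        by_contra hxH
        have : x ∈ (s.image a ∪ s.image b) \ H := Finset.mem_sdiff.2 ⟨hx, hxH⟩
        simp [h0] at this
      -- All coordinates in use are in `H` by now; `y` is only a default value elsewhere.
      refine ⟨fun x => if x ∈ H then x else y, fun x => ?_, fun x hx => if_pos hx,
        le_of_eq (Finset.sum_congr rfl fun i hi => ?_)⟩
      · dsimp only
        split_ifs with h
        exacts [h, hy]
      · dsimp only
        rw [if_pos (hmem _ (Finset.mem_union_left _ (Finset.mem_image_of_mem a hi))),
          if_pos (hmem _ (Finset.mem_union_right _ (Finset.mem_image_of_mem b hi)))]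
    · obtain ⟨hx1, hx2⟩ := Finset.mem_sdiff.1 hx₀
      set X := s.image a ∪ s.image b with hX
      have hYne : ((X ∪ H).erase x₀).Nonempty := by
        obtain ⟨y, hy⟩ := hH
        exact ⟨y, Finset.mem_erase.2 ⟨fun h => hx2 (h ▸ hy), Finset.mem_union_right _ hy⟩⟩
      have hdich : ∀ p ∈ X, p = x₀ ∨ p ∈ (X ∪ H).erase x₀ := fun p hp => by
        by_cases h : p = x₀
        · exact .inl h
        · exact .inr (Finset.mem_erase.2 ⟨h, Finset.mem_union_left _ hp⟩)
      have haX : ∀ i ∈ s, a i ∈ X := fun i hi =>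
        Finset.mem_union_left _ (Finset.mem_image_of_mem a hi)
      have hbX : ∀ i ∈ s, b i ∈ X := fun i hi =>
        Finset.mem_union_right _ (Finset.mem_image_of_mem b hi)
      obtain ⟨z, hz, hle⟩ := exists_moveTo_le s a b x₀ _ hYne (Finset.notMem_erase _ _)
        (fun i hi => hdich _ (haX i hi)) (fun i hi => hdich _ (hbX i hi))
      obtain ⟨hzne, hzm⟩ := Finset.mem_erase.1 hz
      -- The target `z` need not be in `H`, but otherwise it is a coordinate already in use. So the
      -- move removes `x₀` and creates no new coordinate outside `H`, and the number of these drops.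
      have hmv : ∀ p ∈ X, moveTo x₀ z p ∉ H → moveTo x₀ z p ∈ (X \ H).erase x₀ := by
        intro p hp hpH
        unfold moveTo at hpH ⊢
        split_ifs at hpH ⊢ with h
        · exact Finset.mem_erase.2 ⟨hzne, Finset.mem_sdiff.2
            ⟨(Finset.mem_union.1 hzm).resolve_right hpH, hpH⟩⟩
        · exact Finset.mem_erase.2 ⟨h, Finset.mem_sdiff.2 ⟨hp, hpH⟩⟩
      have hlt : ((s.image (moveTo x₀ z ∘ a) ∪ s.image (moveTo x₀ z ∘ b)) \ H).card < n := by
        rw [← hn]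
        refine (Finset.card_le_card ?_).trans_lt (Finset.card_erase_lt_of_mem hx₀)
        intro p hp
        obtain ⟨hp, hpH⟩ := Finset.mem_sdiff.1 hp
        rcases Finset.mem_union.1 hp with hp | hp <;>
          obtain ⟨i, hi, rfl⟩ := Finset.mem_image.1 hp
        exacts [hmv _ (haX i hi) hpH, hmv _ (hbX i hi) hpH]
      obtain ⟨f, hf1, hf2, hf3⟩ := ih _ hlt _ _ rfl
      refine ⟨fun p => f (moveTo x₀ z p), fun x => hf1 _, fun x hx => ?_, hf3.trans hle⟩
      have : moveTo x₀ z x = x := if_neg (by rintro rfl; exact hx2 hx)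
      dsimp only
      rw [this, hf2 x hx]

/-! ### Coordinates of the grid -/

/-- The `j`-th smallest element of a finite set of reals. -/
def coord (s : Finset ℝ) (j : ℕ) : ℝ := (s.sort (· ≤ ·)).getD j 0

theorem coord_eq_getElem {s : Finset ℝ} {j : ℕ} (hj : j < s.card) :
    coord s j = (s.sort (· ≤ ·))[j]'(by simpa using hj) := by
  rw [coord, List.getD_eq_getElem]

theorem coord_lt {s : Finset ℝ} {j k : ℕ} (hjk : j < k) (hk : k < s.card) :
    coord s j < coord s k := by
  rw [coord_eq_getElem (hjk.trans hk), coord_eq_getElem hk]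
  exact (Finset.sortedLT_sort s).getElem_lt_getElem_of_lt hjk

theorem coord_le {s : Finset ℝ} {j k : ℕ} (hjk : j ≤ k) (hk : k < s.card) :
    coord s j ≤ coord s k := by
  rcases hjk.eq_or_lt with rfl | h
  exacts [le_rfl, (coord_lt h hk).le]

theorem coord_mem {s : Finset ℝ} {j : ℕ} (hj : j < s.card) : coord s j ∈ s := by
  rw [coord_eq_getElem hj]
  exact (Finset.mem_sort (· ≤ ·)).1 (List.getElem_mem _)

theorem exists_coord {s : Finset ℝ} {x : ℝ} (hx : x ∈ s) : ∃ j < s.card, coord s j = x := by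
  obtain ⟨j, hj, rfl⟩ := List.getElem_of_mem ((Finset.mem_sort (· ≤ ·)).2 hx)
  have hj' : j < s.card := by simpa using hj
  exact ⟨j, hj', coord_eq_getElem hj'⟩

theorem coord_inj {s : Finset ℝ} {j k : ℕ} (hj : j < s.card) (hk : k < s.card)
    (hjk : coord s j = coord s k) : j = k := by
  rcases lt_trichotomy j k with h | h | h
  · exact absurd hjk (coord_lt h hk).ne
  · exact h
  · exact absurd hjk (coord_lt h hj).ne'

theorem gridPt_eq (P : Finset Pt) (i j : ℕ) :
    gridPt P i j = (coord (P.image Prod.fst) j, coord (P.image Prod.snd) i) := rfl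

/-- The vertices of the grid, as (row, column). -/
def gridVerts (P : Finset Pt) : Set (ℕ × ℕ) := {u | u.1 < numRows P ∧ u.2 < numCols P}

theorem gridPt_injOn (P : Finset Pt) :
    Set.InjOn (fun u : ℕ × ℕ => gridPt P u.1 u.2) (gridVerts P) := by
  rintro ⟨i, j⟩ ⟨hi, hj⟩ ⟨i', j'⟩ ⟨hi', hj'⟩ heq
  simp only [gridPt_eq, Prod.mk.injEq] at heq
  exact Prod.ext (coord_inj hi hi' heq.2) (coord_inj hj hj' heq.1)

theorem exists_terminal {P : Finset Pt} {p : Pt} (hp : p ∈ P) :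
    ∃ u ∈ terminals P, gridPt P u.1 u.2 = p := by
  obtain ⟨j, hj, hj'⟩ := exists_coord (Finset.mem_image_of_mem Prod.fst hp)
  obtain ⟨i, hi, hi'⟩ := exists_coord (Finset.mem_image_of_mem Prod.snd hp)
  have : gridPt P i j = p := by rw [gridPt_eq, hi', hj']
  exact ⟨(i, j), ⟨hi, hj, this ▸ hp⟩, this⟩

theorem terminals_subset (P : Finset Pt) : terminals P ⊆ gridVerts P := fun _ hu => ⟨hu.1, hu.2.1⟩

/-- Every line of the grid carries a point of `P`. This terminal is what keeps the components alive
up to the end of the sweep. -/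
theorem exists_terminal_last_column {P : Finset Pt} (hP : P.Nonempty) :
    ∃ r, (r, numCols P - 1) ∈ terminals P := by
  have hv : 0 < numCols P := Finset.card_pos.2 (hP.image _)
  have hlt : numCols P - 1 < numCols P := by omega
  obtain ⟨p, hp, hpx⟩ := Finset.mem_image.1 (coord_mem (s := P.image Prod.fst) hlt)
  obtain ⟨⟨i, j⟩, hu, rfl⟩ := exists_terminal hp
  obtain rfl : j = numCols P - 1 := coord_inj hu.2.1 hlt hpx
  exact ⟨i, hu⟩

theorem src_mem_gridVerts {P : Finset Pt} {e : GridEdge}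
    (he : e ∈ gridEdges (numRows P) (numCols P)) : e.src ∈ gridVerts P := by
  cases e with
  | vert i j =>
    have := vert_mem_gridEdges.1 he
    exact ⟨by simp only [GridEdge.src]; omega, this.2⟩
  | horiz i j =>
    have := horiz_mem_gridEdges.1 he
    exact ⟨this.1, by simp only [GridEdge.src]; omega⟩

theorem tgt_mem_gridVerts {P : Finset Pt} {e : GridEdge}
    (he : e ∈ gridEdges (numRows P) (numCols P)) : e.tgt ∈ gridVerts P := by
  cases e with
  | vert i j => exact vert_mem_gridEdges.1 he
  | horiz i j => exact horiz_mem_gridEdges.1 he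

theorem seg_eq (P : Finset Pt) (e : GridEdge) :
    e.seg P = s(gridPt P e.src.1 e.src.2, gridPt P e.tgt.1 e.tgt.2) := by
  cases e <;> rfl

/-- From source to target exactly one index grows, so the ends cannot match in the reverse order. -/
theorem eq_of_src_tgt_eq {e e' : GridEdge} (h : s(e.src, e.tgt) = s(e'.src, e'.tgt)) : e = e' := by
  rw [Sym2.eq_iff] at h
  cases e <;> cases e' <;>
    simp only [GridEdge.src, GridEdge.tgt, Prod.mk.injEq, GridEdge.vert.injEq,
      GridEdge.horiz.injEq, reduceCtorEq] at h ⊢ <;> omega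

theorem seg_injOn (P : Finset Pt) :
    Set.InjOn (GridEdge.seg P) {e | e ∈ gridEdges (numRows P) (numCols P)} := by
  intro e he e' he' heq
  apply eq_of_src_tgt_eq
  rw [seg_eq, seg_eq, Sym2.eq_iff] at heq
  rw [Sym2.eq_iff]
  have inj := gridPt_injOn P
  refine heq.imp (fun h => ⟨?_, ?_⟩) (fun h => ⟨?_, ?_⟩)
  · exact inj (src_mem_gridVerts he) (src_mem_gridVerts he') h.1
  · exact inj (tgt_mem_gridVerts he) (tgt_mem_gridVerts he') h.2
  · exact inj (src_mem_gridVerts he) (tgt_mem_gridVerts he') h.1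
  · exact inj (tgt_mem_gridVerts he) (src_mem_gridVerts he') h.2

theorem weight_vert {P : Finset Pt} {i j : ℕ} (hi : i + 1 < numRows P) :
    weight P (.vert i j) = coord (P.image Prod.snd) (i + 1) - coord (P.image Prod.snd) i := by
  have := coord_lt (Nat.lt_succ_self i) hi
  simp only [weight, GridEdge.seg, segLength, Sym2.lift_mk, l1Dist, gridPt_eq, sub_self, abs_zero,
    zero_add]
  rw [abs_sub_comm, abs_of_pos (sub_pos.2 this)]

theorem weight_horiz {P : Finset Pt} {i j : ℕ} (hj : j + 1 < numCols P) :
    weight P (.horiz i j) = coord (P.image Prod.fst) (j + 1) - coord (P.image Prod.fst) j := by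
  have := coord_lt (Nat.lt_succ_self j) hj
  simp only [weight, GridEdge.seg, segLength, Sym2.lift_mk, l1Dist, gridPt_eq, sub_self, abs_zero,
    add_zero]
  rw [abs_sub_comm, abs_of_pos (sub_pos.2 this)]

theorem weight_pos {P : Finset Pt} {e : GridEdge}
    (he : e ∈ gridEdges (numRows P) (numCols P)) : 0 < weight P e := by
  cases e with
  | vert i j =>
    have := (vert_mem_gridEdges.1 he).1
    rw [weight_vert this]
    exact sub_pos.2 (coord_lt (Nat.lt_succ_self i) this)
  | horiz i j =>
    have := (horiz_mem_gridEdges.1 he).2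
    rw [weight_horiz this]
    exact sub_pos.2 (coord_lt (Nat.lt_succ_self j) this)

theorem weight_nonneg (P : Finset Pt) (e : GridEdge) : 0 ≤ weight P e := by
  unfold weight
  induction e.seg P with
  | _ a b => exact add_nonneg (abs_nonneg _) (abs_nonneg _)

/-! ### Connecting sets of grid edges from Steiner trees -/

instance : DecidableEq GridEdge := Classical.decEq _

theorem sum_weight_union_le (P : Finset Pt) (S S' : Finset GridEdge) :
    ∑ e ∈ S ∪ S', weight P e ≤ ∑ e ∈ S, weight P e + ∑ e ∈ S', weight P e := by
  rw [← Finset.sum_union_inter]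
  exact le_add_of_nonneg_right (Finset.sum_nonneg fun e _ => weight_nonneg P e)

theorem sum_weight_biUnion_le {ι : Type*} (P : Finset Pt) (s : Finset ι)
    (S : ι → Finset GridEdge) :
    ∑ e ∈ s.biUnion S, weight P e ≤ ∑ i ∈ s, ∑ e ∈ S i, weight P e := by
  classical
  induction s using Finset.induction_on with
  | empty => simp
  | insert i s hi ih =>
    rw [Finset.biUnion_insert, Finset.sum_insert hi]
    exact (sum_weight_union_le P _ _).trans (by gcongr)

/-- A set of grid edges that connects the grid vertices `u` and `w`, of length at most `r`. -/
def HasGridPath (P : Finset Pt) (u w : ℕ × ℕ) (r : ℝ) : Prop :=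
  ∃ S : Finset GridEdge, (∀ e ∈ S, e ∈ gridEdges (numRows P) (numCols P)) ∧
    Conn (S : Set GridEdge) u w ∧ ∑ e ∈ S, weight P e ≤ r

theorem HasGridPath.symm {P : Finset Pt} {u w : ℕ × ℕ} {r : ℝ} (h : HasGridPath P u w r) :
    HasGridPath P w u r := by
  obtain ⟨S, h1, h2, h3⟩ := h
  exact ⟨S, h1, h2.symm, h3⟩

theorem HasGridPath.trans {P : Finset Pt} {u w x : ℕ × ℕ} {r r' : ℝ} (h : HasGridPath P u w r)
    (h' : HasGridPath P w x r') : HasGridPath P u x (r + r') := by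
  obtain ⟨S, h1, h2, h3⟩ := h
  obtain ⟨S', h1', h2', h3'⟩ := h'
  refine ⟨S ∪ S', fun e he => (Finset.mem_union.1 he).elim (h1 e) (h1' e), ?_,
    (sum_weight_union_le P _ _).trans (add_le_add h3 h3')⟩
  rw [Finset.coe_union]
  exact (h2.mono Set.subset_union_left).trans (h2'.mono Set.subset_union_right)

theorem hasGridPath_edge {P : Finset Pt} {e : GridEdge}
    (he : e ∈ gridEdges (numRows P) (numCols P)) :
    HasGridPath P e.src e.tgt (weight P e) :=
  ⟨{e}, fun x hx => (Finset.mem_singleton.1 hx) ▸ he, Conn.of_mem (by simp), by simp⟩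

theorem hasGridPath_self (P : Finset Pt) (u : ℕ × ℕ) : HasGridPath P u u 0 :=
  ⟨∅, by simp, Conn.refl _ _, by simp⟩

theorem hasGridPath_column {P : Finset Pt} {i i' j : ℕ} (hi : i < numRows P)
    (hi' : i' < numRows P) (hj : j < numCols P) : HasGridPath P (i, j) (i', j)
      |coord (P.image Prod.snd) i - coord (P.image Prod.snd) i'| := by
  have key : ∀ k i, i + k < numRows P → HasGridPath P (i, j) (i + k, j)
      (coord (P.image Prod.snd) (i + k) - coord (P.image Prod.snd) i) := by
    intro k i hk
    induction k with
    | zero => simpa using hasGridPath_self P (i, j)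
    | succ k ih =>
      have hr : i + k + 1 < numRows P := by omega
      have h2 := hasGridPath_edge (P := P) (vert_mem_gridEdges.2 ⟨hr, hj⟩)
      rw [weight_vert hr] at h2
      have h3 := (ih (by omega)).trans h2
      rwa [sub_add_sub_cancel'] at h3
  have key' : ∀ i i', i ≤ i' → i' < numRows P → HasGridPath P (i, j) (i', j)
      |coord (P.image Prod.snd) i - coord (P.image Prod.snd) i'| := by
    intro i i' hle hi'
    rw [abs_sub_comm, abs_of_nonneg (sub_nonneg.2 (coord_le hle hi'))]
    obtain ⟨k, rfl⟩ := Nat.exists_eq_add_of_le hle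
    exact key k i hi'
  rcases le_total i i' with h | h
  · exact key' i i' h hi'
  · rw [abs_sub_comm]
    exact (key' i' i h hi).symm

theorem hasGridPath_row {P : Finset Pt} {i j j' : ℕ} (hi : i < numRows P)
    (hj : j < numCols P) (hj' : j' < numCols P) : HasGridPath P (i, j) (i, j')
      |coord (P.image Prod.fst) j - coord (P.image Prod.fst) j'| := by
  have key : ∀ k j, j + k < numCols P → HasGridPath P (i, j) (i, j + k)
      (coord (P.image Prod.fst) (j + k) - coord (P.image Prod.fst) j) := by
    intro k j hk
    induction k with
    | zero => simpa using hasGridPath_self P (i, j)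
    | succ k ih =>
      have hr : j + k + 1 < numCols P := by omega
      have h2 := hasGridPath_edge (P := P) (horiz_mem_gridEdges.2 ⟨hi, hr⟩)
      rw [weight_horiz hr] at h2
      have h3 := (ih (by omega)).trans h2
      rwa [sub_add_sub_cancel'] at h3
  have key' : ∀ j j', j ≤ j' → j' < numCols P → HasGridPath P (i, j) (i, j')
      |coord (P.image Prod.fst) j - coord (P.image Prod.fst) j'| := by
    intro j j' hle hj'
    rw [abs_sub_comm, abs_of_nonneg (sub_nonneg.2 (coord_le hle hj'))]
    obtain ⟨k, rfl⟩ := Nat.exists_eq_add_of_le hle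
    exact key k j hj'
  rcases le_total j j' with h | h
  · exact key' j j' h hj'
  · rw [abs_sub_comm]
    exact (key' j' j h hj).symm

/-- The path runs along the row of `u` and then along the column of `w`; the two lengths add up to
the `l₁` distance. -/
theorem hasGridPath {P : Finset Pt} {u w : ℕ × ℕ} (hu : u ∈ gridVerts P) (hw : w ∈ gridVerts P) :
    HasGridPath P u w (l1Dist (gridPt P u.1 u.2) (gridPt P w.1 w.2)) :=
  (hasGridPath_row hu.1 hu.2 hw.2).trans (hasGridPath_column hu.1 hw.1 hw.2)

/-- A set of grid edges that connects `P`. -/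
structure IsConnecting (P : Finset Pt) (S : Finset GridEdge) : Prop where
  mem : ∀ e ∈ S, e ∈ gridEdges (numRows P) (numCols P)
  connects : Connects P (S : Set GridEdge)

/-- Every Steiner tree can be replaced by grid edges that connect `P` and are not longer. -/
theorem exists_isConnecting_of_isSteinerTree {P : Finset Pt} (hP : P.Nonempty) {T : PlaneGraph}
    (hT : IsSteinerTree P T) :
    ∃ S, IsConnecting P S ∧ ∑ e ∈ S, weight P e ≤ T.length := by
  -- `e.out` orders the two ends of an edge arbitrarily. Horizontal and vertical extents are summed
  -- separately, so the two coordinates can be retracted independently.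
  obtain ⟨f, hf1, hf2, hf3⟩ := exists_retraction (P.image Prod.fst) (hP.image _) T.edges _
    (fun e => e.out.1.1) (fun e => e.out.2.1) rfl
  obtain ⟨g, hg1, hg2, hg3⟩ := exists_retraction (P.image Prod.snd) (hP.image _) T.edges _
    (fun e => e.out.1.2) (fun e => e.out.2.2) rfl
  choose fi hfi1 hfi2 using fun x => exists_coord (hf1 x)
  choose gi hgi1 hgi2 using fun x => exists_coord (hg1 x)
  let u : Pt → ℕ × ℕ := fun p => (gi p.2, fi p.1)
  have hu : ∀ p, u p ∈ gridVerts P := fun p => ⟨hgi1 _, hfi1 _⟩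
  have hgu : ∀ p, gridPt P (u p).1 (u p).2 = (f p.1, g p.2) := fun p => by
    rw [gridPt_eq]
    exact Prod.ext (hfi2 _) (hgi2 _)
  -- The retractions fix the coordinates of the points of `P`, so the terminals stay in place.
  have hterm : ∀ w ∈ terminals P, u (gridPt P w.1 w.2) = w := by
    intro w hw
    apply gridPt_injOn P (hu _) (terminals_subset P hw)
    dsimp only
    rw [hgu, hf2 _ (Finset.mem_image_of_mem Prod.fst hw.2.2),
      hg2 _ (Finset.mem_image_of_mem Prod.snd hw.2.2)]
  choose S hS1 hS2 hS3 using fun e : Sym2 Pt => hasGridPath (hu e.out.1) (hu e.out.2)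
  refine ⟨T.edges.biUnion S, ⟨fun e he => ?_, ?_⟩, ?_⟩
  · obtain ⟨x, -, hx⟩ := Finset.mem_biUnion.1 he
    exact hS1 x e hx
  · have hadj : ∀ a b : Pt, s(a, b) ∈ T.edges →
        Conn (T.edges.biUnion S : Finset GridEdge) (u a) (u b) := by
      intro a b hab
      have hsub : (S s(a, b) : Set GridEdge) ⊆ (T.edges.biUnion S : Finset GridEdge) :=
        Finset.coe_subset.2 (Finset.subset_biUnion_of_mem S hab)
      have hc := (hS2 s(a, b)).mono hsub
      have hout : s((s(a, b) : Sym2 Pt).out.1, (s(a, b) : Sym2 Pt).out.2) = s(a, b) :=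
        Quot.out_eq _
      rcases Sym2.eq_iff.1 hout with ⟨h1, h2⟩ | ⟨h1, h2⟩
      · rwa [h1, h2] at hc
      · rw [h1, h2] at hc
        exact hc.symm
    intro w hw x hx
    rw [← hterm w hw, ← hterm x hx]
    have hr := hT.isTree.connected.preconnected ⟨_, hT.terminals hw.2.2⟩ ⟨_, hT.terminals hx.2.2⟩
    rw [SimpleGraph.reachable_iff_reflTransGen] at hr
    have : ∀ y : (T.verts : Set Pt), Relation.ReflTransGen
        ((SimpleGraph.fromEdgeSet (T.edges : Set (Sym2 Pt))).induce (T.verts : Set Pt)).Adj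
        ⟨_, hT.terminals hw.2.2⟩ y →
        Conn (T.edges.biUnion S : Finset GridEdge) (u (gridPt P w.1 w.2)) (u y.1) := by
      intro y hy
      induction hy with
      | refl => exact Conn.refl _ _
      | tail _ h ih =>
        refine ih.trans (hadj _ _ ?_)
        exact ((SimpleGraph.fromEdgeSet_adj _).1 (SimpleGraph.induce_adj.1 h)).1
    exact this _ hr
  · refine (sum_weight_biUnion_le P _ S).trans ?_
    have hlen : T.length = ∑ e ∈ T.edges, (|e.out.1.1 - e.out.2.1| + |e.out.1.2 - e.out.2.2|) := by
      refine Finset.sum_congr rfl fun e _ => ?_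
      conv_lhs => rw [← Quot.out_eq e]
      rfl
    rw [hlen, Finset.sum_add_distrib]
    refine le_trans (Finset.sum_le_sum fun e _ => hS3 e) ?_
    simp only [hgu, l1Dist]
    rw [Finset.sum_add_distrib]
    exact add_le_add hf3 hg3

/-! ### Shortest connecting sets are shortest Steiner trees -/

/-- The graph with the given edges, on the points of `P` and the ends of the edges. -/
def graphOf (P : Finset Pt) (E : Finset (Sym2 Pt)) : PlaneGraph where
  verts := P ∪ E.biUnion fun e => e.toFinset
  edges := E

/-- A connecting set of least total length. -/
structure IsMinConnecting (P : Finset Pt) (S : Finset GridEdge) : Prop extends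
    IsConnecting P S where
  le : ∀ S', IsConnecting P S' → ∑ e ∈ S, weight P e ≤ ∑ e ∈ S', weight P e

theorem exists_isConnecting (P : Finset Pt) : ∃ S, IsConnecting P S := by
  refine ⟨(gridEdges (numRows P) (numCols P)).toFinset, fun e he => List.mem_toFinset.1 he, ?_⟩
  intro u hu w hw
  obtain ⟨S, hS, hc, -⟩ := hasGridPath (terminals_subset P hu) (terminals_subset P hw)
  exact hc.mono fun e he => Finset.mem_coe.2 (List.mem_toFinset.2 (hS e he))

theorem exists_isMinConnecting (P : Finset Pt) : ∃ S, IsMinConnecting P S := by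
  classical
  have hmem : ∀ S, IsConnecting P S ↔ S ∈
      (gridEdges (numRows P) (numCols P)).toFinset.powerset.filter (IsConnecting P) := by
    intro S
    rw [Finset.mem_filter, Finset.mem_powerset]
    exact ⟨fun h => ⟨fun e he => List.mem_toFinset.2 (h.mem e he), h⟩, fun h => h.2⟩
  obtain ⟨S₀, h₀⟩ := exists_isConnecting P
  obtain ⟨S, hS, hmin⟩ := Finset.exists_min_image _ (fun S => ∑ e ∈ S, weight P e)
    ⟨S₀, (hmem S₀).1 h₀⟩
  exact ⟨S, (hmem S).2 hS, fun S' h' => hmin S' ((hmem S').1 h')⟩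

/-- Edge lengths are positive, so a connecting set with one edge less would be shorter. -/
theorem IsMinConnecting.not_connects_erase {P : Finset Pt} {S : Finset GridEdge}
    (hS : IsMinConnecting P S) {e : GridEdge} (he : e ∈ S) :
    ¬ Connects P ((S : Set GridEdge) \ {e}) := by
  intro hc
  have h1 := hS.le (S.erase e) ⟨fun x hx => hS.mem x (Finset.mem_of_mem_erase hx), by
    rwa [Finset.coe_erase]⟩
  rw [← Finset.sum_erase_add _ _ he] at h1
  have := weight_pos (hS.mem e he)
  linarith

/-- An edge whose ends stay connected without it could be deleted, and so could an edge in a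
component that misses some terminal: as the terminals are connected to each other, such a component
contains none of them. -/
theorem IsMinConnecting.isTight {P : Finset Pt} {S : Finset GridEdge}
    (hS : IsMinConnecting P S) : IsTight P (S : Set GridEdge) where
  mem := hS.mem
  connects := hS.connects
  bridge := fun e he hc => hS.not_connects_erase he fun u hu w hw =>
    (hS.connects u hu w hw).lift (conn_equivalence _) fun x hx => by
      by_cases hxe : x = e
      · rwa [hxe]
      · exact Conn.of_mem ⟨hx, hxe⟩
  reach := fun e he p hp => by
    by_contra hcon
    refine hS.not_connects_erase he fun u hu w hw => ?_
    -- Within the component of `p`, which does not contain `e`, connections survive the deletion of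
    -- `e`. Being in that component is part of the relation to make it symmetric and transitive.
    have hr : Equivalence fun x y => (Conn (S : Set GridEdge) x p ↔ Conn (S : Set GridEdge) y p) ∧
        (Conn (S : Set GridEdge) x p → Conn ((S : Set GridEdge) \ {e}) x y) :=
      ⟨fun x => ⟨Iff.rfl, fun _ => Conn.refl _ _⟩,
        fun h => ⟨h.1.symm, fun hy => (h.2 (h.1.2 hy)).symm⟩,
        fun h h' => ⟨h.1.trans h'.1, fun hx => (h.2 hx).trans (h'.2 (h.1.1 hx))⟩⟩
    refine ((hS.connects u hu w hw).lift hr fun x hx => ⟨?_, fun hxp => ?_⟩).2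
      (hS.connects u hu p hp)
    · exact ⟨fun h => (Conn.of_mem hx).symm.trans h, fun h => (Conn.of_mem hx).trans h⟩
    · by_cases hxe : x = e
      · exact absurd (hxe ▸ hxp) hcon
      · exact Conn.of_mem ⟨hx, hxe⟩

theorem reachable_lift {V : Type*} {G : SimpleGraph V} {r : V → V → Prop}
    (hr : Equivalence r) (hG : ∀ u w, G.Adj u w → r u w) {u w : V} (h : G.Reachable u w) :
    r u w := by
  rw [SimpleGraph.reachable_iff_reflTransGen] at h
  induction h with
  | refl => exact hr.refl u
  | tail _ h ih => exact hr.trans ih (hG _ _ h)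

/-- A connecting set without superfluous edges is a Steiner tree. -/
theorem IsTight.isSteinerTree {P : Finset Pt} (hP : P.Nonempty) {S : Finset GridEdge}
    (hS : IsTight P (S : Set GridEdge)) :
    IsSteinerTree P (graphOf P (S.image (GridEdge.seg P))) := by
  have hsrc : ∀ e ∈ S, e.src ∈ gridVerts P := fun e he => src_mem_gridVerts (hS.mem e he)
  have htgt : ∀ e ∈ S, e.tgt ∈ gridVerts P := fun e he => tgt_mem_gridVerts (hS.mem e he)
  have hne : ∀ e ∈ S, gridPt P e.src.1 e.src.2 ≠ gridPt P e.tgt.1 e.tgt.2 := fun e he h => by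
    have := gridPt_injOn P (hsrc e he) (htgt e he) h
    cases e <;> simp [GridEdge.src, GridEdge.tgt] at this
  have hinc : ∀ e ∈ S.image (GridEdge.seg P), ∀ a ∈ e,
      a ∈ (graphOf P (S.image (GridEdge.seg P))).verts := fun e he a ha =>
    Finset.mem_union_right _ (Finset.mem_biUnion.2 ⟨e, he, Sym2.mem_toFinset.2 ha⟩)
  have hverts : ∀ a ∈ (graphOf P (S.image (GridEdge.seg P))).verts,
      ∃ u ∈ gridVerts P, a = gridPt P u.1 u.2 ∧ ∀ w ∈ terminals P, Conn (S : Set GridEdge) u w := by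
    intro a ha
    rcases Finset.mem_union.1 ha with ha | ha
    · obtain ⟨u, hu, rfl⟩ := exists_terminal ha
      exact ⟨u, terminals_subset P hu, rfl, hS.connects u hu⟩
    · obtain ⟨s, hs, ha⟩ := Finset.mem_biUnion.1 ha
      obtain ⟨e, he, rfl⟩ := Finset.mem_image.1 hs
      rw [Sym2.mem_toFinset, seg_eq, Sym2.mem_iff] at ha
      rcases ha with rfl | rfl
      · exact ⟨_, hsrc e he, rfl, fun w hw => hS.conn_of_touched ⟨e, he, .inl rfl⟩ hw⟩
      · exact ⟨_, htgt e he, rfl, fun w hw => hS.conn_of_touched ⟨e, he, .inr rfl⟩ hw⟩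
  refine ⟨Finset.subset_union_left, hinc, ?_, ⟨?_, ?_⟩⟩
  · intro a b hab
    obtain ⟨e, he, heq⟩ := Finset.mem_image.1 hab
    have h1 := hne e he
    rw [seg_eq, Sym2.eq_iff] at heq
    have h2 : (gridPt P e.src.1 e.src.2).1 = (gridPt P e.tgt.1 e.tgt.2).1 ∨
        (gridPt P e.src.1 e.src.2).2 = (gridPt P e.tgt.1 e.tgt.2).2 := by
      cases e
      exacts [.inl rfl, .inr rfl]
    rcases heq with ⟨rfl, rfl⟩ | ⟨rfl, rfl⟩
    · exact ⟨h1, h2⟩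
    · exact ⟨h1.symm, h2.imp Eq.symm Eq.symm⟩
  · -- connected
    have key : ∀ {u w}, Conn (S : Set GridEdge) u w → u = w ∨
        ∃ (hu : gridPt P u.1 u.2 ∈ (graphOf P (S.image (GridEdge.seg P))).verts)
          (hw : gridPt P w.1 w.2 ∈ (graphOf P (S.image (GridEdge.seg P))).verts),
        ((SimpleGraph.fromEdgeSet ((graphOf P (S.image (GridEdge.seg P))).edges :
          Set (Sym2 Pt))).induce ((graphOf P (S.image (GridEdge.seg P))).verts : Set Pt)).Reachable
          ⟨_, hu⟩ ⟨_, hw⟩ := by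
      intro u w h
      -- The alternative `u = w` gives reflexivity at grid vertices that are not vertices of the
      -- graph.
      refine h.lift (r := fun u w => u = w ∨
        ∃ (hu : gridPt P u.1 u.2 ∈ (graphOf P (S.image (GridEdge.seg P))).verts)
          (hw : gridPt P w.1 w.2 ∈ (graphOf P (S.image (GridEdge.seg P))).verts),
        ((SimpleGraph.fromEdgeSet ((graphOf P (S.image (GridEdge.seg P))).edges :
          Set (Sym2 Pt))).induce ((graphOf P (S.image (GridEdge.seg P))).verts : Set Pt)).Reachable
          ⟨_, hu⟩ ⟨_, hw⟩) ⟨fun _ => .inl rfl, ?_, ?_⟩ ?_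
      · rintro x y (rfl | ⟨h1, h2, h3⟩)
        exacts [.inl rfl, .inr ⟨h2, h1, h3.symm⟩]
      · rintro x y z (rfl | ⟨h1, h2, h3⟩) (rfl | ⟨h1', h2', h3'⟩)
        exacts [.inl rfl, .inr ⟨h1', h2', h3'⟩, .inr ⟨h1, h2, h3⟩, .inr ⟨h1, h2', h3.trans h3'⟩]
      · intro e he
        have hm : s(gridPt P e.src.1 e.src.2, gridPt P e.tgt.1 e.tgt.2) ∈
            S.image (GridEdge.seg P) := by
          rw [← seg_eq]
          exact Finset.mem_image_of_mem _ he
        refine .inr ⟨hinc _ hm _ (Sym2.mem_mk_left _ _), hinc _ hm _ (Sym2.mem_mk_right _ _), ?_⟩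
        apply SimpleGraph.Adj.reachable
        rw [SimpleGraph.induce_adj, SimpleGraph.fromEdgeSet_adj]
        exact ⟨hm, hne e he⟩
    obtain ⟨p, hp⟩ := hP
    obtain ⟨w, hw, hwp⟩ := exists_terminal hp
    rw [SimpleGraph.connected_iff_exists_forall_reachable]
    have hwm : gridPt P w.1 w.2 ∈ (graphOf P (S.image (GridEdge.seg P))).verts :=
      Finset.mem_union_left _ hw.2.2
    refine ⟨⟨_, hwm⟩, ?_⟩
    rintro ⟨a, ha⟩
    obtain ⟨u, -, rfl, hc⟩ := hverts a ha
    rcases key (hc w hw) with rfl | ⟨h1, h2, h3⟩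
    · exact SimpleGraph.Reachable.refl _
    · exact h3.symm
  · -- acyclic
    rw [SimpleGraph.isAcyclic_iff_forall_adj_isBridge]
    intro a b hab hreach
    -- The map `u` returns the indices of a grid point. It turns a connection that avoids the edge
    -- `a b` into one in `S \ {e}`, against `bridge`.
    let u : Pt → ℕ × ℕ := Function.invFunOn (fun u : ℕ × ℕ => gridPt P u.1 u.2) (gridVerts P)
    have hu : ∀ w ∈ gridVerts P, u (gridPt P w.1 w.2) = w := fun w hw =>
      (gridPt_injOn P).leftInvOn_invFunOn hw
    obtain ⟨e, he, heq⟩ := Finset.mem_image.1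
      ((SimpleGraph.fromEdgeSet_adj _).1 (SimpleGraph.induce_adj.1 hab)).1
    have hc : Conn ((S : Set GridEdge) \ {e}) (u a.1) (u b.1) := by
      refine reachable_lift (r := fun x y => Conn ((S : Set GridEdge) \ {e})
        (u x.1) (u y.1)) ⟨fun x => Conn.refl _ _, Conn.symm, Conn.trans⟩ ?_ hreach
      intro x y hxy
      rw [SimpleGraph.deleteEdges_adj] at hxy
      obtain ⟨e', he', heq'⟩ := Finset.mem_image.1
        ((SimpleGraph.fromEdgeSet_adj _).1 (SimpleGraph.induce_adj.1 hxy.1)).1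
      have hee : e' ≠ e := by
        rintro rfl
        apply hxy.2
        rw [heq, Sym2.eq_iff] at heq'
        rw [Set.mem_singleton_iff, Sym2.eq_iff]
        exact heq'.imp (fun h => ⟨Subtype.ext h.1.symm, Subtype.ext h.2.symm⟩)
          (fun h => ⟨Subtype.ext h.2.symm, Subtype.ext h.1.symm⟩)
      have hc' : Conn ((S : Set GridEdge) \ {e}) e'.src e'.tgt := Conn.of_mem ⟨he', hee⟩
      rw [seg_eq, Sym2.eq_iff] at heq'
      rcases heq' with ⟨h1, h2⟩ | ⟨h1, h2⟩
      · rw [← h1, ← h2, hu _ (hsrc e' he'), hu _ (htgt e' he')]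
        exact hc'
      · rw [← h1, ← h2, hu _ (hsrc e' he'), hu _ (htgt e' he')]
        exact hc'.symm
    rw [seg_eq, Sym2.eq_iff] at heq
    rcases heq with ⟨h1, h2⟩ | ⟨h1, h2⟩
    · rw [← h1, ← h2, hu _ (hsrc e he), hu _ (htgt e he)] at hc
      exact hS.bridge e he hc
    · rw [← h1, ← h2, hu _ (hsrc e he), hu _ (htgt e he)] at hc
      exact hS.bridge e he hc.symm

theorem length_graphOf {P : Finset Pt} {S : Finset GridEdge}
    (hS : ∀ e ∈ S, e ∈ gridEdges (numRows P) (numCols P)) :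
    (graphOf P (S.image (GridEdge.seg P))).length = ∑ e ∈ S, weight P e :=
  Finset.sum_image fun e he e' he' h => seg_injOn P (hS e he) (hS e' he') h

theorem IsMinConnecting.isShortestSteinerTree {P : Finset Pt} (hP : P.Nonempty)
    {S : Finset GridEdge} (hS : IsMinConnecting P S) :
    IsShortestSteinerTree P (graphOf P (S.image (GridEdge.seg P))) := by
  refine ⟨hS.isTight.isSteinerTree hP, fun T hT => ?_⟩
  obtain ⟨S', h1, h2⟩ := exists_isConnecting_of_isSteinerTree hP hT
  rw [length_graphOf hS.mem]
  exact (hS.le S' h1).trans h2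

theorem inHananGrid_graphOf {P : Finset Pt} {S : Finset GridEdge}
    (hS : ∀ e ∈ S, e ∈ gridEdges (numRows P) (numCols P)) :
    InHananGrid P (graphOf P (S.image (GridEdge.seg P))) := by
  intro s hs
  obtain ⟨e, he, rfl⟩ := Finset.mem_image.1 hs
  exact ⟨e, hS e he, rfl⟩

/-! ### The value of the dynamic program -/

theorem sum_chosen {P : Finset Pt} {es : List GridEdge} (hnd : es.Nodup) (bs : List Bool) :
    ∑ e ∈ (chosen es bs).toFinset, weight P e = cost P es bs :=
  List.sum_toFinset _ ((chosen_sublist es bs).nodup hnd)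

theorem gridEdges_eq_nil {h v : ℕ} (hh : 1 ≤ h) (hv : 1 ≤ v) :
    gridEdges h v = [] ↔ h = 1 ∧ v = 1 := by
  constructor
  · intro h0
    constructor
    · by_contra hne
      have := vert_mem_gridEdges (h := h) (v := v) (i := 0) (j := 0)
      rw [h0] at this
      simp at this
      omega
    · by_contra hne
      have := horiz_mem_gridEdges (h := h) (v := v) (i := 0) (j := 0)
      rw [h0] at this
      simp at this
      omega
  · rintro ⟨rfl, rfl⟩
    simp [gridEdges]

theorem isConnecting_of_accepts {P : Finset Pt} (hP : P.Nonempty) {bs : List Bool}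
    (hacc : Accepts P (gridEdges (numRows P) (numCols P)) ∅ bs) :
    IsConnecting P (chosen (gridEdges (numRows P) (numCols P)) bs).toFinset := by
  refine ⟨fun e he => (chosen_sublist _ _).subset (List.mem_toFinset.1 he), ?_⟩
  rw [List.coe_toFinset]
  exact connects_of_accepts hP hacc

/-- If the grid has an edge, `P` has at least two points, so every terminal is an end of an edge of
the connecting set. This is the remaining hypothesis of `accepts_of_isTight_aux`. -/
theorem accepts_of_isMinConnecting {P : Finset Pt} (hP : P.Nonempty)
    (hne : gridEdges (numRows P) (numCols P) ≠ [])
    {S : Finset GridEdge} (hS : IsMinConnecting P S) :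
    ∃ bs, Accepts P (gridEdges (numRows P) (numCols P)) ∅ bs ∧
      cost P (gridEdges (numRows P) (numCols P)) bs = ∑ e ∈ S, weight P e := by
  classical
  have hh : 1 ≤ numRows P := Finset.card_pos.2 (hP.image _)
  have hv : 1 ≤ numCols P := Finset.card_pos.2 (hP.image _)
  have htouch : ∀ u ∈ terminals P, Touched (S : Set GridEdge) u := by
    intro u hu
    have hother : ∃ w ∈ terminals P, w ≠ u := by
      by_contra hcon
      have huniq : ∀ p ∈ P, p = gridPt P u.1 u.2 := by
        intro p hp
        obtain ⟨w, hw, rfl⟩ := exists_terminal hp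
        by_cases hwu : w = u
        · rw [hwu]
        · exact absurd ⟨w, hw, hwu⟩ hcon
      refine hne ((gridEdges_eq_nil hh hv).2 ⟨le_antisymm ?_ hh, le_antisymm ?_ hv⟩)
      · refine Finset.card_le_one.2 ?_
        simp only [Finset.mem_image]
        rintro _ ⟨p, hp, rfl⟩ _ ⟨q, hq, rfl⟩
        rw [huniq p hp, huniq q hq]
      · refine Finset.card_le_one.2 ?_
        simp only [Finset.mem_image]
        rintro _ ⟨p, hp, rfl⟩ _ ⟨q, hq, rfl⟩
        rw [huniq p hp, huniq q hq]
    obtain ⟨w, hw, hwu⟩ := hother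
    rcases (hS.connects u hu w hw).eq_or_touched with h | h
    · exact absurd h.symm hwu
    · exact h.1
  have hempty : {e ∈ (S : Set GridEdge) | e ∉ gridEdges (numRows P) (numCols P)} = ∅ := by
    ext e
    simp only [Set.mem_ofPred_eq, Set.mem_empty_iff_false, iff_false, not_and, not_not]
    exact hS.mem e
  refine ⟨_, accepts_of_isTight_aux hS.isTight (exists_terminal_last_column hP) htouch
    (nodup_gridEdges _ _) (sched_gridEdges hv) (hempty ▸ describes_empty _ _), ?_⟩
  rw [← sum_chosen (nodup_gridEdges _ _), chosen_map_decide]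
  refine Finset.sum_congr ?_ fun _ _ => rfl
  ext e
  simp only [List.mem_toFinset, List.mem_filter, decide_eq_true_eq, Finset.mem_coe]
  exact ⟨fun h => h.2, fun h => ⟨hS.mem e h, h⟩⟩

theorem isMinConnecting_empty {P : Finset Pt}
    (h0 : gridEdges (numRows P) (numCols P) = []) :
    IsMinConnecting P ∅ := by
  obtain ⟨S, hS⟩ := exists_isMinConnecting P
  have : S = ∅ := Finset.eq_empty_of_forall_notMem fun e he => by
    have := hS.mem e he
    rw [h0] at this
    simp at this
  exact this ▸ hS

/-- An accepted run of least cost gives a shortest connecting set. -/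
theorem isMinConnecting_of_accepts {P : Finset Pt} (hP : P.Nonempty) {bs : List Bool}
    (hacc : Accepts P (gridEdges (numRows P) (numCols P)) ∅ bs)
    (hmin : ∀ bs', Accepts P (gridEdges (numRows P) (numCols P)) ∅ bs' →
      cost P (gridEdges (numRows P) (numCols P)) bs ≤
        cost P (gridEdges (numRows P) (numCols P)) bs') :
    IsMinConnecting P (chosen (gridEdges (numRows P) (numCols P)) bs).toFinset := by
  refine ⟨isConnecting_of_accepts hP hacc, fun S' hS' => ?_⟩
  rw [sum_chosen (nodup_gridEdges _ _)]
  by_cases h0 : gridEdges (numRows P) (numCols P) = []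
  · rw [h0]
    simp only [cost, chosen, List.map_nil, List.sum_nil]
    exact Finset.sum_nonneg fun e _ => weight_nonneg P e
  · obtain ⟨S, hS⟩ := exists_isMinConnecting P
    obtain ⟨bs', h1, h2⟩ := accepts_of_isMinConnecting hP h0 hS
    exact ((hmin bs' h1).trans h2.le).trans (hS.le S' hS')

/-! ### Table entries and accepted runs -/

theorem layer_succ_of_getElem? {P : Finset Pt} {l : ℕ} {e : GridEdge}
    (he : (gridEdges (numRows P) (numCols P))[l]? = some e) {ω' : FrontierState} :
    ω' ∈ layer P (l + 1) ↔ ∃ ω ∈ layer P l, ∃ b, Allowed P l e ω b ∧ step ω e b = ω' := by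
  classical
  simp only [layer, he, Finset.mem_image, Finset.mem_filter, Finset.mem_product, Finset.mem_univ,
    and_true, Prod.exists, and_assoc, exists_and_left]

open Classical in
theorem table_succ_of_getElem? {P : Finset Pt} {l : ℕ} {e : GridEdge}
    (he : (gridEdges (numRows P) (numCols P))[l]? = some e) (ω' : FrontierState) :
    table P (l + 1) ω' = ((layer P l ×ˢ (Finset.univ : Finset Bool)).filter fun q =>
        Allowed P l e q.1 q.2 ∧ step q.1 e q.2 = ω').inf
      fun q => table P l q.1 + (transCost P e q.2 : WithTop ℝ) := by
  simp only [table, he]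

/-- The decisions of the run are followed forward: each adds its cost to a bound for the entry of
the next layer, which is a minimum over all transitions into it. -/
theorem exists_table_le {P : Finset Pt} {es : List GridEdge} :
    ∀ {l : ℕ} {ω : FrontierState} {bs : List Bool},
      (gridEdges (numRows P) (numCols P)).drop l = es → l + es.length = lastLayer P →
      ω ∈ layer P l → Accepts P es ω bs → ∃ ω' ∈ layer P (lastLayer P),
        table P (lastLayer P) ω' ≤ table P l ω + (cost P es bs : WithTop ℝ) := by
  classical
  induction es with
  | nil =>
    intro l ω bs _ hl hω _
    rw [List.length_nil, add_zero] at hl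
    subst hl
    exact ⟨ω, hω, by simp [cost, chosen]⟩
  | cons e es ih =>
    intro l ω bs hdrop hl hω hacc
    cases bs with
    | nil => exact hacc.elim
    | cons b bs =>
      obtain ⟨hok, hacc⟩ := hacc
      have he : (gridEdges (numRows P) (numCols P))[l]? = some e := by
        rw [← List.head?_drop, hdrop, List.head?_cons]
      have hdrop' : (gridEdges (numRows P) (numCols P)).drop (l + 1) = es := by
        rw [← List.tail_drop, hdrop, List.tail_cons]
      rw [List.length_cons] at hl
      have hall : Allowed P l e ω b := by
        -- `Allowed` tests the final state at the last edge only, where `Accepts` leaves the empty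
        -- list and demands the same.
        refine ⟨hok, fun hlast => ?_⟩
        have : es = [] := List.eq_nil_of_length_eq_zero (by omega)
        subst this
        cases bs with
        | nil => exact hacc
        | cons _ _ => exact hacc.elim
      obtain ⟨ω', h1, h2⟩ := ih hdrop' (by omega)
        ((layer_succ_of_getElem? he).2 ⟨ω, hω, b, hall, rfl⟩) hacc
      refine ⟨ω', h1, h2.trans ?_⟩
      rw [cost_cons, WithTop.coe_add, ← add_assoc]
      gcongr
      rw [table_succ_of_getElem? he]
      exact Finset.inf_le (f := fun q : FrontierState × Bool =>
        table P l q.1 + (transCost P e q.2 : WithTop ℝ)) (b := (ω, b))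
        (Finset.mem_filter.2 ⟨Finset.mem_product.2 ⟨hω, Finset.mem_univ _⟩, hall, rfl⟩)

/-- A finite entry is attained, so the transitions that attain the minima can be followed back to
the empty state; the completion `bs` grows at its front. -/
theorem exists_accepts_of_table {P : Finset Pt} {l : ℕ} :
    ∀ {ω : FrontierState} {r : ℝ} {bs : List Bool}, table P l ω = (r : WithTop ℝ) →
      Accepts P ((gridEdges (numRows P) (numCols P)).drop l) ω bs →
      ∃ bs₀, Accepts P (gridEdges (numRows P) (numCols P)) ∅ bs₀ ∧
        cost P (gridEdges (numRows P) (numCols P)) bs₀ =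
          r + cost P ((gridEdges (numRows P) (numCols P)).drop l) bs := by
  classical
  induction l with
  | zero =>
    intro ω r bs hr hacc
    simp only [table] at hr
    split_ifs at hr with h0
    · subst h0
      have : r = 0 := by exact_mod_cast hr.symm
      exact ⟨bs, hacc, by simp [this]⟩
    · exact absurd hr.symm (WithTop.coe_ne_top)
  | succ l ih =>
    intro ω' r bs hr hacc
    cases he : (gridEdges (numRows P) (numCols P))[l]? with
    | none =>
      simp only [table, he] at hr
      exact absurd hr.symm (WithTop.coe_ne_top)
    | some e =>
      rw [table_succ_of_getElem? he] at hr
      have hne : ((layer P l ×ˢ (Finset.univ : Finset Bool)).filter fun q =>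
          Allowed P l e q.1 q.2 ∧ step q.1 e q.2 = ω').Nonempty := by
        rw [Finset.nonempty_iff_ne_empty]
        intro h0
        rw [h0, Finset.inf_empty] at hr
        exact absurd hr.symm (WithTop.coe_ne_top)
      obtain ⟨⟨ω, b⟩, hq, hinf⟩ := Finset.exists_mem_eq_inf _ hne
        fun q : FrontierState × Bool => table P l q.1 + (transCost P e q.2 : WithTop ℝ)
      rw [hinf] at hr
      obtain ⟨-, hall, rfl⟩ := Finset.mem_filter.1 hq
      obtain ⟨r', r'', hr', hr'', hsum⟩ := WithTop.add_eq_coe.1 hr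
      have hdrop : (gridEdges (numRows P) (numCols P)).drop l =
          e :: (gridEdges (numRows P) (numCols P)).drop (l + 1) := by
        obtain ⟨hlt, rfl⟩ := List.getElem?_eq_some_iff.1 he
        exact List.drop_eq_getElem_cons hlt
      obtain ⟨bs₀, h1, h2⟩ := ih (bs := b :: bs) hr'.symm (by
        rw [hdrop]
        exact ⟨hall.1, hacc⟩)
      refine ⟨bs₀, h1, ?_⟩
      have : transCost P e b = r'' := (WithTop.coe_inj.1 hr'').symm
      rw [h2, hdrop, cost_cons, this, ← hsum, add_assoc]

/-- The dynamic program finds the least length of a connecting set of grid edges. -/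
theorem dpValue_eq {P : Finset Pt} (hP : P.Nonempty) {S : Finset GridEdge}
    (hS : IsMinConnecting P S) : dpValue P = ((∑ e ∈ S, weight P e : ℝ) : WithTop ℝ) := by
  -- For a single point the first layer is the last one as well. Its only state is empty, and no
  -- transition tests the final condition.
  by_cases h0 : gridEdges (numRows P) (numCols P) = []
  · have hS0 : S = ∅ := Finset.eq_empty_of_forall_notMem fun e he => by
      have := hS.mem e he
      rw [h0] at this
      simp at this
    have hL : lastLayer P = 0 := by simp [lastLayer, h0]
    simp [dpValue, hL, layer, table, hS0]
  · have hL : 0 < lastLayer P := List.length_pos_of_ne_nil h0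
    apply le_antisymm
    · obtain ⟨bs, h1, h2⟩ := accepts_of_isMinConnecting hP h0 hS
      obtain ⟨ω', h3, h4⟩ := exists_table_le (l := 0) (ω := ∅) List.drop_zero
        (by simp [lastLayer]) (by simp [layer]) h1
      refine (Finset.inf_le h3).trans (h4.trans ?_)
      simp [table, h2]
    · refine Finset.le_inf fun ω hω => ?_
      cases hr : table P (lastLayer P) ω with
      | top => exact le_top
      | coe r =>
        obtain ⟨l, hl⟩ := Nat.exists_eq_succ_of_ne_zero hL.ne'
        have hlt : l < (gridEdges (numRows P) (numCols P)).length := by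
          have : lastLayer P = (gridEdges (numRows P) (numCols P)).length := rfl
          omega
        have he := List.getElem?_eq_getElem hlt
        have hω' := hω
        rw [hl] at hω'
        obtain ⟨ω₀, -, b, hall, rfl⟩ := (layer_succ_of_getElem? he).1 hω'
        -- The state was reached by an allowed last transition, so the empty completion is accepted.
        have hfin := hall.2 hl.symm
        have hdrop : (gridEdges (numRows P) (numCols P)).drop (lastLayer P) = [] := by
          simp [lastLayer]
        obtain ⟨bs, h1, h2⟩ := exists_accepts_of_table (bs := []) hr (by
          rw [hdrop]
          exact hfin)
        rw [hdrop] at h2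
        simp only [cost, chosen, List.map_nil, List.sum_nil, add_zero] at h2
        have h3 := hS.le _ (isConnecting_of_accepts hP h1)
        rw [sum_chosen (nodup_gridEdges _ _)] at h3
        have h4 : ∑ e ∈ S, weight P e ≤ r := by
          rw [← h2]
          exact h3
        exact_mod_cast h4

theorem exists_shortest_in_grid {P : Finset Pt} (hP : P.Nonempty) :
    ∃ T : PlaneGraph, IsShortestSteinerTree P T ∧ InHananGrid P T ∧
      dpValue P = (T.length : WithTop ℝ) := by
  obtain ⟨S, hS⟩ := exists_isMinConnecting P
  refine ⟨_, hS.isShortestSteinerTree hP, inHananGrid_graphOf hS.mem, ?_⟩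
  rw [dpValue_eq hP hS, length_graphOf hS.mem]

/-! ### Reasoning about programs -/

section Memory

variable (m : Mem) (a i k b j : ℕ) (r : ℝ)

@[simp] theorem nat_writeNat :
    (m.writeNat a i k).nat b j = if b = a ∧ j = i then k else m.nat b j := by
  by_cases hb : b = a
  · subst hb
    simp [Mem.writeNat, Function.update_apply]
  · simp [Mem.writeNat, hb]

@[simp] theorem real_writeNat : (m.writeNat a i k).real = m.real := rfl

@[simp] theorem nat_writeReal : (m.writeReal a i r).nat = m.nat := rfl

@[simp] theorem real_writeReal :
    (m.writeReal a i r).real b j = if b = a ∧ j = i then r else m.real b j := by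
  by_cases hb : b = a
  · subst hb
    simp [Mem.writeReal, Function.update_apply]
  · simp [Mem.writeReal, hb]

end Memory

/-- The scalar stored in cell `0` of a natural array. -/
abbrev NExpr.var (a : ℕ) : NExpr := .get a (.lit 0)

/-- Assignment to the scalar in cell `0` of a natural array. -/
abbrev Prog.setVar (a : ℕ) (x : NExpr) : Prog := .setNat a (.lit 0) x

attribute [simp] NExpr.eval RExpr.eval BExpr.eval

/-- The program may write to the natural array `a`. -/
def Prog.writesNat (a : ℕ) : Prog → Bool
  | .skip => false
  | .setNat b _ _ => a == b
  | .setReal _ _ _ => false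
  | .seq c d => c.writesNat a || d.writesNat a
  | .ite _ c d => c.writesNat a || d.writesNat a
  | .loop _ c => c.writesNat a

/-- The program may write to the real array `a`. -/
def Prog.writesReal (a : ℕ) : Prog → Bool
  | .skip => false
  | .setNat _ _ _ => false
  | .setReal b _ _ => a == b
  | .seq c d => c.writesReal a || d.writesReal a
  | .ite _ c d => c.writesReal a || d.writesReal a
  | .loop _ c => c.writesReal a

/-- The memories differ only in arrays to which the program may write. -/
structure Prog.Frame (c : Prog) (m m' : Mem) : Prop where
  nat : ∀ a, c.writesNat a = false → m'.nat a = m.nat a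
  real : ∀ a, c.writesReal a = false → m'.real a = m.real a

theorem Prog.Frame.refl (c : Prog) (m : Mem) : c.Frame m m := ⟨fun _ _ => rfl, fun _ _ => rfl⟩

theorem Prog.Frame.trans {c : Prog} {m m' m'' : Mem} (h : c.Frame m m') (h' : c.Frame m' m'') :
    c.Frame m m'' :=
  ⟨fun a ha => (h'.nat a ha).trans (h.nat a ha), fun a ha => (h'.real a ha).trans (h.real a ha)⟩

theorem Prog.Frame.mono {c d : Prog} {m m' : Mem} (h : c.Frame m m')
    (hn : ∀ a, d.writesNat a = false → c.writesNat a = false)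
    (hr : ∀ a, d.writesReal a = false → c.writesReal a = false) : d.Frame m m' :=
  ⟨fun a ha => h.nat a (hn a ha), fun a ha => h.real a (hr a ha)⟩

/-- Which arrays a program may write is computed from its text. For a concrete program and array,
preservation is therefore closed by `rfl`, and loop invariants need not mention it. -/
theorem Exec.frame {c : Prog} {m m' : Mem} {t : ℕ} (h : Exec c m m' t) : c.Frame m m' := by
  induction h with
  | skip m => exact .refl _ _
  | setNat m a i x =>
    refine ⟨fun b hb => ?_, fun _ _ => rfl⟩
    funext j
    have : b ≠ a := by simpa [Prog.writesNat] using hb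
    simp [this]
  | setReal m a i x =>
    refine ⟨fun _ _ => rfl, fun b hb => ?_⟩
    funext j
    have : b ≠ a := by simpa [Prog.writesReal] using hb
    simp [this]
  | seq _ _ ih ih' =>
    refine (ih.mono ?_ ?_).trans (ih'.mono ?_ ?_) <;> intro a ha <;>
      simp only [Prog.writesNat, Prog.writesReal, Bool.or_eq_false_iff] at ha
    exacts [ha.1, ha.1, ha.2, ha.2]
  | iteTrue _ _ ih =>
    refine ih.mono ?_ ?_ <;> intro a ha <;>
      simp only [Prog.writesNat, Prog.writesReal, Bool.or_eq_false_iff] at ha <;> exact ha.1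
  | iteFalse _ _ ih =>
    refine ih.mono ?_ ?_ <;> intro a ha <;>
      simp only [Prog.writesNat, Prog.writesReal, Bool.or_eq_false_iff] at ha <;> exact ha.2
  | loopDone _ => exact .refl _ _
  | @loopStep b c _ _ _ _ _ _ _ _ ih ih' =>
    exact Prog.Frame.trans (ih.mono (d := .loop b c) (fun _ h => h) (fun _ h => h)) ih'

/-- Started on `m`, the program halts after at most `T` steps with a memory that satisfies `Q`. -/
def Runs (c : Prog) (m : Mem) (T : ℕ) (Q : Mem → Prop) : Prop :=
  ∃ m' t, Exec c m m' t ∧ t ≤ T ∧ Q m'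

theorem Runs.mono {c : Prog} {m : Mem} {T T' : ℕ} {Q Q' : Mem → Prop} (h : Runs c m T Q)
    (hT : T ≤ T') (hQ : ∀ m', c.Frame m m' → Q m' → Q' m') : Runs c m T' Q' := by
  obtain ⟨m', t, h1, h2, h3⟩ := h
  exact ⟨m', t, h1, h2.trans hT, hQ m' h1.frame h3⟩

theorem Runs.mono_time {c : Prog} {m : Mem} {T T' : ℕ} {Q : Mem → Prop} (h : Runs c m T Q)
    (hT : T ≤ T') : Runs c m T' Q := h.mono hT fun _ _ h => h

theorem Runs.imp {c : Prog} {m : Mem} {T : ℕ} {Q Q' : Mem → Prop} (h : Runs c m T Q)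
    (hQ : ∀ m', c.Frame m m' → Q m' → Q' m') : Runs c m T Q' := h.mono le_rfl hQ

theorem Runs.seq {c d : Prog} {m : Mem} {T T' : ℕ} {R Q : Mem → Prop} (h : Runs c m T R)
    (h' : ∀ m', c.Frame m m' → R m' → Runs d m' T' Q) : Runs (.seq c d) m (T + T') Q := by
  obtain ⟨m', t, h1, h2, h3⟩ := h
  obtain ⟨m'', t', h4, h5, h6⟩ := h' m' h1.frame h3
  exact ⟨m'', t + t', .seq h1 h4, add_le_add h2 h5, h6⟩

/-- A bound on the running time of a program without loops. -/
def Prog.maxCost : Prog → ℕ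
  | .skip => 1
  | .setNat _ i x => i.cost + x.cost + 1
  | .setReal _ i x => i.cost + x.cost + 1
  | .seq c d => c.maxCost + d.maxCost
  | .ite b c d => b.cost + 1 + (c.maxCost + d.maxCost)
  | .loop _ _ => 0

/-- The weakest precondition of a program without loops. -/
@[simp] def Prog.wp : Prog → (Mem → Prop) → Mem → Prop
  | .skip, Q, m => Q m
  | .setNat a i x, Q, m => Q (m.writeNat a (i.eval m) (x.eval m))
  | .setReal a i x, Q, m => Q (m.writeReal a (i.eval m) (x.eval m))
  | .seq c d, Q, m => c.wp (fun m' => d.wp Q m') m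
  | .ite b c d, Q, m => (b.eval m → c.wp Q m) ∧ (¬ b.eval m → d.wp Q m)
  | .loop _ _, _, _ => False

/-- The precondition of a loop is `False`, so the value `0` of `maxCost` at loops never serves as a
bound. -/
theorem Runs.of_wp {c : Prog} {m : Mem} {Q : Mem → Prop} (h : c.wp Q m) :
    Runs c m c.maxCost Q := by
  induction c generalizing m Q with
  | skip => exact ⟨_, _, .skip m, le_rfl, h⟩
  | setNat a i x => exact ⟨_, _, .setNat m a i x, le_rfl, h⟩
  | setReal a i x => exact ⟨_, _, .setReal m a i x, le_rfl, h⟩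
  | seq c d ihc ihd => exact (ihc h).seq fun m' _ h' => ihd h'
  | ite b c d ihc ihd =>
    by_cases hb : b.eval m
    · obtain ⟨m', t, h1, h2, h3⟩ := ihc (h.1 hb)
      exact ⟨m', _, .iteTrue hb h1, by simp only [Prog.maxCost]; omega, h3⟩
    · obtain ⟨m', t, h1, h2, h3⟩ := ihd (h.2 hb)
      exact ⟨m', _, .iteFalse hb h1, by simp only [Prog.maxCost]; omega, h3⟩
  | loop b c => exact h.elim

theorem Runs.iteTrue {b : BExpr} {c d : Prog} {m : Mem} {T : ℕ} {Q : Mem → Prop}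
    (hb : b.eval m) (h : Runs c m T Q) : Runs (.ite b c d) m (b.cost + 1 + T) Q := by
  obtain ⟨m', t, h1, h2, h3⟩ := h
  exact ⟨m', _, .iteTrue hb h1, by omega, h3⟩

theorem Runs.iteFalse {b : BExpr} {c d : Prog} {m : Mem} {T : ℕ} {Q : Mem → Prop}
    (hb : ¬ b.eval m) (h : Runs d m T Q) : Runs (.ite b c d) m (b.cost + 1 + T) Q := by
  obtain ⟨m', t, h1, h2, h3⟩ := h
  exact ⟨m', _, .iteFalse hb h1, by omega, h3⟩

/-- A loop that is executed exactly `N` times. -/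
theorem Runs.loop {b : BExpr} {c : Prog} {m : Mem} {T : ℕ} (N : ℕ) (Inv : ℕ → Mem → Prop)
    (h0 : Inv 0 m)
    (hstep : ∀ k < N, ∀ m', c.Frame m m' → Inv k m' → b.eval m' ∧ Runs c m' T (Inv (k + 1)))
    (hend : ∀ m', c.Frame m m' → Inv N m' → ¬ b.eval m') :
    Runs (.loop b c) m ((N + 1) * (T + b.cost + 1)) (Inv N) := by
  -- Here `q` is the number of rounds still to come.
  have key : ∀ q ≤ N, ∀ m', c.Frame m m' → Inv (N - q) m' →
      Runs (.loop b c) m' ((q + 1) * (T + b.cost + 1)) (Inv N) := by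
    intro q
    induction q with
    | zero =>
      intro _ m' hF hI
      exact ⟨m', _, .loopDone (hend m' hF hI), by rw [zero_add, one_mul]; omega, hI⟩
    | succ q ih =>
      intro hq m' hF hI
      obtain ⟨hb, m'', t, h1, h2, h3⟩ := hstep (N - (q + 1)) (by omega) m' hF hI
      rw [show N - (q + 1) + 1 = N - q by omega] at h3
      obtain ⟨m₃, t', h4, h5, h6⟩ := ih (by omega) m'' (hF.trans h1.frame) h3
      refine ⟨m₃, _, .loopStep hb h1 h4, ?_, h6⟩
      rw [Nat.succ_mul (q + 1)]
      omega
  exact key N le_rfl m (.refl _ _) (by rwa [Nat.sub_self])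

/-- Executes `c` with the scalar `i` running through the numbers below `bound`. -/
def Prog.forLoop (i : ℕ) (bound : NExpr) (c : Prog) : Prog :=
  .seq (.setVar i (.lit 0))
    (.loop (.ltNat (.var i) bound) (.seq c (.setVar i (.add (.var i) (.lit 1)))))

/-- `Inv k` refers to the memory in which the counter has already been set to `k`. There are `B + 1`
tests; one more term in the time bound pays for setting the counter to `0`, and the constant `10`
covers the increment and the rest of the test. -/
theorem Runs.forLoop {i : ℕ} {bound : NExpr} {c : Prog} {m : Mem} {T : ℕ} (B : ℕ)
    (Inv : ℕ → Mem → Prop) (h0 : Inv 0 (m.writeNat i 0 0))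
    (hbound : ∀ k m', (Prog.forLoop i bound c).Frame m m' → Inv k m' → bound.eval m' = B)
    (hstep : ∀ k < B, ∀ m', (Prog.forLoop i bound c).Frame m m' → m'.nat i 0 = k → Inv k m' →
      Runs c m' T fun m'' => m''.nat i 0 = k ∧ Inv (k + 1) (m''.writeNat i 0 (k + 1))) :
    Runs (Prog.forLoop i bound c) m ((B + 2) * (T + bound.cost + 10)) (Inv B) := by
  have hfr : ∀ m', (Prog.seq c (.setVar i (.add (.var i) (.lit 1)))).Frame
      (m.writeNat i 0 0) m' → (Prog.forLoop i bound c).Frame m m' := by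
    intro m' h
    refine ⟨fun a ha => ?_, fun a ha => ?_⟩
    · simp only [Prog.forLoop, Prog.writesNat, Bool.or_eq_false_iff, beq_eq_false_iff_ne] at ha
      rw [h.nat a (by simp [Prog.writesNat, ha.1, ha.2])]
      funext j
      simp [ha.1]
    · simp only [Prog.forLoop, Prog.writesReal, Bool.false_or, Bool.or_false] at ha
      rw [h.real a (by simp [Prog.writesReal, ha])]
      rfl
  have hloop := Runs.loop (b := .ltNat (.var i) bound)
    (c := .seq c (.setVar i (.add (.var i) (.lit 1)))) (m := m.writeNat i 0 0) (T := T + 6) B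
    (fun k m' => m'.nat i 0 = k ∧ Inv k m') ⟨by simp, h0⟩
    (fun k hk m' hF hI => by
      refine ⟨?_, ?_⟩
      · simp only [BExpr.eval, NExpr.eval, hbound k m' (hfr m' hF) hI.2, hI.1]
        exact hk
      · refine (hstep k hk m' (hfr m' hF) hI.1 hI.2).seq (T' := 6) fun m'' _ h => ?_
        refine (Runs.of_wp (c := .setVar i (.add (.var i) (.lit 1))) ?_)
        simp only [Prog.wp, NExpr.eval, h.1]
        exact ⟨by simp, h.2⟩)
    (fun m' hF hI => by
      simp only [BExpr.eval, NExpr.eval, hbound B m' (hfr m' hF) hI.2, hI.1]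
      exact lt_irrefl B)
  have hset : Runs (.setVar i (.lit 0)) m 3 (fun m' => m' = m.writeNat i 0 0) :=
    ⟨_, _, .setNat m i (.lit 0) (.lit 0), le_rfl, rfl⟩
  refine (hset.seq (T' := (B + 1) * (T + 6 + (BExpr.ltNat (.var i) bound).cost + 1))
    (Q := Inv B) fun m' _ h => ?_).mono_time ?_
  · subst h
    exact hloop.imp fun _ _ h => h.2
  · simp only [BExpr.cost, NExpr.cost]
    have : (B + 2) * (T + bound.cost + 10) =
      (B + 1) * (T + bound.cost + 10) + (T + bound.cost + 10) := by ring
    rw [this]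
    have h2 : T + 6 + (1 + 1 + bound.cost + 1) + 1 = T + bound.cost + 10 := by ring
    rw [h2]
    omega

set_option linter.unusedSimpArgs false

/-! ### Decoding the number of a state

The program uses the following arrays of natural numbers, where scalars are kept in cell `0`:
`3` the number `h` of rows, `8`, `9`, `10` loop counters, `18` the powers of five, `20` the labels and
`21` the letters of the rows, `22` the value of `openTop` at the first row of each component, `23`
the current value of `openTop`, `24` the part of the code not yet decoded, `25` and `26` the current
letter and the current power of five. -/

/-- Subtracts the weight `26` from the number `24` if possible, and counts this in `25`. -/
def digitStepProg : Prog :=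
  .ite (.ltNat (.var 24) (.var 26)) .skip
    (.seq (.setVar 24 (.sub (.var 24) (.var 26))) (.setVar 25 (.add (.var 25) (.lit 1))))

/-- Extracts the leading digit `25` from the number `24`, where `26` is the weight of the digit. -/
def digitProg : Prog :=
  .seq (.setVar 25 (.lit 0)) (.seq digitStepProg (.seq digitStepProg
    (.seq digitStepProg digitStepProg)))

/-- Without division, a digit is found by repeated subtraction: after `k` rounds the remainder is
below the weight `p`, or `p` has been subtracted `k` times. Four rounds suffice for a digit below
five. -/
theorem wp_digitStepProg {m : Mem} {x p k : ℕ} (h : m.nat 26 0 = p ∧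
    x = m.nat 25 0 * p + m.nat 24 0 ∧ (m.nat 24 0 < p ∨ m.nat 25 0 = k)) :
    digitStepProg.wp (fun m' => m'.nat 26 0 = p ∧
      x = m'.nat 25 0 * p + m'.nat 24 0 ∧ (m'.nat 24 0 < p ∨ m'.nat 25 0 = k + 1)) m := by
  obtain ⟨rfl, h1, h2⟩ := h
  simp only [digitStepProg, Prog.wp, BExpr.eval, NExpr.eval, nat_writeNat]
  norm_num
  refine ⟨fun h => ⟨h1, .inl h⟩, fun h => ⟨?_, .inr (h2.resolve_left (by omega))⟩⟩
  rw [h1, add_one_mul]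
  omega

/-- The assumptions on the number are part of the postcondition, because the tables are computed for
all numbers below `5 ^ h`: the decoder must halt in time on each of them, but only codes of states
have to be decoded correctly. -/
theorem runs_digitProg (m : Mem) : Runs digitProg m digitProg.maxCost fun m' =>
    ∀ d r, d < 5 → r < m.nat 26 0 → m.nat 24 0 = d * m.nat 26 0 + r →
      m'.nat 25 0 = d ∧ m'.nat 24 0 = r := by
  have h0 : Runs (.setVar 25 (.lit 0)) m _ (fun m' => m'.nat 26 0 = m.nat 26 0 ∧
      m.nat 24 0 = m'.nat 25 0 * m.nat 26 0 + m'.nat 24 0 ∧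
      (m'.nat 24 0 < m.nat 26 0 ∨ m'.nat 25 0 = 0)) := Runs.of_wp (by simp)
  refine (h0.seq fun m₁ _ h => (Runs.of_wp (wp_digitStepProg h)).seq fun m₂ _ h =>
    (Runs.of_wp (wp_digitStepProg h)).seq fun m₃ _ h => (Runs.of_wp (wp_digitStepProg h)).seq
    fun m₄ _ h => Runs.of_wp (wp_digitStepProg h)).imp ?_
  rintro m' - ⟨-, h1, h2⟩ d r hd hr hdr
  rw [hdr] at h1
  generalize m.nat 26 0 = p at *
  generalize m'.nat 25 0 = d' at *
  generalize m'.nat 24 0 = r' at *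
  -- Uniqueness of division with remainder; if the remainder is not below `p`, four subtractions
  -- were made and `d' = 4`.
  have hd' : d' = d := by
    rcases lt_trichotomy d' d with h | h | h
    · exfalso
      have h3 : (d' + 1) * p ≤ d * p := Nat.mul_le_mul_right p h
      rw [add_one_mul] at h3
      rcases h2 with h2 | h2 <;> omega
    · exact h
    · exfalso
      have h3 : (d + 1) * p ≤ d' * p := Nat.mul_le_mul_right p h
      rw [add_one_mul] at h3
      omega
  subst hd'
  exact ⟨rfl, by omega⟩

/-- The part of the decoder that is executed for each row `8`. -/
def decodeBody : Prog :=
  .seq (.setVar 26 (.get 18 (.sub (.sub (.var 3) (.lit 1)) (.var 8)))) <|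
  .seq digitProg <|
  .seq (.setNat 21 (.var 8) (.var 25)) <|
  .ite (.ltNat (.var 25) (.lit 1)) (.setNat 20 (.var 8) (.lit 0)) <|
  .ite (.ltNat (.var 25) (.lit 3))
    (.seq (.setNat 20 (.var 8) (.add (.var 8) (.lit 1)))
      (.ite (.ltNat (.var 25) (.lit 2)) .skip
        (.seq (.setNat 22 (.add (.var 8) (.lit 1)) (.var 23))
          (.setVar 23 (.add (.var 8) (.lit 1))))))
    (.seq (.setNat 20 (.var 8) (.var 23))
      (.ite (.ltNat (.var 25) (.lit 4)) .skip (.setVar 23 (.get 22 (.var 23)))))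

/-- Computes the letters and labels of the state whose number is `c`. -/
def decode (c : NExpr) : Prog :=
  .seq (.setVar 24 c) (.seq (.setVar 23 (.lit 0)) (.forLoop 8 (.var 3) decodeBody))

/-- What the decoder has found after the first `k` rows. -/
structure DecodeInv (h : ℕ) (ω : FrontierState) (k : ℕ) (m : Mem) : Prop where
  rest : m.nat 24 0 < 5 ^ (h - k)
  code : code h ω = horner (digit ω) k * 5 ^ (h - k) + m.nat 24 0
  digit : ∀ j < k, m.nat 21 j = digit ω j
  label : ∀ j < k, m.nat 20 j = label ω j
  openTop : m.nat 23 0 = openTop ω k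
  parent : ∀ j < k, RST.digit ω j = 2 → m.nat 22 (j + 1) = RST.openTop ω j

/-- Together with `horner_lt_of_le`: the first `k` digits determine the number up to a remainder
below `5 ^ (h - k)`. -/
theorem horner_le (d : ℕ → ℕ) {k h : ℕ} (hk : k ≤ h) :
    horner d k * 5 ^ (h - k) ≤ horner d h := by
  induction h, hk using Nat.le_induction with
  | base => simp
  | succ h hk ih =>
    rw [Nat.succ_sub hk, pow_succ, horner, ← mul_assoc]
    omega

theorem horner_lt_of_le {d : ℕ → ℕ} (hd : ∀ k, d k < 5) {k h : ℕ} (hk : k ≤ h) :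
    horner d h < (horner d k + 1) * 5 ^ (h - k) := by
  induction h, hk using Nat.le_induction with
  | base => simp
  | succ h hk ih =>
    rw [Nat.succ_sub hk, pow_succ, horner, ← mul_assoc]
    have := hd h
    omega

/-- When a component ends, the decoder looks up array `22` at its label. As the first row of the
component has the letter `2`, that cell has been written. -/
theorem IsPartial.digit_label {h : ℕ} {ω : FrontierState} (hω : IsPartial h ω) {k : ℕ}
    (hk : RST.digit ω k = 4) : ∃ f < k, RST.label ω k = f + 1 ∧ RST.digit ω f = 2 := by
  have hkk : SameBlock ω k k := digit_ne_zero.1 (by omega)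
  obtain ⟨f, hf⟩ := exists_label hkk
  obtain ⟨h1, h2⟩ := label_spec hf
  have hp : HasPrev ω k := by
    by_contra hp
    unfold RST.digit at hk
    split_ifs at hk <;> omega
  obtain ⟨j, hj, hjk⟩ := hp
  have hfk : f < k := (h2 j hjk).trans_lt hj
  refine ⟨f, hfk, hf, ?_⟩
  have hp : ¬ HasPrev ω f := fun ⟨j, hj, hjf⟩ => (h2 j (hω.trans hjf h1)).not_gt hj
  have hx : HasNext ω f := ⟨k, hfk, h1⟩
  simp [RST.digit, hp, hx, h1.left]

/-- The undecoded rest has the letter of row `k` as its leading digit, with weight `5 ^ (h - 1 -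
k)`. -/
theorem DecodeInv.step {h : ℕ} {ω : FrontierState} {k : ℕ} (hk : k < h)
    {m : Mem} (hI : DecodeInv h ω k m) :
    ∃ r, r < 5 ^ (h - 1 - k) ∧ m.nat 24 0 = RST.digit ω k * 5 ^ (h - 1 - k) + r ∧
      RST.code h ω = horner (RST.digit ω) (k + 1) * 5 ^ (h - (k + 1)) + r := by
  have h1 := horner_le (RST.digit ω) (show k + 1 ≤ h from hk)
  have h2 := horner_lt_of_le (digit_lt ω) (show k + 1 ≤ h from hk)
  have h3 := hI.code
  have e1 : h - k = h - (k + 1) + 1 := by omega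
  have e2 : h - 1 - k = h - (k + 1) := by omega
  rw [e2]
  rw [e1, pow_succ, ← mul_assoc] at h3
  obtain ⟨r, hr⟩ := Nat.exists_eq_add_of_le h1
  change RST.code h ω = _ at hr
  rw [horner] at h1 h2 hr ⊢
  rw [add_mul, add_mul, one_mul] at h2
  rw [add_mul] at hr
  refine ⟨r, ?_, ?_, ?_⟩
  · change RST.code h ω < _ at h2
    omega
  · rw [hr] at h3
    have : 5 * horner (RST.digit ω) k * 5 ^ (h - (k + 1)) =
      horner (RST.digit ω) k * 5 ^ (h - (k + 1)) * 5 := by ring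
    omega
  · rw [add_mul]
    omega

theorem DecodeInv.succ {h : ℕ} {ω : FrontierState} {k r : ℕ} {m m' : Mem}
    (hI : DecodeInv h ω k m) (hr : r < 5 ^ (h - 1 - k))
    (hc : RST.code h ω = horner (RST.digit ω) (k + 1) * 5 ^ (h - (k + 1)) + r)
    (h24 : m'.nat 24 0 = r)
    (h21 : ∀ j, m'.nat 21 j = if j = k then RST.digit ω k else m.nat 21 j)
    (h20 : ∀ j, m'.nat 20 j = if j = k then RST.label ω k else m.nat 20 j)
    (h23 : m'.nat 23 0 = RST.openTop ω (k + 1))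
    (h22 : ∀ j < k, m'.nat 22 (j + 1) = m.nat 22 (j + 1))
    (h22' : RST.digit ω k = 2 → m'.nat 22 (k + 1) = RST.openTop ω k) :
    DecodeInv h ω (k + 1) m' where
  rest := by rw [h24, show h - (k + 1) = h - 1 - k by omega]; exact hr
  code := by rw [h24]; exact hc
  digit := fun j hj => by
    rw [h21]
    split_ifs with h0
    · rw [h0]
    · exact hI.digit j (by omega)
  label := fun j hj => by
    rw [h20]
    split_ifs with h0
    · rw [h0]
    · exact hI.label j (by omega)
  openTop := h23
  parent := fun j hj hd => by
    rcases (Nat.lt_succ_iff.1 hj).eq_or_lt with rfl | h0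
    · exact h22' hd
    · rw [h22 j h0]
      exact hI.parent j h0 hd

/-- The program evaluates the recursions `label_eq` and `openTop_succ`. Array `22` keeps the value
of `openTop` at the first row of each component with several rows, so closing a component is a
single lookup. -/
theorem runs_decodeBody {h k : ℕ} {m : Mem} (hk : k < h) (hh : m.nat 3 0 = h)
    (hpow : m.nat 18 (h - 1 - k) = 5 ^ (h - 1 - k)) (hk8 : m.nat 8 0 = k) :
    Runs decodeBody m decodeBody.maxCost fun m' => m'.nat 8 0 = k ∧
      ∀ ω ∈ stateSpace h, DecodeInv h ω k m → DecodeInv h ω (k + 1) m' := by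
  have h0 : Runs (.setVar 26 (.get 18 (.sub (.sub (.var 3) (.lit 1)) (.var 8)))) m _
      (fun m' => m' = m.writeNat 26 0 (5 ^ (h - 1 - k))) :=
    Runs.of_wp (by simp [hh, hk8, hpow])
  refine (h0.seq fun m₁ _ h1 => (runs_digitProg m₁).seq (T' := _)
    fun m₂ hF h2 => Runs.of_wp ?_)
  subst h1
  have e8 : m₂.nat 8 0 = k := by rw [hF.nat 8 rfl]; simpa using hk8
  have e20 : m₂.nat 20 = m.nat 20 := by rw [hF.nat 20 rfl]; funext j; simp
  have e21 : m₂.nat 21 = m.nat 21 := by rw [hF.nat 21 rfl]; funext j; simp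
  have e22 : m₂.nat 22 = m.nat 22 := by rw [hF.nat 22 rfl]; funext j; simp
  have e23 : m₂.nat 23 = m.nat 23 := by rw [hF.nat 23 rfl]; funext j; simp
  simp only [nat_writeNat, and_self, if_true, Nat.reduceEqDiff, false_and, if_false]
    at h2
  have hkey : ∀ ω ∈ stateSpace h, DecodeInv h ω k m → m₂.nat 25 0 = RST.digit ω k ∧
      m₂.nat 24 0 < 5 ^ (h - 1 - k) ∧
      RST.code h ω = horner (RST.digit ω) (k + 1) * 5 ^ (h - (k + 1)) + m₂.nat 24 0 := by
    intro ω hω hI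
    obtain ⟨r, h3, h4, h5⟩ := hI.step hk
    obtain ⟨h6, h7⟩ := h2 _ r (digit_lt ω k) h3 h4
    exact ⟨h6, h7 ▸ h3, h7 ▸ h5⟩
  generalize hd : m₂.nat 25 0 = d at hkey
  simp only [Prog.wp, BExpr.eval, NExpr.eval, nat_writeNat, e8, hd, true_and, and_self, if_true,
    Nat.reduceEqDiff, false_and, if_false, and_true, e20, e21, e22, e23]
  refine ⟨fun h3 => ?_, fun h3 => ⟨fun h4 => ⟨fun h5 => ?_, fun h5 => ?_⟩,
    fun h4 => ⟨fun h5 => ?_, fun h5 => ?_⟩⟩⟩ <;>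
  · intro ω hω hI
    obtain ⟨h6, h7, h8⟩ := hkey ω hω hI
    have hlt := digit_lt ω k
    obtain ⟨hp, hn⟩ := mem_stateSpace.1 hω
    have hl := hp.label_eq hn k
    have ho := hp.openTop_succ hn k
    have hpar := fun h0 => hp.digit_label (k := k) h0
    have htop := hI.openTop
    -- The outcomes of the tests leave exactly one letter; each alternative treats one.
    first
    | have h9 : RST.digit ω k = 0 := by omega
      rw [h9] at hl ho
      refine hI.succ h7 h8 ?_ ?_ ?_ ?_ ?_ ?_ <;> simp [h9, h6, hl, ho, htop, e20, e21, e22, e23]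
    | have h9 : RST.digit ω k = 1 := by omega
      rw [h9] at hl ho
      refine hI.succ h7 h8 ?_ ?_ ?_ ?_ ?_ ?_ <;> simp [h9, h6, hl, ho, htop, e20, e21, e22, e23]
    | have h9 : RST.digit ω k = 3 := by omega
      rw [h9] at hl ho
      refine hI.succ h7 h8 ?_ ?_ ?_ ?_ ?_ ?_ <;> simp [h9, h6, hl, ho, htop, e20, e21, e22, e23]
    | have h9 : RST.digit ω k = 2 := by omega
      rw [h9] at hl ho
      refine hI.succ h7 h8 ?_ ?_ ?_ ?_ ?_ ?_ <;> simp [h9, h6, hl, ho, htop, e20, e21, e22, e23]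
      intro j hj h10
      omega
    | have h9 : RST.digit ω k = 4 := by omega
      obtain ⟨f, hf, hf1, hf2⟩ := hpar h9
      have hf3 := hI.parent f hf hf2
      rw [h9] at hl ho
      simp only [OfNat.ofNat_ne_zero, if_false, Nat.reduceLT, Nat.reduceEqDiff, if_true] at hl ho
      rw [hf1, Nat.add_sub_cancel] at ho
      refine hI.succ h7 h8 ?_ ?_ ?_ ?_ ?_ ?_ <;>
        simp [h9, h6, ho, htop, e20, e21, e22, e23, hl.symm.trans hf1, hf1, hf3]

theorem runs_decode {h : ℕ} {m : Mem} (hh : m.nat 3 0 = h) (hpow : ∀ k < h, m.nat 18 k = 5 ^ k)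
    (c : NExpr) : Runs (decode c) m ((c.cost + decodeBody.maxCost + 30) * (h + 2)) fun m' =>
      ∀ ω ∈ stateSpace h, c.eval m = code h ω →
        ∀ k < h, m'.nat 20 k = label ω k ∧ m'.nat 21 k = digit ω k := by
  have h0 : Runs (.setVar 24 c) m _ (fun m' => m' = m.writeNat 24 0 (c.eval m)) :=
    Runs.of_wp (by simp)
  have h1 : ∀ m, Runs (.setVar 23 (.lit 0)) m _ (fun m' => m' = m.writeNat 23 0 0) :=
    fun m => Runs.of_wp (by simp)
  refine ((h0.seq fun m₁ _ e1 => (h1 m₁).seq fun m₂ _ e2 =>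
    Runs.forLoop (T := decodeBody.maxCost) h (fun k m' =>
    ∀ ω ∈ stateSpace h, c.eval m = code h ω → DecodeInv h ω k m') ?_ ?_ ?_)).mono
    (T := _) (Q := fun m' => ∀ ω ∈ stateSpace h, c.eval m = code h ω → DecodeInv h ω h m') ?_ ?_
  · intro ω hω hc
    subst e1 e2
    refine ⟨?_, ?_, by simp, by simp, ?_, by simp⟩
    · simpa [hc] using code_lt h ω
    · simp [hc, horner]
    · simp [openTop_zero]
  · intro k m' hF hI
    subst e1 e2
    simp only [NExpr.eval]
    rw [hF.nat 3 rfl]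
    simpa using hh
  · intro k hk m' hF hk8 hI
    subst e1 e2
    refine (runs_decodeBody hk ?_ ?_ hk8).imp fun m'' hF' h => ⟨h.1, ?_⟩
    · rw [hF.nat 3 rfl]
      simpa using hh
    · rw [hF.nat 18 rfl]
      simpa using hpow _ (by omega)
    · intro ω hω hc
      have := h.2 ω hω (hI ω hω hc)
      exact ⟨by simpa using this.rest, by simpa using this.code, by simpa using this.digit,
        by simpa using this.label, by simpa using this.openTop, by simpa using this.parent⟩
  · simp only [Prog.maxCost, NExpr.cost]
    nlinarith
  · intro m' _ hI ω hω hc k hk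
    exact ⟨(hI ω hω hc).label k hk, (hI ω hω hc).digit k hk⟩

set_option linter.unusedSimpArgs false

/-! ### Encoding the successors of a state

Further arrays: `27` a label, `28` the new labels, `29` and `30` the last and the first row of a
label, `31` the code; `45` to `49` the parameters of `relabelWith`. -/

/-- Equality of numbers as a test. -/
def BExpr.eq (x y : NExpr) : BExpr := .and (.not (.ltNat x y)) (.not (.ltNat y x))

def BExpr.or (b c : BExpr) : BExpr := .not (.and (.not b) (.not c))

@[simp] theorem BExpr.eval_eq (m : Mem) (x y : NExpr) :
    (BExpr.eq x y).eval m ↔ x.eval m = y.eval m := by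
  simp only [BExpr.eq, BExpr.eval]
  omega

@[simp] theorem BExpr.eval_or (m : Mem) (b c : BExpr) :
    (BExpr.or b c).eval m ↔ b.eval m ∨ c.eval m := by
  simp only [BExpr.or, BExpr.eval]
  tauto

/-- A common form of the changes of the labels. -/
def relabelWith (p p' a b z : ℕ) (f : ℕ → ℕ) (k : ℕ) : ℕ :=
  if k = p ∨ k = p' ∨ (0 < f k ∧ (f k = a ∨ f k = b)) then z else f k

/-- Computes the new labels. -/
def relabelBody : Prog :=
  .seq (.setVar 27 (.get 20 (.var 8))) <|
  .seq (.ite (.or (.eq (.var 8) (.var 45)) (.or (.eq (.var 8) (.var 46))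
      (.and (.ltNat (.lit 0) (.var 27)) (.or (.eq (.var 27) (.var 47)) (.eq (.var 27) (.var 48))))))
    (.setVar 27 (.var 49)) .skip) <|
  .seq (.setNat 28 (.var 8) (.var 27)) (.setNat 29 (.var 27) (.var 8))

/-- Computes the first row of each label, going through the rows from top to bottom. -/
def firstBody : Prog :=
  .seq (.setVar 26 (.sub (.sub (.var 3) (.lit 1)) (.var 8)))
    (.setNat 30 (.get 28 (.var 26)) (.var 26))

/-- Computes the letter of a row from the first and the last row of its label. -/
def codeBody : Prog :=
  -- Multiplication by five, written as a sum; the letter is added below.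
  .seq (.setVar 31 (.add (.var 31) (.add (.var 31) (.add (.var 31) (.add (.var 31) (.var 31)))))) <|
  .seq (.setVar 27 (.get 28 (.var 8))) <|
  .ite (.ltNat (.lit 0) (.var 27))
    (.ite (.ltNat (.get 30 (.var 27)) (.var 8))
      (.ite (.ltNat (.var 8) (.get 29 (.var 27))) (.setVar 31 (.add (.var 31) (.lit 3)))
        (.setVar 31 (.add (.var 31) (.lit 4))))
      (.ite (.ltNat (.var 8) (.get 29 (.var 27))) (.setVar 31 (.add (.var 31) (.lit 2)))
        (.setVar 31 (.add (.var 31) (.lit 1)))))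
    .skip

/-- Computes the code of the state with the changed labels. -/
def encode : Prog :=
  .seq (.forLoop 8 (.var 3) relabelBody) <| .seq (.forLoop 8 (.var 3) firstBody) <|
  .seq (.setVar 31 (.lit 0)) (.forLoop 8 (.var 3) codeBody)

/-- Every row overwrites the cell of its label in array `29`, so the last row with that label
remains. Values left from earlier calls do no harm: only cells of labels that occur are considered,
and these have been overwritten. -/
theorem runs_relabelLoop {h : ℕ} {m : Mem} (hh : m.nat 3 0 = h) {f : ℕ → ℕ}
    (hf : f = relabelWith (m.nat 45 0) (m.nat 46 0) (m.nat 47 0) (m.nat 48 0) (m.nat 49 0)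
      (m.nat 20)) :
    Runs (.forLoop 8 (.var 3) relabelBody) m ((h + 2) * (relabelBody.maxCost + 2 + 10)) fun m' =>
      ∀ q < h, m'.nat 28 q = f q ∧ q ≤ m'.nat 29 (f q) ∧ m'.nat 29 (f q) < h ∧
        f (m'.nat 29 (f q)) = f q := by
  refine Runs.forLoop (T := relabelBody.maxCost) h (fun k m' => ∀ q < k, m'.nat 28 q = f q ∧
    q ≤ m'.nat 29 (f q) ∧ m'.nat 29 (f q) < k ∧ f (m'.nat 29 (f q)) = f q) (by simp) ?_ ?_
  · intro k m' hF _
    simp only [NExpr.eval]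
    rw [hF.nat 3 rfl, hh]
  · intro k hk m' hF hk8 hI
    apply Runs.of_wp
    have e20 := hF.nat 20 rfl
    have e45 := hF.nat 45 rfl
    have e46 := hF.nat 46 rfl
    have e47 := hF.nat 47 rfl
    have e48 := hF.nat 48 rfl
    have e49 := hF.nat 49 rfl
    have key : ∀ x, x = f k → ∀ q ≤ k,
        (if q = k then x else m'.nat 28 q) = f q ∧
        q ≤ (if f q = x then k else m'.nat 29 (f q)) ∧
        (if f q = x then k else m'.nat 29 (f q)) ≤ k ∧
        f (if f q = x then k else m'.nat 29 (f q)) = f q := by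
      rintro x rfl q hq
      by_cases hqk : q = k
      · subst hqk
        simp
      · obtain ⟨h1, h2, h3, h4⟩ := hI q (by omega)
        rw [if_neg hqk]
        refine ⟨h1, ?_⟩
        split_ifs with h5
        · exact ⟨by omega, by omega, h5.symm⟩
        · exact ⟨h2, by omega, h4⟩
    have hfk : f k = if k = m.nat 45 0 ∨ k = m.nat 46 0 ∨ (0 < m.nat 20 k ∧
        (m.nat 20 k = m.nat 47 0 ∨ m.nat 20 k = m.nat 48 0)) then m.nat 49 0 else m.nat 20 k := by
      rw [hf]; rfl
    simp [relabelBody, hk8, e20, e45, e46, e47, e48, e49]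
    refine ⟨fun hc => key _ ?_, fun h1 h2 h3 => key _ ?_⟩
    · rw [hfk, if_pos hc]
    · rw [hfk, if_neg]
      rintro (h | h | ⟨h, h' | h'⟩)
      exacts [h1 h, h2 h, (h3 h).1 h', (h3 h).2 h']

/-- The same device in the opposite direction: round `k` treats row `h - 1 - k`, so the first row
with a label is written last. -/
theorem runs_firstLoop {h : ℕ} {m : Mem} (hh : m.nat 3 0 = h) {f : ℕ → ℕ}
    (hf : ∀ q < h, m.nat 28 q = f q) :
    Runs (.forLoop 8 (.var 3) firstBody) m ((h + 2) * (firstBody.maxCost + 2 + 10)) fun m' =>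
      ∀ q < h, m'.nat 30 (f q) ≤ q ∧ f (m'.nat 30 (f q)) = f q := by
  refine (Runs.forLoop (T := firstBody.maxCost) h (fun k m' => ∀ q, h - k ≤ q → q < h →
    h - k ≤ m'.nat 30 (f q) ∧ m'.nat 30 (f q) ≤ q ∧ f (m'.nat 30 (f q)) = f q)
    ?_ ?_ ?_).imp fun m' _ hI q hq => (hI q (by omega) hq).2
  · intro q hq hq'
    omega
  · intro k m' hF _
    simp only [NExpr.eval]
    rw [hF.nat 3 rfl, hh]
  · intro k hk m' hF hk8 hI
    apply Runs.of_wp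
    have e3 := hF.nat 3 rfl
    have e28 := hF.nat 28 rfl
    simp [firstBody, hk8, e3, hh, e28]
    rw [hf _ (by omega)]
    intro q hq hq'
    split_ifs with h1
    · rw [h1]
      refine ⟨by omega, ?_, rfl⟩
      rcases Nat.lt_or_ge q (h - k) with h2 | h2
      · omega
      · omega
    · have hne : q ≠ h - 1 - k := fun h0 => h1 (by rw [h0])
      obtain ⟨h2, h3, h4⟩ := hI q (by omega) hq'
      exact ⟨by omega, h3, h4⟩

theorem digitOf_eq {h : ℕ} {f first last : ℕ → ℕ} {k : ℕ} (hk : k < h)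
    (hfirst : ∀ q < h, first (f q) ≤ q ∧ f (first (f q)) = f q)
    (hlast : ∀ q < h, q ≤ last (f q) ∧ last (f q) < h ∧ f (last (f q)) = f q) :
    digitOf h f k = if f k = 0 then 0
      else if first (f k) < k then if k < last (f k) then 3 else 4
      else if k < last (f k) then 2 else 1 := by
  have h1 : (∃ j < k, f j = f k) ↔ first (f k) < k := by
    constructor
    · rintro ⟨j, hj, hjk⟩
      rw [← hjk]
      exact (hfirst j (hj.trans hk)).1.trans_lt hj
    · exact fun h => ⟨_, h, (hfirst k hk).2⟩
  have h2 : (∃ j, k < j ∧ j < h ∧ f j = f k) ↔ k < last (f k) := by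
    constructor
    · rintro ⟨j, hj, hjh, hjk⟩
      rw [← hjk]
      exact hj.trans_le (hlast j hjh).1
    · exact fun h => ⟨_, h, (hlast k hk).2⟩
  unfold digitOf
  simp only [h1, h2]

theorem runs_codeLoop {h : ℕ} {m : Mem} (hh : m.nat 3 0 = h) {f : ℕ → ℕ}
    (hf : ∀ q < h, m.nat 28 q = f q) (h31 : m.nat 31 0 = 0)
    (hfirst : ∀ q < h, m.nat 30 (f q) ≤ q ∧ f (m.nat 30 (f q)) = f q)
    (hlast : ∀ q < h, q ≤ m.nat 29 (f q) ∧ m.nat 29 (f q) < h ∧ f (m.nat 29 (f q)) = f q) :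
    Runs (.forLoop 8 (.var 3) codeBody) m ((h + 2) * (codeBody.maxCost + 2 + 10)) fun m' =>
      m'.nat 31 0 = horner (digitOf h f) h := by
  refine Runs.forLoop (T := codeBody.maxCost) h
    (fun k m' => m'.nat 31 0 = horner (digitOf h f) k) (by simp [horner, h31]) ?_ ?_
  · intro k m' hF _
    simp only [NExpr.eval]
    rw [hF.nat 3 rfl, hh]
  · intro k hk m' hF hk8 hI
    apply Runs.of_wp
    have e28 := hF.nat 28 rfl
    have e29 := hF.nat 29 rfl
    have e30 := hF.nat 30 rfl
    simp only [horner]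
    rw [digitOf_eq hk hfirst hlast]
    simp [codeBody, hk8, e28, e29, e30, hf k hk, hI]
    refine ⟨fun h0 => ⟨fun h1 => ⟨fun h2 => ?_, fun h2 => ?_⟩,
      fun h1 => ⟨fun h2 => ?_, fun h2 => ?_⟩⟩, fun h0 => ?_⟩
    · rw [if_neg (by omega), if_pos h1, if_pos h2]; ring
    · rw [if_neg (by omega), if_pos h1, if_neg (by omega)]; ring
    · rw [if_neg (by omega), if_neg (by omega), if_pos h2]; ring
    · rw [if_neg (by omega), if_neg (by omega), if_neg (by omega)]; ring
    · rw [if_pos h0]; ring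

theorem runs_encode {h : ℕ} {m : Mem} (hh : m.nat 3 0 = h) :
    Runs encode m ((relabelBody.maxCost + firstBody.maxCost + codeBody.maxCost + 60) * (h + 2))
      fun m' => m'.nat 31 0 = horner (digitOf h (relabelWith (m.nat 45 0) (m.nat 46 0)
        (m.nat 47 0) (m.nat 48 0) (m.nat 49 0) (m.nat 20))) h := by
  have h1 : ∀ m, Runs (.setVar 31 (.lit 0)) m _ (fun m' => m' = m.writeNat 31 0 0) :=
    fun m => Runs.of_wp (by simp)
  refine ((runs_relabelLoop hh rfl).seq fun m₁ hF₁ hI₁ =>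
    (runs_firstLoop (h := h) ?_ fun q hq => (hI₁ q hq).1).seq fun m₂ hF₂ hI₂ =>
    (h1 m₂).seq fun m₃ _ e₃ => runs_codeLoop ?_ ?_ ?_ ?_ ?_).mono_time ?_
  · rw [hF₁.nat 3 rfl, hh]
  · subst e₃
    simp only [nat_writeNat]
    norm_num
    rw [hF₂.nat 3 rfl, hF₁.nat 3 rfl, hh]
  · subst e₃
    intro q hq
    simp only [nat_writeNat]
    norm_num
    rw [hF₂.nat 28 rfl]
    exact (hI₁ q hq).1
  · subst e₃
    simp
  · subst e₃
    intro q hq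
    simpa using hI₂ q hq
  · subst e₃
    intro q hq
    simp only [nat_writeNat]
    norm_num
    rw [hF₂.nat 29 rfl]
    exact (hI₁ q hq).2
  · simp only [Prog.maxCost, NExpr.cost]
    nlinarith

set_option linter.unusedSimpArgs false

/-! ### The tables of transitions

The programs use `17` for the number `N = 5 ^ h`, `15` for the array of the numbers `i * N`, and `32`
for the address of the entry for row `i` and code `c` in the tables `33` to `36`. -/

theorem nat_writeNat_of_ne (m : Mem) {a b : ℕ} (i k : ℕ) (h : b ≠ a) :
    (m.writeNat a i k).nat b = m.nat b := by
  funext j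
  simp [h]

theorem IsLabelling.congr {h : ℕ} {ω : FrontierState} {f g : ℕ → ℕ} (hf : IsLabelling h ω f)
    (hg : ∀ k < h, g k = f k) : IsLabelling h ω g := by
  intro a ha b hb
  rw [hf a ha b hb, hg a ha, hg b hb]

section Codes

variable {h : ℕ} {ω : FrontierState} {f : ℕ → ℕ} {i : ℕ}

theorem code_step_link (hω : IsPartial h ω) (hf : ∀ k < h, f k = label ω k) (hi : i + 1 < h)
    (j : ℕ) (hs : IsPartial h (step ω (.vert i j) true)) :
    horner (digitOf h (relabelWith i (i + 1) (f i) (f (i + 1)) (i + 1) f)) h =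
      code h (step ω (.vert i j) true) := by
  refine (((hω.isLabelling_link i j).congr fun k hk => ?_).code_eq hs).symm
  simp only [relabelWith, relabelLink, hf k hk, hf i (by omega), hf (i + 1) hi, Nat.pos_iff_ne_zero]

/-- With `a = b = 0` the clause of `relabelWith` about labels is void, since it asks for a positive
label; only row `i` changes. -/
theorem code_step_erase (hω : IsPartial h ω) (hf : ∀ k < h, f k = label ω k)
    (j : ℕ) (hs : IsPartial h (step ω (.horiz i j) false)) :
    horner (digitOf h (relabelWith i i 0 0 0 f)) h = code h (step ω (.horiz i j) false) := by
  refine (((hω.isLabelling_erase i j).congr fun k hk => ?_).code_eq hs).symm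
  simp only [relabelWith, relabelErase, hf k hk]
  by_cases hki : k = i <;> simp [hki]
  omega

/-- The new value at row `i` is its old label if there is one, so a row of positive degree is left
as it is. -/
theorem code_step_insert (hω : IsPartial h ω) (hf : ∀ k < h, f k = label ω k) (hi : i < h)
    (j : ℕ) (hs : IsPartial h (step ω (.horiz i j) true)) :
    horner (digitOf h (relabelWith i i 0 0 (if f i = 0 then i + 1 else f i) f)) h =
      code h (step ω (.horiz i j) true) := by
  refine (((hω.isLabelling_insert i j).congr fun k hk => ?_).code_eq hs).symm
  simp only [relabelWith, relabelInsert, hf k hk, hf i hi]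
  by_cases hki : k = i
  · subst hki
    simp
  · simp [hki]
    omega

end Codes

/-- Codes are stored increased by `1`, because `0` is to mark an impossible transition. -/
theorem runs_encodeTo {S : Prog} {t h p p' a b z : ℕ} {m : Mem}
    (hS : S.wp (fun m' => m'.nat 45 0 = p ∧ m'.nat 46 0 = p' ∧ m'.nat 47 0 = a ∧
      m'.nat 48 0 = b ∧ m'.nat 49 0 = z) m)
    (h3 : S.writesNat 3 = false) (h20 : S.writesNat 20 = false) (h32 : S.writesNat 32 = false)
    (ht : S.writesNat t = false) (ht' : encode.writesNat t = false) (hh : m.nat 3 0 = h) :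
    Runs (.seq S (.seq encode (.setNat t (.var 32) (.add (.var 31) (.lit 1))))) m
      (S.maxCost + ((relabelBody.maxCost + firstBody.maxCost + codeBody.maxCost + 60) * (h + 2) + 7))
      fun m' => m'.nat t = Function.update (m.nat t) (m.nat 32 0)
        (horner (digitOf h (relabelWith p p' a b z (m.nat 20))) h + 1) := by
  refine (Runs.of_wp hS).seq fun m₁ hF₁ e₁ =>
    ((runs_encode (by rw [hF₁.nat 3 h3, hh])).seq (T' := 7) fun m₂ hF₂ e₂ =>
      (Runs.of_wp (c := .setNat t (.var 32) (.add (.var 31) (.lit 1))) ?_).mono_time le_rfl)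
  obtain ⟨e45, e46, e47, e48, e49⟩ := e₁
  rw [e45, e46, e47, e48, e49, hF₁.nat 20 h20] at e₂
  funext x
  simp only [Prog.wp, NExpr.eval, nat_writeNat, e₂, true_and, Function.update_apply,
    hF₂.nat t ht', hF₁.nat t ht, hF₂.nat 32 rfl, hF₁.nat 32 h32]

def linkParams : Prog :=
  .seq (.setVar 45 (.var 9)) <| .seq (.setVar 46 (.add (.var 9) (.lit 1))) <|
  .seq (.setVar 47 (.get 20 (.var 9))) <|
  .seq (.setVar 48 (.get 20 (.add (.var 9) (.lit 1)))) (.setVar 49 (.add (.var 9) (.lit 1)))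

def eraseParams : Prog :=
  .seq (.setVar 45 (.var 9)) <| .seq (.setVar 46 (.var 9)) <| .seq (.setVar 47 (.lit 0)) <|
  .seq (.setVar 48 (.lit 0)) (.setVar 49 (.lit 0))

def insertParams : Prog :=
  .seq (.setVar 45 (.var 9)) <| .seq (.setVar 46 (.var 9)) <| .seq (.setVar 47 (.lit 0)) <|
  .seq (.setVar 48 (.lit 0)) <| .ite (.eq (.get 20 (.var 9)) (.lit 0))
    (.setVar 49 (.add (.var 9) (.lit 1))) (.setVar 49 (.get 20 (.var 9)))

/-- Removes the codes of infeasible successors from the tables. -/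
def feasibleBody : Prog :=
  .seq (.ite (.and (.ltNat (.lit 0) (.get 20 (.var 9)))
      (.eq (.get 20 (.var 9)) (.get 20 (.add (.var 9) (.lit 1)))))
    (.setNat 33 (.var 32) (.lit 0)) .skip) <|
  .seq (.ite (.eq (.get 21 (.var 9)) (.lit 1)) (.setNat 34 (.var 32) (.lit 0)) .skip)
    (.setNat 36 (.var 32) (.get 21 (.var 9)))

/-- Computes the table entries for row `9` and code `10`. -/
def tableBody : Prog :=
  .seq (.setVar 32 (.add (.get 15 (.var 9)) (.var 10))) <| .seq (decode (.var 10)) <|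
  .seq (.seq linkParams (.seq encode (.setNat 33 (.var 32) (.add (.var 31) (.lit 1))))) <|
  .seq (.seq eraseParams (.seq encode (.setNat 34 (.var 32) (.add (.var 31) (.lit 1))))) <|
  .seq (.seq insertParams (.seq encode (.setNat 35 (.var 32) (.add (.var 31) (.lit 1)))))
  feasibleBody

/-- Computes the tables. -/
def tables : Prog := .forLoop 9 (.var 3) (.forLoop 10 (.var 17) tableBody)

open Classical in
/-- The table entries at address `x` are those for row `i` of the state `ω`. -/
structure TableEntry (h : ℕ) (ω : FrontierState) (i x : ℕ) (m : Mem) : Prop where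
  link : i + 1 < h → m.nat 33 x =
    if SameBlock ω i (i + 1) then 0 else code h (step ω (.vert i 0) true) + 1
  erase : m.nat 34 x = if {i} ∈ ω then 0 else code h (step ω (.horiz i 0) false) + 1
  insert : m.nat 35 x = code h (step ω (.horiz i 0) true) + 1
  digit : m.nat 36 x = digit ω i

theorem TableEntry.congr {h : ℕ} {ω : FrontierState} {i x : ℕ} {m m' : Mem}
    (hI : TableEntry h ω i x m) (h33 : m'.nat 33 x = m.nat 33 x) (h34 : m'.nat 34 x = m.nat 34 x)
    (h35 : m'.nat 35 x = m.nat 35 x) (h36 : m'.nat 36 x = m.nat 36 x) :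
    TableEntry h ω i x m' :=
  ⟨fun hi => h33.trans (hI.link hi), h34.trans hI.erase, h35.trans hI.insert, h36.trans hI.digit⟩

/-- One decoding serves all three successors, since `encode` does not touch the decoded labels and
letters. The entry for linking is meaningless in the top row, where `TableEntry.link` claims
nothing. -/
theorem exists_runs_tableBody : ∃ K, ∀ (h i c : ℕ) (m : Mem), i < h → m.nat 3 0 = h →
    (∀ k < h, m.nat 18 k = 5 ^ k) → m.nat 9 0 = i → m.nat 10 0 = c →
    Runs tableBody m (K * (h + 2)) fun m' =>
      (∀ ω ∈ stateSpace h, code h ω = c → TableEntry h ω i (m.nat 15 i + c) m') ∧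
      ∀ x ≠ m.nat 15 i + c, m'.nat 33 x = m.nat 33 x ∧ m'.nat 34 x = m.nat 34 x ∧
        m'.nat 35 x = m.nat 35 x ∧ m'.nat 36 x = m.nat 36 x := by
  refine ⟨decodeBody.maxCost + 3 * (relabelBody.maxCost + firstBody.maxCost +
        codeBody.maxCost + 60) + linkParams.maxCost + eraseParams.maxCost + insertParams.maxCost +
        feasibleBody.maxCost + 100, fun h i c m hi hh hpow h9 h10 => ?_⟩
  have h0 : Runs (.setVar 32 (.add (.get 15 (.var 9)) (.var 10))) m _
    (fun m' => m' = m.writeNat 32 0 (m.nat 15 i + c)) := Runs.of_wp (by simp [h9, h10])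
  refine (h0.seq fun m₁ _ e₁ => (runs_decode (h := h) ?_ ?_ (.var 10)).seq fun m₂ hF₂ e₂ =>
    (runs_encodeTo (h := h) (p := i) (p' := i + 1) (a := m₂.nat 20 i) (b := m₂.nat 20 (i + 1))
      (z := i + 1) ?_ rfl rfl rfl rfl rfl ?_).seq fun m₃ hF₃ e₃ =>
    (runs_encodeTo (h := h) (p := i) (p' := i) (a := 0) (b := 0) (z := 0)
      ?_ rfl rfl rfl rfl rfl ?_).seq fun m₄ hF₄ e₄ =>
    (runs_encodeTo (h := h) (p := i) (p' := i) (a := 0) (b := 0)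
      (z := if m₂.nat 20 i = 0 then i + 1 else m₂.nat 20 i)
      ?_ rfl rfl rfl rfl rfl ?_).seq fun m₅ hF₅ e₅ =>
    (?_ : Runs feasibleBody m₅ feasibleBody.maxCost _)).mono_time ?_
  · subst e₁; simpa using hh
  · subst e₁; simpa using hpow
  · have : m₂.nat 9 0 = i := by rw [hF₂.nat 9 rfl, e₁]; simpa using h9
    simp [linkParams, this]
  · rw [hF₂.nat 3 rfl, e₁]; simpa using hh
  · have : m₃.nat 9 0 = i := by rw [hF₃.nat 9 rfl, hF₂.nat 9 rfl, e₁]; simpa using h9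
    simp [eraseParams, this]
  · rw [hF₃.nat 3 rfl, hF₂.nat 3 rfl, e₁]; simpa using hh
  · have : m₄.nat 9 0 = i := by
      rw [hF₄.nat 9 rfl, hF₃.nat 9 rfl, hF₂.nat 9 rfl, e₁]; simpa using h9
    have h20 : m₄.nat 20 = m₂.nat 20 := by rw [hF₄.nat 20 rfl, hF₃.nat 20 rfl]
    simp [insertParams, this, h20]
    exact ⟨fun h => by simp [h], fun h => by simp [h]⟩
  · rw [hF₄.nat 3 rfl, hF₃.nat 3 rfl, hF₂.nat 3 rfl, e₁]; simpa using hh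
  · have e9 : m₅.nat 9 0 = i := by
      rw [hF₅.nat 9 rfl, hF₄.nat 9 rfl, hF₃.nat 9 rfl, hF₂.nat 9 rfl, e₁]; simpa using h9
    have f32 : m₂.nat 32 0 = m.nat 15 i + c := by rw [hF₂.nat 32 rfl, e₁]; simp
    have e32 : m₅.nat 32 0 = m.nat 15 i + c := by
      rw [hF₅.nat 32 rfl, hF₄.nat 32 rfl, hF₃.nat 32 rfl, f32]
    have e20 : m₅.nat 20 = m₂.nat 20 := by
      rw [hF₅.nat 20 rfl, hF₄.nat 20 rfl, hF₃.nat 20 rfl]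
    have e21 : m₅.nat 21 = m₂.nat 21 := by
      rw [hF₅.nat 21 rfl, hF₄.nat 21 rfl, hF₃.nat 21 rfl]
    have g20 : m₄.nat 20 = m₂.nat 20 := by rw [hF₄.nat 20 rfl, hF₃.nat 20 rfl]
    have g : ∀ a, a ≠ 32 → m₁.nat a = m.nat a := fun a ha => by rw [e₁, nat_writeNat_of_ne _ _ _ ha]
    have e33 : m₅.nat 33 = Function.update (m.nat 33) (m.nat 15 i + c) (horner (digitOf h
        (relabelWith i (i + 1) (m₂.nat 20 i) (m₂.nat 20 (i + 1)) (i + 1) (m₂.nat 20))) h + 1) := by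
      rw [hF₅.nat 33 rfl, hF₄.nat 33 rfl, e₃, f32, hF₂.nat 33 rfl, g 33 (by decide)]
    have e34 : m₅.nat 34 = Function.update (m.nat 34) (m.nat 15 i + c) (horner (digitOf h
        (relabelWith i i 0 0 0 (m₂.nat 20))) h + 1) := by
      rw [hF₅.nat 34 rfl, e₄, hF₃.nat 20 rfl, hF₃.nat 32 rfl, f32, hF₃.nat 34 rfl, hF₂.nat 34 rfl,
        g 34 (by decide)]
    have e35 : m₅.nat 35 = Function.update (m.nat 35) (m.nat 15 i + c) (horner (digitOf h
        (relabelWith i i 0 0 (if m₂.nat 20 i = 0 then i + 1 else m₂.nat 20 i)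
          (m₂.nat 20))) h + 1) := by
      rw [e₅, g20, hF₄.nat 32 rfl, hF₃.nat 32 rfl, f32, hF₄.nat 35 rfl, hF₃.nat 35 rfl,
        hF₂.nat 35 rfl, g 35 (by decide)]
    have e36 : m₅.nat 36 = m.nat 36 := by
      rw [hF₅.nat 36 rfl, hF₄.nat 36 rfl, hF₃.nat 36 rfl, hF₂.nat 36 rfl, g 36 (by decide)]
    have g10 : m₁.nat 10 0 = c := by rw [g 10 (by decide), h10]
    simp only [NExpr.eval, g10] at e₂
    have key : ∀ m' : Mem,
        (∀ x, m'.nat 33 x = if x = m.nat 15 i + c then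
          (if 0 < m₂.nat 20 i ∧ m₂.nat 20 i = m₂.nat 20 (i + 1) then 0 else horner (digitOf h
        (relabelWith i (i + 1) (m₂.nat 20 i) (m₂.nat 20 (i + 1)) (i + 1) (m₂.nat 20))) h + 1)
          else m.nat 33 x) →
        (∀ x, m'.nat 34 x = if x = m.nat 15 i + c then
          (if m₂.nat 21 i = 1 then 0 else horner (digitOf h
        (relabelWith i i 0 0 0 (m₂.nat 20))) h + 1)
          else m.nat 34 x) →
        (∀ x, m'.nat 35 x = if x = m.nat 15 i + c then horner (digitOf h
        (relabelWith i i 0 0 (if m₂.nat 20 i = 0 then i + 1 else m₂.nat 20 i)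
          (m₂.nat 20))) h + 1 else m.nat 35 x) →
        (∀ x, m'.nat 36 x = if x = m.nat 15 i + c then m₂.nat 21 i else m.nat 36 x) →
        (∀ ω ∈ stateSpace h, code h ω = c → TableEntry h ω i (m.nat 15 i + c) m') ∧
      ∀ x ≠ m.nat 15 i + c, m'.nat 33 x = m.nat 33 x ∧ m'.nat 34 x = m.nat 34 x ∧
        m'.nat 35 x = m.nat 35 x ∧ m'.nat 36 x = m.nat 36 x := by
      intro m' k33 k34 k35 k36
      refine ⟨fun ω hω hc => ?_, fun x hx => by simp [k33, k34, k35, k36, hx]⟩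
      have hl : ∀ k < h, m₂.nat 20 k = label ω k := fun k hk => (e₂ ω hω hc.symm k hk).1
      have hd : m₂.nat 21 i = digit ω i := (e₂ ω hω hc.symm i hi).2
      have hp := (mem_stateSpace.1 hω).1
      refine ⟨fun hi' => ?_, ?_, ?_, ?_⟩
      · rw [k33, if_pos rfl, code_step_link hp hl hi' 0 (mem_stateSpace.1 (step_mem_stateSpace hω
          (e := .vert i 0) hi' true)).1]
        simp only [hp.sameBlock_iff_label, hl i hi, hl _ hi', Nat.pos_iff_ne_zero]
      · rw [k34, if_pos rfl, code_step_erase hp hl 0 (mem_stateSpace.1 (step_mem_stateSpace hω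
          (e := .horiz i 0) hi false)).1]
        simp only [hp.singleton_mem_iff_digit, hd]
      · rw [k35, if_pos rfl, code_step_insert hp hl hi 0 (mem_stateSpace.1 (step_mem_stateSpace hω
          (e := .horiz i 0) hi true)).1]
      · rw [k36, if_pos rfl, hd]
    refine (Runs.of_wp (Q := fun m' =>
        (∀ x, m'.nat 33 x = if x = m.nat 15 i + c then
          (if 0 < m₂.nat 20 i ∧ m₂.nat 20 i = m₂.nat 20 (i + 1) then 0 else horner (digitOf h
        (relabelWith i (i + 1) (m₂.nat 20 i) (m₂.nat 20 (i + 1)) (i + 1) (m₂.nat 20))) h + 1)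
          else m.nat 33 x) ∧
        (∀ x, m'.nat 34 x = if x = m.nat 15 i + c then
          (if m₂.nat 21 i = 1 then 0 else horner (digitOf h
        (relabelWith i i 0 0 0 (m₂.nat 20))) h + 1)
          else m.nat 34 x) ∧
        (∀ x, m'.nat 35 x = if x = m.nat 15 i + c then horner (digitOf h
        (relabelWith i i 0 0 (if m₂.nat 20 i = 0 then i + 1 else m₂.nat 20 i)
          (m₂.nat 20))) h + 1 else m.nat 35 x) ∧
        (∀ x, m'.nat 36 x = if x = m.nat 15 i + c then m₂.nat 21 i else m.nat 36 x) ) ?_).imp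
      fun m' _ h => key m' h.1 h.2.1 h.2.2.1 h.2.2.2
    simp only [feasibleBody, Prog.wp, BExpr.eval, BExpr.eval_eq, NExpr.eval, nat_writeNat, e9, e32,
      e20, e21, e33, e34, e35, e36, Nat.reduceEqDiff, false_and, if_false, Function.update_apply]
    refine ⟨fun h1 => ⟨fun h2 => ?_, fun h2 => ?_⟩, fun h1 => ⟨fun h2 => ?_, fun h2 => ?_⟩⟩ <;>
      refine ⟨fun x => ?_, fun x => ?_, fun x => ?_, fun x => ?_⟩ <;>
      by_cases hx : x = m.nat 15 i + c <;>
      simp [hx, h1, h2, e33, e34, e35, e36, e32, e21] <;> omega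
  · simp only [Prog.maxCost, NExpr.cost]
    nlinarith

theorem address_inj {N i i' c c' : ℕ} (hc : c < N) (hc' : c' < N)
    (h : i * N + c = i' * N + c') : i = i' ∧ c = c' := by
  have h1 : i = i' := by
    have e := congrArg (· / N) h
    simpa [Nat.mul_comm _ N, Nat.mul_add_div (by omega : 0 < N), Nat.div_eq_of_lt hc,
      Nat.div_eq_of_lt hc'] using e
  subst h1
  exact ⟨rfl, by omega⟩

/-- `B ≥ 1` rounds of cost `O(X)` cost `O(B X)`, as `B + 2 ≤ 3 * B`. -/
theorem loop_time_le {B T K X c : ℕ} (hB : 1 ≤ B) (hX : 1 ≤ X) (hT : T ≤ K * X) :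
    (B + 2) * (T + c + 10) ≤ 3 * (K + c + 10) * (B * X) := by
  have h1 : T + c + 10 ≤ (K + c + 10) * X := by nlinarith
  calc (B + 2) * (T + c + 10) ≤ (3 * B) * ((K + c + 10) * X) := Nat.mul_le_mul (by omega) h1
    _ = _ := by ring

/-- The second factor `h` is the price of decoding and encoding. It is paid once for all columns,
and is later absorbed by `h ≤ n`. -/
theorem exists_runs_tables : ∃ K, ∀ (h : ℕ) (m : Mem), 1 ≤ h → m.nat 3 0 = h →
    m.nat 17 0 = 5 ^ h → (∀ k < h, m.nat 18 k = 5 ^ k) → (∀ i < h, m.nat 15 i = i * 5 ^ h) →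
    Runs tables m (K * (h * (5 ^ h * h))) fun m' => ∀ i < h, ∀ ω ∈ stateSpace h,
      TableEntry h ω i (i * 5 ^ h + code h ω) m' := by
  obtain ⟨K, hK⟩ := exists_runs_tableBody
  refine ⟨3 * (3 * (3 * K + (NExpr.var 17).cost + 10) + (NExpr.var 3).cost + 10),
    fun h m h1 hh hN hpow hbase => ?_⟩
  have h5 : 1 ≤ 5 ^ h := Nat.one_le_pow _ _ (by decide)
  refine (Runs.forLoop (T := (5 ^ h + 2) * (K * (h + 2) + (NExpr.var 17).cost + 10)) h
    (fun i m' => ∀ i' < i, ∀ ω ∈ stateSpace h, TableEntry h ω i' (i' * 5 ^ h + code h ω) m')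
    (by simp) ?_ ?_).mono_time (loop_time_le h1 (Nat.mul_pos h5 h1)
      (loop_time_le h5 h1 (K := 3 * K) (by nlinarith)))
  · intro k m' hF _
    simp only [NExpr.eval]
    rw [hF.nat 3 rfl, hh]
  · intro i hi m₁ hF₁ h9 hI
    refine (Runs.forLoop (5 ^ h) (fun c m' => m'.nat 9 0 = i ∧ (∀ i' < i, ∀ ω ∈ stateSpace h,
      TableEntry h ω i' (i' * 5 ^ h + code h ω) m') ∧ ∀ ω ∈ stateSpace h, code h ω < c →
      TableEntry h ω i (i * 5 ^ h + code h ω) m') ?_ ?_ ?_).imp ?_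
    · refine ⟨by simpa using h9, fun i' hi' ω hω => (hI i' hi' ω hω).congr ?_ ?_ ?_ ?_,
        by simp⟩ <;> simp
    · intro k m' hF _
      simp only [NExpr.eval]
      rw [hF.nat 17 rfl, hF₁.nat 17 rfl, hN]
    · rintro c hc m₂ hF₂ h10 ⟨h9', hI', hJ⟩
      have e15 : m₂.nat 15 i = i * 5 ^ h := by rw [hF₂.nat 15 rfl, hF₁.nat 15 rfl, hbase i hi]
      refine (hK h i c m₂ hi ?_ ?_ h9' h10).imp fun m₃ hF₃ h₃ => ?_
      · rw [hF₂.nat 3 rfl, hF₁.nat 3 rfl, hh]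
      · intro k hk
        rw [hF₂.nat 18 rfl, hF₁.nat 18 rfl, hpow k hk]
      · rw [e15] at h₃
        have hcongr : ∀ ω ∈ stateSpace h, ∀ i', TableEntry h ω i' (i' * 5 ^ h + code h ω) m₂ →
            i' * 5 ^ h + code h ω ≠ i * 5 ^ h + c →
            TableEntry h ω i' (i' * 5 ^ h + code h ω) (m₃.writeNat 10 0 (c + 1)) := by
          intro ω hω i' hT hne
          obtain ⟨k33, k34, k35, k36⟩ := h₃.2 _ hne
          exact hT.congr (by simpa using k33) (by simpa using k34) (by simpa using k35)
            (by simpa using k36)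
        refine ⟨by rw [hF₃.nat 10 rfl, h10], ?_, fun i' hi' ω hω => ?_, fun ω hω hcω => ?_⟩
        · rw [nat_writeNat_of_ne _ _ _ (by decide), hF₃.nat 9 rfl, h9']
        · refine hcongr ω hω i' (hI' i' hi' ω hω) fun he => ?_
          exact hi'.ne (address_inj (code_lt h ω) hc he).1
        · rcases (Nat.lt_succ_iff.1 hcω).eq_or_lt with h0 | h0
          · rw [h0]
            refine (h₃.1 ω hω h0).congr ?_ ?_ ?_ ?_ <;> simp
          · refine hcongr ω hω i (hJ ω hω h0) fun he => ?_
            exact h0.ne (address_inj (code_lt h ω) hc he).2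
    · rintro m₂ hF₂ ⟨h9', hI', hJ⟩
      refine ⟨h9', fun i' hi' ω hω => ?_⟩
      have hJ' : TableEntry h ω i' (i' * 5 ^ h + code h ω) m₂ := by
        rcases (Nat.lt_succ_iff.1 hi').eq_or_lt with rfl | h0
        · exact hJ ω hω (code_lt h ω)
        · exact hI' i' h0 ω hω
      refine hJ'.congr ?_ ?_ ?_ ?_ <;> simp

set_option linter.unusedSimpArgs false

/-! ### Best completions of a state -/

/-- The decisions are possible and have the least cost. -/
def IsBest (P : Finset Pt) (es : List GridEdge) (ω : FrontierState) (bs : List Bool) : Prop :=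
  Accepts P es ω bs ∧ ∀ bs', Accepts P es ω bs' → cost P es bs ≤ cost P es bs'

section Best

variable {P : Finset Pt} {e : GridEdge} {es : List GridEdge} {ω : FrontierState} {b : Bool}
  {bs bs' : List Bool}

/-- With `IsBest.cons`, this is the principle of optimality: costs are additive, so the rest of a
best completion is best and can be exchanged for any other best one. -/
theorem IsBest.tail (h : IsBest P (e :: es) ω (b :: bs)) : IsBest P es (step ω e b) bs := by
  refine ⟨h.1.2, fun bs' h' => ?_⟩
  have := h.2 (b :: bs') ⟨h.1.1, h'⟩
  rw [cost_cons, cost_cons] at this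
  linarith

theorem IsBest.cons (h : IsBest P (e :: es) ω (b :: bs)) (h' : IsBest P es (step ω e b) bs') :
    IsBest P (e :: es) ω (b :: bs') := by
  refine ⟨⟨h.1.1, h'.1⟩, fun bs'' h'' => le_trans ?_ (h.2 bs'' h'')⟩
  rw [cost_cons, cost_cons]
  linarith [h'.2 bs h.1.2]

/-- A flag and a number describe the completions of the state `ω`: the flag is `0` if there is none,
otherwise the number is the least cost of a completion, attained by one that takes the first edge if
and only if the flag is `2`. -/
structure Stored (P : Finset Pt) (es : List GridEdge) (ω : FrontierState) (f : ℕ) (r : ℝ) :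
    Prop where
  none : f = 0 → ∀ bs, ¬ Accepts P es ω bs
  some : f ≠ 0 → ∃ bs, IsBest P es ω bs ∧ cost P es bs = r ∧ ∀ b ∈ bs.head?, (b = true ↔ f = 2)

open Classical in
/-- The successor of a code, increased by `1`, or `0` if the transition is not possible. -/
def succCode (P : Finset Pt) (h : ℕ) (e : GridEdge) (ω : FrontierState) (b : Bool) : ℕ :=
  if stepOK P ω e b then code h (step ω e b) + 1 else 0

theorem accepts_cons_iff : Accepts P (e :: es) ω bs ↔
    ∃ b bs', bs = b :: bs' ∧ stepOK P ω e b ∧ Accepts P es (step ω e b) bs' := by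
  cases bs with
  | nil => simp [Accepts]
  | cons b bs => simp [Accepts]

/-- The comparison of the two transitions from a state. -/
theorem Stored.cons {f₀ f₁ : ℕ} {r₀ r₁ : ℝ}
    (h₀ : stepOK P ω e false → Stored P es (step ω e false) f₀ r₀)
    (h₁ : stepOK P ω e true → Stored P es (step ω e true) f₁ r₁) {f : ℕ} {r : ℝ}
    (hnone : ¬ (stepOK P ω e false ∧ f₀ ≠ 0) → ¬ (stepOK P ω e true ∧ f₁ ≠ 0) → f = 0)
    (hfalse : stepOK P ω e false → f₀ ≠ 0 →
      (stepOK P ω e true → f₁ ≠ 0 → r₀ ≤ r₁ + weight P e) → f = 1 ∧ r = r₀)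
    (htrue : stepOK P ω e true → f₁ ≠ 0 →
      (stepOK P ω e false → f₀ ≠ 0 → r₁ + weight P e < r₀) → f = 2 ∧ r = r₁ + weight P e) :
    Stored P (e :: es) ω f r := by
  have hw : ∀ b, transCost P e b = if b then weight P e else 0 := by
    intro b
    cases b <;> rfl
  have none₀ : ¬ (stepOK P ω e false ∧ f₀ ≠ 0) → ∀ bs, ¬ Accepts P (e :: es) ω (false :: bs) := by
    rintro hn bs ⟨h1, h2⟩
    exact (h₀ h1).none (not_not.1 fun h => hn ⟨h1, h⟩) bs h2
  have none₁ : ¬ (stepOK P ω e true ∧ f₁ ≠ 0) → ∀ bs, ¬ Accepts P (e :: es) ω (true :: bs) := by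
    rintro hn bs ⟨h1, h2⟩
    exact (h₁ h1).none (not_not.1 fun h => hn ⟨h1, h⟩) bs h2
  have best₀ : ∀ bs', Accepts P (e :: es) ω (false :: bs') →
      stepOK P ω e false ∧ f₀ ≠ 0 ∧ r₀ ≤ cost P (e :: es) (false :: bs') := by
    rintro bs' hacc
    by_cases hc : stepOK P ω e false ∧ f₀ ≠ 0
    · obtain ⟨bs, h1, h2, -⟩ := (h₀ hc.1).some hc.2
      refine ⟨hc.1, hc.2, ?_⟩
      rw [cost_cons, hw, ← h2]
      simpa using h1.2 bs' hacc.2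
    · exact absurd hacc (none₀ hc bs')
  have best₁ : ∀ bs', Accepts P (e :: es) ω (true :: bs') →
      stepOK P ω e true ∧ f₁ ≠ 0 ∧ r₁ + weight P e ≤ cost P (e :: es) (true :: bs') := by
    rintro bs' hacc
    by_cases hc : stepOK P ω e true ∧ f₁ ≠ 0
    · obtain ⟨bs, h1, h2, -⟩ := (h₁ hc.1).some hc.2
      refine ⟨hc.1, hc.2, ?_⟩
      rw [cost_cons, hw, ← h2, add_comm]
      simpa using h1.2 bs' hacc.2
    · exact absurd hacc (none₁ hc bs')
  -- The edge is taken if this is possible and either strictly cheaper or the only possibility; ties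
  -- are decided against it.
  by_cases hc₁ : stepOK P ω e true ∧ f₁ ≠ 0 ∧
      (stepOK P ω e false → f₀ ≠ 0 → r₁ + weight P e < r₀)
  · obtain ⟨h1, h2, h3⟩ := hc₁
    obtain ⟨rfl, rfl⟩ := htrue h1 h2 h3
    refine ⟨by simp, fun _ => ?_⟩
    obtain ⟨bs, h4, h5, -⟩ := (h₁ h1).some h2
    have h6 : cost P (e :: es) (true :: bs) = r₁ + weight P e := by
      rw [cost_cons, hw, h5, if_pos rfl, add_comm]
    refine ⟨true :: bs, ⟨⟨h1, h4.1⟩, fun bs' hacc => ?_⟩, h6, by simp⟩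
    rw [h6]
    obtain ⟨b, bs', rfl, -⟩ := accepts_cons_iff.1 hacc
    cases b with
    | false =>
      obtain ⟨h7, h8, h9⟩ := best₀ bs' hacc
      exact (h3 h7 h8).le.trans h9
    | true => exact (best₁ bs' hacc).2.2
  · by_cases hc₀ : stepOK P ω e false ∧ f₀ ≠ 0
    · obtain ⟨h1, h2⟩ := hc₀
      have h3 : stepOK P ω e true → f₁ ≠ 0 → r₀ ≤ r₁ + weight P e := fun h4 h5 =>
        not_lt.1 fun h6 => hc₁ ⟨h4, h5, fun _ _ => h6⟩
      obtain ⟨rfl, rfl⟩ := hfalse h1 h2 h3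
      refine ⟨by simp, fun _ => ?_⟩
      obtain ⟨bs, h4, h5, -⟩ := (h₀ h1).some h2
      have h6 : cost P (e :: es) (false :: bs) = r := by
        rw [cost_cons, hw, h5]
        simp
      refine ⟨false :: bs, ⟨⟨h1, h4.1⟩, fun bs' hacc => ?_⟩, h6, by simp⟩
      rw [h6]
      obtain ⟨b, bs', rfl, -⟩ := accepts_cons_iff.1 hacc
      cases b with
      | false => exact (best₀ bs' hacc).2.2
      | true =>
        obtain ⟨h7, h8, h9⟩ := best₁ bs' hacc
        exact (h3 h7 h8).trans h9
    · have hc₁' : ¬ (stepOK P ω e true ∧ f₁ ≠ 0) := fun h =>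
        hc₁ ⟨h.1, h.2, fun h1 h2 => absurd ⟨h1, h2⟩ hc₀⟩
      have hf := hnone hc₀ hc₁'
      refine ⟨fun _ bs hacc => ?_, fun h => absurd hf h⟩
      obtain ⟨b, bs', rfl, -⟩ := accepts_cons_iff.1 hacc
      cases b with
      | false => exact none₀ hc₀ bs' hacc
      | true => exact none₁ hc₁' bs' hacc

theorem chosen_concat {G : List GridEdge} {pre : List Bool} (he : G[pre.length]? = some e)
    (b : Bool) : chosen G (pre ++ [b]) = chosen G pre ++ if b then [e] else [] := by
  induction pre generalizing G with
  | nil =>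
    cases G with
    | nil => simp at he
    | cons g G =>
      obtain rfl : g = e := by simpa using he
      cases b <;> simp [chosen]
  | cons a pre ih =>
    cases G with
    | nil => simp at he
    | cons g G =>
      have := ih (G := G) (by simpa using he)
      cases a <;> simp [chosen, this]

end Best

/-! ### The dynamic program, from the last layer to the first

Arrays: `11` the number of edges, `12` to `14` the kinds of the edges, their rows and whether the
vertex that leaves the frontier is a terminal, real arrays `9` to `12` the ends of the edges, `37` and
real array `13` the flags and the costs, where the entries for a layer begin at the address `40`; `38`
the number of an edge, `41` and `42` the successors of a code, `43` a flag, real arrays `14` and `15`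
costs. -/

/-- The memory describes the grid edge `e` with the number `k`. -/
structure EdgeStored (P : Finset Pt) (k : ℕ) (e : GridEdge) (m : Mem) : Prop where
  kind : m.nat 12 k = match e with | .vert _ _ => 0 | .horiz _ _ => 1
  row : m.nat 13 k = e.src.1
  terminal : 0 < m.nat 14 k ↔ gridPt P e.src.1 e.src.2 ∈ P
  x : m.real 9 k = coord (P.image Prod.fst) e.src.2
  y : m.real 10 k = coord (P.image Prod.snd) e.src.1
  x' : m.real 11 k = coord (P.image Prod.fst) e.tgt.2
  y' : m.real 12 k = coord (P.image Prod.snd) e.tgt.1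

theorem EdgeStored.weight {P : Finset Pt} {k : ℕ} {e : GridEdge} {m : Mem}
    (hE : EdgeStored P k e m) (he : e ∈ gridEdges (numRows P) (numCols P)) :
    m.real 11 k - m.real 9 k + (m.real 12 k - m.real 10 k) = weight P e := by
  rw [hE.x, hE.y, hE.x', hE.y']
  cases e with
  | vert i j =>
    rw [weight_vert (vert_mem_gridEdges.1 he).1]
    simp [GridEdge.src, GridEdge.tgt]
  | horiz i j =>
    rw [weight_horiz (horiz_mem_gridEdges.1 he).2]
    simp [GridEdge.src, GridEdge.tgt]

/-- The memory describes the grid edges in the list. -/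
structure EdgesStored (P : Finset Pt) (G : List GridEdge) (m : Mem) : Prop where
  length : m.nat 11 0 = G.length
  edge : ∀ k e, G[k]? = some e → EdgeStored P k e m

theorem EdgesStored.congr {P : Finset Pt} {G : List GridEdge} {m m' : Mem}
    (hE : EdgesStored P G m) (hn : ∀ a ∈ [11, 12, 13, 14], m'.nat a = m.nat a)
    (hr : ∀ a ∈ [9, 10, 11, 12], m'.real a = m.real a) : EdgesStored P G m' := by
  simp only [List.forall_mem_cons, List.not_mem_nil, false_implies, implies_true, and_true] at hn hr
  obtain ⟨n1, n2, n3, n4⟩ := hn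
  obtain ⟨r1, r2, r3, r4⟩ := hr
  refine ⟨n1 ▸ hE.length, fun k e he => ?_⟩
  obtain ⟨h1, h2, h3, h4, h5, h6, h7⟩ := hE.edge k e he
  exact ⟨n2 ▸ h1, n3 ▸ h2, n4 ▸ h3, r1 ▸ h4, r2 ▸ h5, r3 ▸ h6, r4 ▸ h7⟩

/-- The memory contains the tables that the dynamic program uses. -/
structure TablesStored (P : Finset Pt) (m : Mem) : Prop where
  size : m.nat 17 0 = 5 ^ numRows P
  rowBase : ∀ i < numRows P, m.nat 15 i = i * 5 ^ numRows P
  entry : ∀ i < numRows P, ∀ ω ∈ stateSpace (numRows P),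
    TableEntry (numRows P) ω i (i * 5 ^ numRows P + code (numRows P) ω) m
  edges : EdgesStored P (gridEdges (numRows P) (numCols P)) m

theorem TablesStored.congr {P : Finset Pt} {m m' : Mem} (hT : TablesStored P m)
    (hn : ∀ a ∈ [11, 12, 13, 14, 15, 17, 33, 34, 35, 36], m'.nat a = m.nat a)
    (hr : ∀ a ∈ [9, 10, 11, 12], m'.real a = m.real a) : TablesStored P m' := by
  have hE := hT.edges.congr (fun a ha => hn a (by simp at ha ⊢; tauto)) hr
  simp only [List.forall_mem_cons, List.not_mem_nil, false_implies, implies_true, and_true] at hn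
  obtain ⟨-, -, -, -, n15, n17, n33, n34, n35, n36⟩ := hn
  refine ⟨n17 ▸ hT.size, n15 ▸ hT.rowBase, fun i hi ω hω => ?_, hE⟩
  exact (hT.entry i hi ω hω).congr (by rw [n33]) (by rw [n34]) (by rw [n35]) (by rw [n36])

/-- Computes the successors `41` and `42` of the code `10` for the edge `38`. -/
def succBody : Prog :=
  .seq (.setVar 32 (.add (.get 15 (.get 13 (.var 38))) (.var 10))) <|
  .ite (.eq (.get 12 (.var 38)) (.lit 0))
    (.seq (.setVar 41 (.add (.var 10) (.lit 1))) (.setVar 42 (.get 33 (.var 32))))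
    (.seq (.setVar 42 (.get 35 (.var 32)))
      (.ite (.and (.ltNat (.lit 0) (.get 14 (.var 38))) (.eq (.get 36 (.var 32)) (.lit 0)))
        (.setVar 41 (.lit 0)) (.setVar 41 (.get 34 (.var 32)))))

/-- The column of an edge matters only through the terminal flag, which forbids leaving behind a
terminal of degree zero; everything else comes from the tables for its row. -/
theorem runs_succBody {P : Finset Pt} {m : Mem} (hT : TablesStored P m) {k : ℕ} {e : GridEdge}
    (he : (gridEdges (numRows P) (numCols P))[k]? = some e) (h38 : m.nat 38 0 = k) :
    Runs succBody m succBody.maxCost fun m' => ∀ ω ∈ stateSpace (numRows P),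
      m.nat 10 0 = code (numRows P) ω → m'.nat 41 0 = succCode P (numRows P) e ω false ∧
        m'.nat 42 0 = succCode P (numRows P) e ω true := by
  have hmem : e ∈ gridEdges (numRows P) (numCols P) := List.mem_of_getElem? he
  have hE := hT.edges.edge k e he
  apply Runs.of_wp
  cases e with
  | vert i j =>
    have hi := (vert_mem_gridEdges.1 hmem).1
    have e12 : m.nat 12 k = 0 := hE.kind
    have e13 : m.nat 13 k = i := hE.row
    simp [succBody, h38, e12, e13, hT.rowBase i (by omega)]
    intro ω hω h10
    have hen := (hT.entry i (by omega) ω hω).link hi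
    rw [h10, hen]
    have hst : stepOK P ω (.vert i j) true ↔ ¬ SameBlock ω i (i + 1) := Iff.rfl
    constructor
    · simp [succCode, stepOK, step]
    · unfold succCode
      rw [hst]
      by_cases hc : SameBlock ω i (i + 1)
      · simp [hc]
      · rw [if_neg hc, if_pos hc]
        rfl
  | horiz i j =>
    have hi := (horiz_mem_gridEdges.1 hmem).1
    have e12 : m.nat 12 k = 1 := hE.kind
    have e13 : m.nat 13 k = i := hE.row
    have e14 : 0 < m.nat 14 k ↔ gridPt P i j ∈ P := hE.terminal
    simp [succBody, h38, e12, e13, hT.rowBase i (by omega)]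
    have key : ∀ ω ∈ stateSpace (numRows P), m.nat 10 0 = code (numRows P) ω →
        (0 < m.nat 14 k ∧ m.nat 36 (i * 5 ^ numRows P + m.nat 10 0) = 0 →
          0 = succCode P (numRows P) (.horiz i j) ω false) ∧
        (¬ (0 < m.nat 14 k ∧ m.nat 36 (i * 5 ^ numRows P + m.nat 10 0) = 0) →
          m.nat 34 (i * 5 ^ numRows P + m.nat 10 0) =
            succCode P (numRows P) (.horiz i j) ω false) ∧
        m.nat 35 (i * 5 ^ numRows P + m.nat 10 0) =
          succCode P (numRows P) (.horiz i j) ω true := by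
      intro ω hω h10
      have hen := hT.entry i hi ω hω
      have hst : stepOK P ω (.horiz i j) false ↔ (gridPt P i j ∈ P → i ∈ covered ω) ∧ {i} ∉ ω :=
        Iff.rfl
      have hd : digit ω i = 0 ↔ i ∉ covered ω := by
        rw [mem_covered, ← digit_ne_zero, not_not]
      rw [h10, hen.digit, hen.erase, hen.insert, e14, hd]
      unfold succCode
      rw [hst]
      refine ⟨fun h1 => ?_, fun h1 => ?_, ?_⟩
      · rw [if_neg fun h => h1.2 (h.1 h1.1)]
      · by_cases hc : {i} ∈ ω
        · simp [hc]
        · rw [if_neg hc, if_pos ⟨fun h => by_contra fun h' => h1 ⟨h, h'⟩, hc⟩]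
          rfl
      · simp [stepOK, step]
    exact ⟨fun h1 h2 ω hω h10 => ⟨(key ω hω h10).1 ⟨h1, h2⟩, (key ω hω h10).2.2⟩,
      fun h1 ω hω h10 => ⟨(key ω hω h10).2.1 fun h => h1 h.1 h.2, (key ω hω h10).2.2⟩⟩

/-! ### The comparison of the two transitions and the computation of all layers -/

set_option linter.unusedSimpArgs false

/-- Compares the successors `41` and `42` and stores the result for the code `10`. -/
def chooseBody : Prog :=
  .seq (.setVar 43 (.lit 0)) <|
  .seq (.ite (.and (.ltNat (.lit 0) (.var 41))
      (.ltNat (.lit 0) (.get 37 (.add (.var 40) (.sub (.var 41) (.lit 1))))))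
    (.seq (.setVar 43 (.lit 1))
      (.setReal 14 (.lit 0) (.get 13 (.add (.var 40) (.sub (.var 41) (.lit 1)))))) .skip) <|
  .seq (.ite (.and (.ltNat (.lit 0) (.var 42))
      (.ltNat (.lit 0) (.get 37 (.add (.var 40) (.sub (.var 42) (.lit 1))))))
    (.seq (.setReal 15 (.lit 0) (.add (.get 13 (.add (.var 40) (.sub (.var 42) (.lit 1))))
        (.add (.sub (.get 11 (.var 38)) (.get 9 (.var 38)))
          (.sub (.get 12 (.var 38)) (.get 10 (.var 38))))))
      (.ite (.or (.eq (.var 43) (.lit 0)) (.ltReal (.get 15 (.lit 0)) (.get 14 (.lit 0))))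
        (.seq (.setVar 43 (.lit 2)) (.setReal 14 (.lit 0) (.get 15 (.lit 0)))) .skip)) .skip) <|
  .seq (.setNat 37 (.add (.add (.var 40) (.var 17)) (.var 10)) (.var 43))
    (.setReal 13 (.add (.add (.var 40) (.var 17)) (.var 10)) (.get 14 (.lit 0)))

/-- For an impossible transition, `s - 1` is truncated to `0` and names some irrelevant cell, whose
flag has no effect because `s` is tested too. If neither transition is possible, the stored real is
left over from earlier and the flag `0` invalidates it. -/
theorem runs_chooseBody {m : Mem} {base s₀ s₁ k a : ℕ} (h40 : m.nat 40 0 = base)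
    (h41 : m.nat 41 0 = s₀) (h42 : m.nat 42 0 = s₁) (h38 : m.nat 38 0 = k)
    (ha : base + m.nat 17 0 + m.nat 10 0 = a) {f₀ f₁ : ℕ} {r₀ r₁ w : ℝ}
    (hf₀ : m.nat 37 (base + (s₀ - 1)) = f₀) (hf₁ : m.nat 37 (base + (s₁ - 1)) = f₁)
    (hr₀ : m.real 13 (base + (s₀ - 1)) = r₀) (hr₁ : m.real 13 (base + (s₁ - 1)) = r₁)
    (hw : m.real 11 k - m.real 9 k + (m.real 12 k - m.real 10 k) = w) :
    Runs chooseBody m chooseBody.maxCost fun m' =>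
      (∀ x ≠ a, m'.nat 37 x = m.nat 37 x ∧ m'.real 13 x = m.real 13 x) ∧
      (¬ (0 < s₀ ∧ 0 < f₀) → ¬ (0 < s₁ ∧ 0 < f₁) → m'.nat 37 a = 0) ∧
      (0 < s₀ → 0 < f₀ → (0 < s₁ → 0 < f₁ → r₀ ≤ r₁ + w) →
        m'.nat 37 a = 1 ∧ m'.real 13 a = r₀) ∧
      (0 < s₁ → 0 < f₁ → (0 < s₀ → 0 < f₀ → r₁ + w < r₀) →
        m'.nat 37 a = 2 ∧ m'.real 13 a = r₁ + w) := by
  apply Runs.of_wp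
  simp only [chooseBody, Prog.wp, BExpr.eval, BExpr.eval_or, BExpr.eval_eq, NExpr.eval, RExpr.eval,
    nat_writeNat, nat_writeReal, real_writeReal, real_writeNat, Nat.reduceEqDiff, false_and,
    if_false, true_and, if_true, and_true, h40, h41, h42, h38, ha, hf₀, hf₁, hr₀, hr₁, hw]
  refine ⟨fun h1 => ⟨fun h2 => ⟨fun h3 => ?_, fun h3 => ?_⟩, fun h2 => ?_⟩,
    fun h1 => ⟨fun h2 => ⟨fun h3 => ?_, fun h3 => ?_⟩, fun h2 => ?_⟩⟩
  · simp at h2 h3 ⊢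
    grind
  · simp at h2 h3 ⊢
    grind
  · simp at h2 ⊢
    grind
  · simp at h2 ⊢
    grind
  · simp at h3
  · simp at h2 ⊢
    grind

/-- The entries for layer `q`, counted from the last layer. -/
def LayerStored (P : Finset Pt) (q : ℕ) (m : Mem) : Prop :=
  ∀ ω ∈ stateSpace (numRows P), Stored P
    ((gridEdges (numRows P) (numCols P)).drop (lastLayer P - q)) ω
    (m.nat 37 (q * 5 ^ numRows P + code (numRows P) ω))
    (m.real 13 (q * 5 ^ numRows P + code (numRows P) ω))

/-- Computes the entries for all layers. -/
def dynamicProgram : Prog :=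
  .seq (.setVar 40 (.lit 0)) <| .forLoop 9 (.var 11) <|
  .seq (.setVar 38 (.sub (.sub (.var 11) (.lit 1)) (.var 9))) <|
  .seq (.forLoop 10 (.var 17) (.seq succBody chooseBody)) (.setVar 40 (.add (.var 40) (.var 17)))

/-- Entries are maintained for all non-crossing states, reached or not. By `step_mem_stateSpace` the
successors are again such states, so their entries are available in layer `q`. -/
theorem runs_dpBody {P : Finset Pt} {m : Mem} (hT : TablesStored P m) {q : ℕ} {e : GridEdge}
    (he : (gridEdges (numRows P) (numCols P))[lastLayer P - (q + 1)]? = some e)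
    (hq : q < lastLayer P) (h38 : m.nat 38 0 = lastLayer P - (q + 1))
    (h40 : m.nat 40 0 = q * 5 ^ numRows P) {c : ℕ} (h10 : m.nat 10 0 = c)
    (hL : LayerStored P q m) :
    Runs (.seq succBody chooseBody) m (succBody.maxCost + chooseBody.maxCost) fun m' =>
      (∀ x ≠ (q + 1) * 5 ^ numRows P + c, m'.nat 37 x = m.nat 37 x ∧
        m'.real 13 x = m.real 13 x) ∧
      ∀ ω ∈ stateSpace (numRows P), code (numRows P) ω = c → Stored P
        ((gridEdges (numRows P) (numCols P)).drop (lastLayer P - (q + 1))) ω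
        (m'.nat 37 ((q + 1) * 5 ^ numRows P + c)) (m'.real 13 ((q + 1) * 5 ^ numRows P + c)) := by
  have hmem : e ∈ gridEdges (numRows P) (numCols P) := List.mem_of_getElem? he
  have hw := (hT.edges.edge _ e he).weight hmem
  have hdrop : (gridEdges (numRows P) (numCols P)).drop (lastLayer P - (q + 1)) =
      e :: (gridEdges (numRows P) (numCols P)).drop (lastLayer P - q) := by
    obtain ⟨hlt, rfl⟩ := List.getElem?_eq_some_iff.1 he
    rw [List.drop_eq_getElem_cons hlt, show lastLayer P - (q + 1) + 1 = lastLayer P - q by omega]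
  refine (runs_succBody hT he h38).seq fun m₁ hF₁ h₁ => (runs_chooseBody
    (a := (q + 1) * 5 ^ numRows P + c) rfl rfl rfl rfl ?_ rfl rfl rfl rfl rfl).imp fun m₂ _ h₂ => ?_
  · rw [hF₁.nat 40 rfl, hF₁.nat 17 rfl, hF₁.nat 10 rfl, h40, h10, hT.size]
    ring
  · obtain ⟨hx, hnone, hfalse, htrue⟩ := h₂
    refine ⟨fun x hxa => ?_, fun ω hω hc => ?_⟩
    · rw [(hx x hxa).1, (hx x hxa).2, hF₁.nat 37 rfl, hF₁.real 13 rfl]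
      exact ⟨rfl, rfl⟩
    · obtain ⟨h41, h42⟩ := h₁ ω hω (h10.trans hc.symm)
      simp only [hF₁.nat 40 rfl, hF₁.nat 37 rfl, hF₁.nat 38 rfl, hF₁.real 13 rfl, hF₁.real 9 rfl,
        hF₁.real 10 rfl, hF₁.real 11 rfl, hF₁.real 12 rfl, h40, h38, h41, h42, hw]
        at hnone hfalse htrue
      have hpos : ∀ b, 0 < succCode P (numRows P) e ω b ↔ stepOK P ω e b := by
        intro b
        unfold succCode
        split_ifs with h <;> simp [h]
      have hsub : ∀ b, stepOK P ω e b →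
          succCode P (numRows P) e ω b - 1 = code (numRows P) (step ω e b) := by
        intro b hb
        simp [succCode, hb]
      have hst : ∀ b, stepOK P ω e b → Stored P
          ((gridEdges (numRows P) (numCols P)).drop (lastLayer P - q)) (step ω e b)
          (m.nat 37 (q * 5 ^ numRows P + (succCode P (numRows P) e ω b - 1)))
          (m.real 13 (q * 5 ^ numRows P + (succCode P (numRows P) e ω b - 1))) := by
        intro b hb
        rw [hsub b hb]
        exact hL _ (step_mem_stateSpace hω (rowsLt_of_mem_gridEdges hmem) b)
      simp only [hpos, Nat.pos_iff_ne_zero] at hnone hfalse htrue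
      rw [hdrop]
      exact Stored.cons (hst false) (hst true) hnone hfalse htrue

theorem exists_runs_dynamicProgram : ∃ K, ∀ (P : Finset Pt) (m : Mem), TablesStored P m →
    1 ≤ lastLayer P → LayerStored P 0 m →
    Runs dynamicProgram m (K * (lastLayer P * 5 ^ numRows P)) fun m' =>
      m'.nat 40 0 = lastLayer P * 5 ^ numRows P ∧ ∀ q ≤ lastLayer P, LayerStored P q m' := by
  refine ⟨3 + 3 * (3 * (succBody.maxCost + chooseBody.maxCost + (NExpr.var 17).cost + 10) + 20 +
    (NExpr.var 11).cost + 10), fun P m hT h1 h0 => ?_⟩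
  have h5 : 1 ≤ 5 ^ numRows P := Nat.one_le_pow _ _ (by decide)
  have hL : m.nat 11 0 = lastLayer P := hT.edges.length
  have hinit : Runs (.setVar 40 (.lit 0)) m 3 (fun m' => m' = m.writeNat 40 0 0) :=
    Runs.of_wp (by simp)
  refine (hinit.seq fun m₁ _ e₁ => Runs.forLoop (T := 9 + ((5 ^ numRows P + 2) *
    (succBody.maxCost + chooseBody.maxCost + (NExpr.var 17).cost + 10) + 7)) (lastLayer P)
    (fun q m' => m'.nat 40 0 = q * 5 ^ numRows P ∧ ∀ q' ≤ q, LayerStored P q' m')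
    ?_ ?_ ?_).mono_time ?_
  · subst e₁
    refine ⟨by simp, fun q' hq' => ?_⟩
    obtain rfl : q' = 0 := by omega
    simpa [LayerStored] using h0
  · intro q m' hF _
    subst e₁
    simp only [NExpr.eval]
    rw [hF.nat 11 rfl]
    simpa using hL
  · rintro q hq m₂ hF₂ h9 ⟨h40, hI⟩
    have hT₂ : TablesStored P m₂ := by
      subst e₁
      refine hT.congr (fun a ha => ?_) (fun a ha => ?_)
      · rw [hF₂.nat a (by fin_cases ha <;> rfl)]
        exact nat_writeNat_of_ne _ _ _ (by fin_cases ha <;> decide)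
      · rw [hF₂.real a (by fin_cases ha <;> rfl)]
        rfl
    have h11 : m₂.nat 11 0 = lastLayer P := hT₂.edges.length
    have hset : Runs (.setVar 38 (.sub (.sub (.var 11) (.lit 1)) (.var 9))) m₂ 9
        (fun m' => m' = m₂.writeNat 38 0 (lastLayer P - (q + 1))) :=
      Runs.of_wp (by simp [h9, h11, Nat.sub_sub, Nat.add_comm])
    have hlt : lastLayer P - (q + 1) < lastLayer P := by omega
    refine hset.seq fun m₃ _ e₃ => (Runs.forLoop (5 ^ numRows P) (fun c m' =>
      m'.nat 40 0 = q * 5 ^ numRows P ∧ m'.nat 9 0 = q ∧ m'.nat 38 0 = lastLayer P - (q + 1) ∧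
      (∀ q' ≤ q, LayerStored P q' m') ∧ ∀ ω ∈ stateSpace (numRows P), code (numRows P) ω < c →
        Stored P ((gridEdges (numRows P) (numCols P)).drop (lastLayer P - (q + 1))) ω
          (m'.nat 37 ((q + 1) * 5 ^ numRows P + code (numRows P) ω))
          (m'.real 13 ((q + 1) * 5 ^ numRows P + code (numRows P) ω))) ?_ ?_ ?_).seq (T' := 7)
      fun m₄ hF₄ h₄ => ?_
    · subst e₃
      refine ⟨by simpa using h40, by simpa using h9, by simp, ?_, by simp⟩
      simpa [LayerStored] using hI
    · intro c m' hF _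
      subst e₃
      simp only [NExpr.eval]
      rw [hF.nat 17 rfl]
      simpa using hT₂.size
    · rintro c hc m₄ hF₄ h10 ⟨h40, h9, h38, hI, hJ⟩
      have hT₄ : TablesStored P m₄ := by
        subst e₃
        refine hT₂.congr (fun a ha => ?_) (fun a ha => ?_)
        · rw [hF₄.nat a (by fin_cases ha <;> rfl)]
          exact nat_writeNat_of_ne _ _ _ (by fin_cases ha <;> decide)
        · rw [hF₄.real a (by fin_cases ha <;> rfl)]
          rfl
      refine (runs_dpBody hT₄ (List.getElem?_eq_getElem hlt) hq h38 h40 h10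
        (hI q le_rfl)).imp fun m₅ hF₅ h₅ => ⟨by rw [hF₅.nat 10 rfl, h10], ?_, ?_, ?_, ?_, ?_⟩
      · rw [nat_writeNat_of_ne _ _ _ (by decide), hF₅.nat 40 rfl, h40]
      · rw [nat_writeNat_of_ne _ _ _ (by decide), hF₅.nat 9 rfl, h9]
      · rw [nat_writeNat_of_ne _ _ _ (by decide), hF₅.nat 38 rfl, h38]
      · intro q' hq' ω hω
        have hne : q' * 5 ^ numRows P + code (numRows P) ω ≠ (q + 1) * 5 ^ numRows P + c :=
          fun h => by
            have := (address_inj (code_lt _ ω) hc h).1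
            omega
        rw [nat_writeNat_of_ne _ _ _ (by decide), real_writeNat, (h₅.1 _ hne).1, (h₅.1 _ hne).2]
        exact hI q' hq' ω hω
      · intro ω hω hcω
        rw [nat_writeNat_of_ne _ _ _ (by decide), real_writeNat]
        rcases (Nat.lt_succ_iff.1 hcω).eq_or_lt with h | h
        · rw [h]
          exact h₅.2 ω hω h
        · have hne : (q + 1) * 5 ^ numRows P + code (numRows P) ω ≠
              (q + 1) * 5 ^ numRows P + c := by omega
          rw [(h₅.1 _ hne).1, (h₅.1 _ hne).2]
          exact hJ ω hω h
    · obtain ⟨h40, h9, -, hI, hJ⟩ := h₄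
      have e17 : m₄.nat 17 0 = 5 ^ numRows P := by
        rw [hF₄.nat 17 rfl, e₃, nat_writeNat_of_ne _ _ _ (by decide), hT₂.size]
      refine (Runs.of_wp (c := .setVar 40 (.add (.var 40) (.var 17))) ?_)
      simp only [Prog.wp, NExpr.eval, h40, e17]
      refine ⟨by simpa using h9, by simp [add_mul], fun q' hq' ω hω => ?_⟩
      simp only [nat_writeNat_of_ne _ _ _ (show (37 : ℕ) ≠ 40 by decide), real_writeNat,
        nat_writeNat_of_ne _ _ _ (show (37 : ℕ) ≠ 9 by decide)]
      rcases (Nat.lt_or_ge q q') with h | h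
      · obtain rfl : q' = q + 1 := by omega
        exact hJ ω hω (code_lt _ ω)
      · exact hI q' h ω hω
  · have := loop_time_le (c := (NExpr.var 11).cost) (T := 9 + ((5 ^ numRows P + 2) *
      (succBody.maxCost + chooseBody.maxCost + (NExpr.var 17).cost + 10) + 7))
      (K := 3 * (succBody.maxCost + chooseBody.maxCost + (NExpr.var 17).cost + 10) + 20) h1 h5
      (by nlinarith)
    have h6 : 1 ≤ lastLayer P * 5 ^ numRows P := Nat.mul_pos h1 h5
    refine (Nat.add_le_add_left this 3).trans ?_
    rw [add_mul]
    exact Nat.add_le_add_right (by omega) _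

set_option linter.unusedSimpArgs false

/-! ### Output of the edges of a shortest tree -/

/-- Outputs the edge `38`. -/
def emit : Prog :=
  .seq (.setReal 2 (.var 1) (.get 9 (.var 38))) <| .seq (.setReal 3 (.var 1) (.get 10 (.var 38))) <|
  .seq (.setReal 4 (.var 1) (.get 11 (.var 38))) <|
  .seq (.setReal 5 (.var 1) (.get 12 (.var 38))) (.setVar 1 (.add (.var 1) (.lit 1)))

/-- Follows the best transition from the state `10` of the layer before the edge `9`. -/
def traceBody : Prog :=
  .seq (.setVar 38 (.var 9)) <| .seq (.setVar 43 (.get 37 (.add (.var 40) (.var 10)))) <|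
  .seq succBody <|
  .seq (.ite (.eq (.var 43) (.lit 2)) (.seq emit (.setVar 10 (.sub (.var 42) (.lit 1))))
    (.setVar 10 (.sub (.var 41) (.lit 1))))
  (.setVar 40 (.sub (.var 40) (.var 17)))

/-- Follows the best transitions from the empty state and outputs the edges taken. -/
def trace : Prog := .seq (.setVar 10 (.lit 0)) (.forLoop 9 (.var 11) traceBody)

theorem outputEdges_emit {m m' : Mem} {c : ℕ} {x y x' y' : ℝ} (hc : m.nat 1 0 = c)
    (hc' : m'.nat 1 0 = c + 1) (h2 : m'.real 2 = Function.update (m.real 2) c x)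
    (h3 : m'.real 3 = Function.update (m.real 3) c y)
    (h4 : m'.real 4 = Function.update (m.real 4) c x')
    (h5 : m'.real 5 = Function.update (m.real 5) c y') :
    outputEdges m' = outputEdges m ++ [s((x, y), (x', y'))] := by
  unfold outputEdges
  rw [hc, hc', List.range_succ, List.map_append]
  congr 1
  · refine List.map_congr_left fun i hi => ?_
    have : i ≠ c := (List.mem_range.1 hi).ne
    simp [h2, h3, h4, h5, this]
  · simp [h2, h3, h4, h5]

theorem outputEdges_congr {m m' : Mem} (hc : m'.nat 1 0 = m.nat 1 0)
    (h2 : m'.real 2 = m.real 2) (h3 : m'.real 3 = m.real 3) (h4 : m'.real 4 = m.real 4)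
    (h5 : m'.real 5 = m.real 5) : outputEdges m' = outputEdges m := by
  unfold outputEdges
  rw [hc, h2, h3, h4, h5]

/-- The state of the trace after `k` edges. -/
structure TraceInv (P : Finset Pt) (k : ℕ) (m : Mem) : Prop where
  base : m.nat 40 0 = (lastLayer P - k) * 5 ^ numRows P
  run : ∃ (pre : List Bool) (ω : FrontierState), pre.length = k ∧ ω ∈ stateSpace (numRows P) ∧
    m.nat 10 0 = code (numRows P) ω ∧
    outputEdges m = (chosen (gridEdges (numRows P) (numCols P)) pre).map (GridEdge.seg P) ∧
    (∃ bs, IsBest P ((gridEdges (numRows P) (numCols P)).drop k) ω bs) ∧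
    ∀ bs, IsBest P ((gridEdges (numRows P) (numCols P)).drop k) ω bs →
      IsBest P (gridEdges (numRows P) (numCols P)) ∅ (pre ++ bs)

/-- The flag of the current state names the first decision of some best completion. By the principle
of optimality, every best completion of the successor then continues the decisions made so far to a
best run. -/
theorem runs_traceBody {P : Finset Pt} {m : Mem} (hT : TablesStored P m)
    (hL : ∀ q ≤ lastLayer P, LayerStored P q m) {k : ℕ} (hk : k < lastLayer P)
    (h9 : m.nat 9 0 = k) (hI : TraceInv P k m) :
    Runs traceBody m (traceBody.maxCost) fun m' =>
      m'.nat 9 0 = k ∧ TraceInv P (k + 1) m' := by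
  obtain ⟨hbase, pre, ω, hpre, hω, h10, hout, ⟨bs₀, hbs₀⟩, hpost⟩ := hI
  have he : (gridEdges (numRows P) (numCols P))[k]? = some (gridEdges (numRows P) (numCols P))[k] :=
    List.getElem?_eq_getElem hk
  have hdrop := List.drop_eq_getElem_cons (l := gridEdges (numRows P) (numCols P)) hk
  generalize (gridEdges (numRows P) (numCols P))[k] = e at he hdrop
  have hmem : e ∈ gridEdges (numRows P) (numCols P) := List.mem_of_getElem? he
  have hE := hT.edges.edge k e he
  have hS := hL (lastLayer P - k) (by omega) ω hω
  rw [show lastLayer P - (lastLayer P - k) = k by omega, ← hbase, ← h10] at hS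
  generalize hf : m.nat 37 (m.nat 40 0 + m.nat 10 0) = f at hS
  -- A state on the trace has a completion.
  have hf0 : f ≠ 0 := fun h => hS.none h bs₀ hbs₀.1
  obtain ⟨bs, hbs, -, hhead⟩ := hS.some hf0
  rw [hdrop] at hbs
  obtain ⟨b, bs, rfl, -⟩ := accepts_cons_iff.1 hbs.1
  have hb : b = true ↔ f = 2 := hhead b rfl
  have hset : Runs (.setVar 38 (.var 9)) m _ (fun m' => m' = m.writeNat 38 0 k) :=
    Runs.of_wp (by simp [h9])
  have hset' : ∀ m' : Mem, Runs (.setVar 43 (.get 37 (.add (.var 40) (.var 10)))) m' _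
      (fun m'' => m'' = m'.writeNat 43 0 (m'.nat 37 (m'.nat 40 0 + m'.nat 10 0))) :=
    fun m' => Runs.of_wp (by simp)
  refine (hset.seq fun m₁ _ e₁ => (hset' m₁).seq fun m₂ _ e₂ => (runs_succBody (P := P) (k := k)
    (e := e) ?_ he ?_).seq fun m₃ hF₃ h₃ => Runs.of_wp ?_).mono_time le_rfl
  · subst e₁ e₂
    refine hT.congr (fun a ha => ?_) (fun a ha => rfl)
    rw [nat_writeNat_of_ne _ _ _ (by fin_cases ha <;> decide),
      nat_writeNat_of_ne _ _ _ (by fin_cases ha <;> decide)]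
  · subst e₁ e₂
    simp
  · subst e₁ e₂
    obtain ⟨h41, h42⟩ := h₃ ω hω (by simpa using h10)
    have e38 : m₃.nat 38 0 = k := by rw [hF₃.nat 38 rfl]; simp
    have e43 : m₃.nat 43 0 = f := by rw [hF₃.nat 43 rfl]; simp [hf]
    have e9 : m₃.nat 9 0 = k := by rw [hF₃.nat 9 rfl]; simpa using h9
    have e40 : m₃.nat 40 0 = (lastLayer P - k) * 5 ^ numRows P := by
      rw [hF₃.nat 40 rfl]; simpa using hbase
    have e17 : m₃.nat 17 0 = 5 ^ numRows P := by rw [hF₃.nat 17 rfl]; simpa using hT.size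
    have e1 : m₃.nat 1 0 = m.nat 1 0 := by rw [hF₃.nat 1 rfl]; simp
    have er : ∀ a, m₃.real a = m.real a := fun a => by
      rw [hF₃.real a rfl]; rfl
    have eout : outputEdges m₃ = outputEdges m := outputEdges_congr e1 (er 2) (er 3) (er 4) (er 5)
    have hsub : (lastLayer P - k) * 5 ^ numRows P - 5 ^ numRows P =
        (lastLayer P - (k + 1)) * 5 ^ numRows P := by
      rw [show lastLayer P - k = lastLayer P - (k + 1) + 1 by omega, add_mul, one_mul,
        Nat.add_sub_cancel]
    have hcode : succCode P (numRows P) e ω b - 1 = code (numRows P) (step ω e b) := by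
      simp [succCode, hbs.1.1]
    have hω' := step_mem_stateSpace hω (rowsLt_of_mem_gridEdges hmem) b
    have hchosen := chosen_concat (e := e) (hpre ▸ he) b
    have key : ∀ m' : Mem, m'.nat 40 0 = (lastLayer P - (k + 1)) * 5 ^ numRows P →
        m'.nat 10 0 = code (numRows P) (step ω e b) →
        outputEdges m' = outputEdges m ++ (if b then [e.seg P] else []) →
        TraceInv P (k + 1) m' := by
      intro m' h40' h10' hout'
      refine ⟨h40', pre ++ [b], step ω e b, by simp [hpre], hω', h10', ?_, ⟨bs, hbs.tail⟩,
        fun bs' hbs' => ?_⟩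
      · rw [hout', hout, hchosen]
        cases b <;> simp
      · rw [List.append_assoc]
        refine hpost _ ?_
        rw [hdrop]
        exact hbs.cons hbs'
    simp only [Prog.wp, BExpr.eval_eq, NExpr.eval, e43, emit, RExpr.eval]
    refine ⟨fun h2 => ⟨?_, key _ ?_ ?_ ?_⟩, fun h2 => ⟨?_, key _ ?_ ?_ ?_⟩⟩
    · simpa using e9
    · simp [e40, e17, hsub]
    · obtain rfl := hb.2 h2
      simp [h42, hcode]
    · obtain rfl := hb.2 h2
      rw [← eout, if_pos rfl, seg_eq, gridPt_eq, gridPt_eq]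
      refine outputEdges_emit (c := m₃.nat 1 0) rfl (by simp) ?_ ?_ ?_ ?_ <;> funext j <;>
        simp [Function.update_apply, e38, er, hE.x, hE.y, hE.x', hE.y']
    · simpa using e9
    · simp [e40, e17, hsub]
    · obtain rfl : b = false := by
        by_contra hc
        exact h2 (hb.1 (by simpa using hc))
      simp [h41, hcode]
    · obtain rfl : b = false := by
        by_contra hc
        exact h2 (hb.1 (by simpa using hc))
      rw [← eout]
      rw [if_neg (by simp), List.append_nil]
      exact outputEdges_congr (by simp) rfl rfl rfl rfl

theorem runs_trace {P : Finset Pt} {m : Mem} (hT : TablesStored P m)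
    (hL : ∀ q ≤ lastLayer P, LayerStored P q m) (h1 : m.nat 1 0 = 0)
    (h40 : m.nat 40 0 = lastLayer P * 5 ^ numRows P)
    (hbest : ∃ bs, IsBest P (gridEdges (numRows P) (numCols P)) ∅ bs) :
    Runs trace m (3 + (lastLayer P + 2) * (traceBody.maxCost + 2 + 10)) fun m' =>
      ∃ bs, IsBest P (gridEdges (numRows P) (numCols P)) ∅ bs ∧
        outputEdges m' = (chosen (gridEdges (numRows P) (numCols P)) bs).map (GridEdge.seg P) := by
  have hinit : Runs (.setVar 10 (.lit 0)) m 3 (fun m' => m' = m.writeNat 10 0 0) :=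
    Runs.of_wp (by simp)
  refine hinit.seq fun m₁ _ e₁ => (Runs.forLoop (lastLayer P) (TraceInv P) ?_ ?_ ?_).imp ?_
  · subst e₁
    refine ⟨by simpa using h40, [], ∅, rfl, empty_mem_stateSpace _, by simp [code_empty], ?_,
      hbest, fun bs h => h⟩
    simp [outputEdges, h1, chosen]
  · intro k m' hF _
    subst e₁
    simp only [NExpr.eval]
    rw [hF.nat 11 rfl]
    simpa [lastLayer] using hT.edges.length
  · intro k hk m₂ hF h9 hI
    subst e₁
    refine (runs_traceBody (hT.congr (fun a ha => ?_) (fun a ha => ?_)) ?_ hk h9 hI).imp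
      fun m₃ _ h => ⟨h.1, ?_, ?_⟩
    · rw [hF.nat a (by fin_cases ha <;> rfl)]
      exact nat_writeNat_of_ne _ _ _ (by fin_cases ha <;> decide)
    · rw [hF.real a (by fin_cases ha <;> rfl)]
      rfl
    · intro q hq ω hω
      rw [hF.nat 37 rfl, hF.real 13 rfl]
      simpa using hL q hq ω hω
    · simpa using h.2.base
    · obtain ⟨pre, ω, k1, k2, k3, k4, k5⟩ := h.2.run
      exact ⟨pre, ω, k1, k2, by simpa using k3, by
        rw [← k4]; exact outputEdges_congr (by simp) rfl rfl rfl rfl, k5⟩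
  · rintro m' - ⟨-, pre, ω, hlen, -, -, hout, ⟨bs, hbs⟩, hpost⟩
    have hdrop : (gridEdges (numRows P) (numCols P)).drop (lastLayer P) = [] := by
      simp [lastLayer]
    have h := hpost bs hbs
    rw [hdrop] at hbs
    obtain rfl : bs = [] := by
      cases bs with
      | nil => rfl
      | cons b bs => exact hbs.1.elim
    rw [List.append_nil] at h
    exact ⟨pre, h, hout⟩

set_option linter.unusedSimpArgs false

/-- This splits the current index off a loop invariant, so that the previous invariant applies to
the rest. -/
theorem forall_le_iff {p : ℕ → Prop} {q : ℕ} : (∀ k ≤ q, p k) ↔ p q ∧ ∀ k < q, p k :=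
  ⟨fun h => ⟨h q le_rfl, fun k hk => h k hk.le⟩, fun h k hk =>
    hk.eq_or_lt.elim (fun h' => h' ▸ h.1) (h.2 k)⟩

theorem exists_le_iff {p : ℕ → Prop} {q : ℕ} : (∃ k ≤ q, p k) ↔ p q ∨ ∃ k < q, p k :=
  ⟨fun ⟨k, hk, h⟩ => hk.eq_or_lt.elim (fun h' => .inl (h' ▸ h)) fun h' => .inr ⟨k, h', h⟩,
    fun h => h.elim (fun h => ⟨q, le_rfl, h⟩) fun ⟨k, hk, h⟩ => ⟨k, hk.le, h⟩⟩

/-! ### Powers of five -/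

/-- Computes the powers of five and the addresses of the rows in the tables. -/
def powers : Prog :=
  .seq (.setVar 17 (.lit 1)) <|
  .seq (.forLoop 8 (.var 3) (.seq (.setNat 18 (.var 8) (.var 17))
    (.setVar 17 (.add (.var 17) (.add (.var 17) (.add (.var 17) (.add (.var 17) (.var 17)))))))) <|
  .seq (.setVar 48 (.lit 0)) <|
  .forLoop 8 (.var 3) (.seq (.setNat 15 (.var 8) (.var 48)) (.setVar 48 (.add (.var 48) (.var 17))))

theorem runs_powers {m : Mem} {h : ℕ} (hh : m.nat 3 0 = h) :
    Runs powers m (200 * (h + 2)) fun m' => m'.nat 17 0 = 5 ^ h ∧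
      (∀ k < h, m'.nat 18 k = 5 ^ k) ∧ ∀ k < h, m'.nat 15 k = k * 5 ^ h := by
  have h1 : Runs (.setVar 17 (.lit 1)) m _ (fun m' => m' = m.writeNat 17 0 1) :=
    Runs.of_wp (by simp)
  have h2 : ∀ m : Mem, Runs (.setVar 48 (.lit 0)) m _ (fun m' => m' = m.writeNat 48 0 0) :=
    fun m => Runs.of_wp (by simp)
  refine (h1.seq fun m₁ _ e₁ => (Runs.forLoop h
    (fun q m' => m'.nat 17 0 = 5 ^ q ∧ ∀ k < q, m'.nat 18 k = 5 ^ k) ?_ ?_ (fun q hq m₂ hF h8 hI =>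
      Runs.of_wp ?_)).seq fun m₂ hF₂ h₂ => (h2 m₂).seq fun m₃ _ e₃ => (Runs.forLoop h
    (fun q m' => m'.nat 48 0 = q * 5 ^ h ∧ ∀ k < q, m'.nat 15 k = k * 5 ^ h) ?_ ?_
      (fun q hq m₄ hF h8 hI => Runs.of_wp ?_)).imp fun m₄ hF₄ h₄ => ⟨?_, ?_, h₄.2⟩).mono_time ?_
  · subst e₁
    simp
  · intro q m' hF _
    simp only [NExpr.eval]
    rw [hF.nat 3 rfl, e₁]
    simpa using hh
  · simp [h8, hI.1]
    refine ⟨by ring, fun k hk => ?_⟩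
    split_ifs with h
    · rw [h]
    · exact hI.2 k (by omega)
  · subst e₃
    simp
  · intro q m' hF _
    simp only [NExpr.eval]
    rw [hF.nat 3 rfl, e₃, nat_writeNat_of_ne _ _ _ (by decide), hF₂.nat 3 rfl, e₁]
    simpa using hh
  · have e17 : m₄.nat 17 0 = 5 ^ h := by
      rw [hF.nat 17 rfl, e₃, nat_writeNat_of_ne _ _ _ (by decide), h₂.1]
    simp [h8, hI.1, e17]
    refine ⟨by ring, fun k hk => ?_⟩
    split_ifs with h
    · rw [h]
    · exact hI.2 k (by omega)
  · simp only [Prog.maxCost, NExpr.cost]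
    omega
  · rw [hF₄.nat 17 rfl, e₃, nat_writeNat_of_ne _ _ _ (by decide), h₂.1]
  · intro k hk
    rw [hF₄.nat 18 rfl, e₃, nat_writeNat_of_ne _ _ _ (by decide), h₂.2 k hk]

/-! ### The last layer -/

/-- The memory describes the grid: `0` the number of points, `2` the number of columns, `3` the
number of rows, real arrays `6` and `7` their coordinates, `5` the positions of the points. -/
structure GridStored (P : Finset Pt) (n : ℕ) (m : Mem) : Prop where
  stride : m.nat 0 0 = n
  cols : m.nat 2 0 = numCols P
  rows : m.nat 3 0 = numRows P
  x : ∀ j < numCols P, m.real 6 j = coord (P.image Prod.fst) j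
  y : ∀ i < numRows P, m.real 7 i = coord (P.image Prod.snd) i
  terminal : ∀ i < numRows P, ∀ j < numCols P, 0 < m.nat 5 (i * n + j) ↔ gridPt P i j ∈ P

theorem GridStored.congr {P : Finset Pt} {n : ℕ} {m m' : Mem} (hG : GridStored P n m)
    (hn : ∀ a ∈ [0, 2, 3, 5], m'.nat a = m.nat a) (hr : ∀ a ∈ [6, 7], m'.real a = m.real a) :
    GridStored P n m' := by
  simp only [List.forall_mem_cons, List.not_mem_nil, false_implies, implies_true, and_true] at hn hr
  obtain ⟨h1, h2, h3, h4, h5, h6⟩ := hG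
  obtain ⟨n0, n2, n3, n5⟩ := hn
  obtain ⟨r6, r7⟩ := hr
  exact ⟨n0 ▸ h1, n2 ▸ h2, n3 ▸ h3, r6 ▸ h4, r7 ▸ h5, n5 ▸ h6⟩

/-- Compares the label of row `8` with the first label `46`; `47` is the address of the last grid
vertex of the row in `5`. -/
def finalRowBody : Prog :=
  .seq (.setVar 27 (.get 20 (.var 8))) <|
  .seq (.ite (.eq (.var 27) (.lit 0))
    (.ite (.ltNat (.lit 0) (.get 5 (.var 47))) (.setVar 43 (.lit 0)) .skip)
    (.ite (.eq (.var 46) (.lit 0)) (.setVar 46 (.var 27))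
      (.ite (.eq (.var 46) (.var 27)) .skip (.setVar 43 (.lit 0))))) <|
  .setVar 47 (.add (.var 47) (.var 0))

/-- The machine has no real constants; the cost zero is obtained as the difference of a cell with
itself. -/
def finalBody : Prog :=
  .seq (decode (.var 10)) <|
  .seq (.seq (.setVar 43 (.lit 1)) (.seq (.setVar 46 (.lit 0))
    (.setVar 47 (.sub (.var 2) (.lit 1))))) <|
  .seq (.forLoop 8 (.var 3) finalRowBody) <|
  .seq (.ite (.eq (.var 46) (.lit 0)) (.setVar 43 (.lit 0)) .skip) <|
  .seq (.setNat 37 (.var 10) (.var 43))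
    (.setReal 13 (.var 10) (.sub (.get 7 (.lit 0)) (.get 7 (.lit 0))))

/-- Computes the entries for the last layer. -/
def finalLayer : Prog := .forLoop 10 (.var 17) finalBody

/-- All nonzero labels agree if and only if each agrees with the first one found, so one pass
decides whether there is at most one component. The case of no component at all is left to the test
of `46` in `finalBody`. -/
theorem runs_finalRows {m : Mem} {n h v : ℕ} (h0 : m.nat 0 0 = n) (hh : m.nat 3 0 = h)
    (h43 : m.nat 43 0 = 1) (h46 : m.nat 46 0 = 0) (h47 : m.nat 47 0 = v) :
    Runs (.forLoop 8 (.var 3) finalRowBody) m ((h + 2) * (finalRowBody.maxCost + 2 + 10)) fun m' =>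
      (m'.nat 46 0 = 0 ↔ ∀ k < h, m.nat 20 k = 0) ∧
      (m'.nat 46 0 ≠ 0 → ((m'.nat 43 0 ≠ 0 ↔
        (∀ k < h, m.nat 20 k = 0 → ¬ 0 < m.nat 5 (k * n + v)) ∧
        ∀ k < h, ∀ l < h, m.nat 20 k ≠ 0 → m.nat 20 l ≠ 0 → m.nat 20 k = m.nat 20 l))) := by
  refine (Runs.forLoop h (fun q m' => m'.nat 47 0 = q * n + v ∧
    (m'.nat 46 0 = 0 ↔ ∀ k < q, m.nat 20 k = 0) ∧
    (m'.nat 46 0 ≠ 0 → ∃ k < q, m.nat 20 k = m'.nat 46 0) ∧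
    (m'.nat 43 0 ≠ 0 ↔ (∀ k < q, m.nat 20 k = 0 → ¬ 0 < m.nat 5 (k * n + v)) ∧
      ∀ k < q, m.nat 20 k ≠ 0 → m.nat 20 k = m'.nat 46 0)) ?_ ?_
    (fun q hq m₂ hF h8 hI => Runs.of_wp ?_)).imp fun m' _ hI => ?_
  · simp [h43, h46, h47]
  · intro q m' hF _
    simp only [NExpr.eval]
    rw [hF.nat 3 rfl, hh]
  · obtain ⟨h1, h2, h3, h4⟩ := hI
    have e0 : m₂.nat 0 0 = n := by rw [hF.nat 0 rfl, h0]
    simp [finalRowBody, h8, h1, e0, hF.nat 20 rfl, hF.nat 5 rfl]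
    have e47 : q * n + v + n = (q + 1) * n + v := by ring
    simp only [forall_le_iff, exists_le_iff, e47, true_and]
    clear hF h8 h1
    generalize m₂.nat 46 0 = g at *
    generalize m₂.nat 43 0 = F at *
    generalize m.nat 20 = f at *
    simp only [not_lt, Nat.le_zero] at h4
    generalize hd : (fun k => m.nat 5 (k * n + v)) = d at *
    have hd' : ∀ k, m.nat 5 (k * n + v) = d k := fun k => congrFun hd k
    simp only [hd'] at h4 ⊢
    clear hd hd'
    refine ⟨fun k1 => ⟨fun k2 => ⟨?_, ?_, ?_⟩, fun k2 => ⟨?_, ?_, ?_⟩⟩, fun k1 =>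
      ⟨fun k2 => ⟨?_, ?_, ?_⟩, fun k2 => ⟨fun k3 => ⟨?_, ?_, ?_⟩, fun k3 => ⟨?_, ?_, ?_⟩⟩⟩⟩
    all_goals grind
  · obtain ⟨-, h2, h3, h4⟩ := hI
    refine ⟨h2, fun h5 => ?_⟩
    obtain ⟨k, hk, hk'⟩ := h3 h5
    rw [h4]
    refine and_congr_right fun _ => ⟨fun h6 k hk l hl h7 h8 => ?_, fun h6 l hl h7 => ?_⟩
    · rw [h6 k hk h7, h6 l hl h8]
    · rw [← hk']
      exact h6 l hl k hk h7 (hk' ▸ h5)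

theorem finalOK_iff {P : Finset Pt} {ω : FrontierState} (hω : IsPartial (numRows P) ω)
    {f : ℕ → ℕ} (hf : ∀ k < numRows P, f k = label ω k) {t : ℕ → Prop}
    (ht : ∀ k < numRows P, t k ↔ gridPt P k (numCols P - 1) ∈ P) :
    finalOK P ω ↔ (¬ ∀ k < numRows P, f k = 0) ∧ (∀ k < numRows P, f k = 0 → ¬ t k) ∧
      ∀ k < numRows P, ∀ l < numRows P, f k ≠ 0 → f l ≠ 0 → f k = f l := by
  have hs : ∀ a b, SameBlock ω a b ↔ a < numRows P ∧ b < numRows P ∧ f a ≠ 0 ∧ f a = f b := by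
    intro a b
    constructor
    · intro h
      have h1 := hω.lt_left h
      have h2 := hω.lt_right h
      exact ⟨h1, h2, by rw [hf a h1, hf b h2]; exact hω.sameBlock_iff_label.1 h⟩
    · rintro ⟨h1, h2, h3⟩
      rw [hf a h1, hf b h2] at h3
      exact hω.sameBlock_iff_label.2 h3
  have hc : ∀ k < numRows P, k ∈ covered ω ↔ f k ≠ 0 := fun k hk => by
    rw [mem_covered, hs]
    tauto
  rw [finalOK, hω.card_eq_one_iff]
  refine ⟨fun ⟨⟨⟨a, ha⟩, h1⟩, h2⟩ => ⟨fun h => ?_, fun k hk h0 htk => ?_, fun k hk l hl h3 h4 => ?_⟩,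
    fun ⟨h1, h2, h3⟩ => ⟨⟨?_, fun a b ha hb => ?_⟩, fun k hk hP => ?_⟩⟩
  · have := (hs a a).1 ha
    exact this.2.2.1 (h a this.1)
  · exact (hc k hk).1 (h2 k hk ((ht k hk).1 htk)) h0
  · exact ((hs k l).1 (h1 k l ((hs k k).2 ⟨hk, hk, h3, rfl⟩) ((hs l l).2 ⟨hl, hl, h4, rfl⟩))).2.2.2
  · push Not at h1
    obtain ⟨k, hk, h4⟩ := h1
    exact ⟨k, (hs k k).2 ⟨hk, hk, h4, rfl⟩⟩
  · have ha' := (hs a a).1 ha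
    have hb' := (hs b b).1 hb
    exact (hs a b).2 ⟨ha'.1, hb'.1, ha'.2.2.1, h3 a ha'.1 b hb'.1 ha'.2.2.1 hb'.2.2.1⟩
  · by_contra hcov
    rw [hc k hk, not_not] at hcov
    exact h2 k hk hcov ((ht k hk).2 hP)

theorem stored_nil {P : Finset Pt} {ω : FrontierState} {f : ℕ} {r : ℝ}
    (hf : f ≠ 0 ↔ finalOK P ω) (hr : r = 0) : Stored P [] ω f r := by
  subst hr
  refine ⟨fun h bs hacc => ?_, fun h => ⟨[], ⟨hf.1 h, fun bs' h' => ?_⟩, ?_, by simp⟩⟩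
  · cases bs with
    | nil => exact hf.2 hacc h
    | cons b bs => exact hacc
  · cases bs' with
    | nil => exact le_rfl
    | cons b bs => exact h'.elim
  · simp [cost, chosen]

theorem exists_runs_finalBody : ∃ K, ∀ (P : Finset Pt) (n c : ℕ) (m : Mem), GridStored P n m →
    1 ≤ numCols P → (∀ k < numRows P, m.nat 18 k = 5 ^ k) → m.nat 10 0 = c →
    Runs finalBody m (K * (numRows P + 2)) fun m' =>
      (∀ x ≠ c, m'.nat 37 x = m.nat 37 x ∧ m'.real 13 x = m.real 13 x) ∧
      ∀ ω ∈ stateSpace (numRows P), code (numRows P) ω = c →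
        Stored P [] ω (m'.nat 37 c) (m'.real 13 c) := by
  refine ⟨decodeBody.maxCost + finalRowBody.maxCost + 200, fun P n c m hG hv hpow h10 => ?_⟩
  have hinit : ∀ m : Mem, Runs (.seq (.setVar 43 (.lit 1)) (.seq (.setVar 46 (.lit 0))
      (.setVar 47 (.sub (.var 2) (.lit 1))))) m _ (fun m' => m'.nat 43 0 = 1 ∧ m'.nat 46 0 = 0 ∧
        m'.nat 47 0 = m.nat 2 0 - 1) := fun m => Runs.of_wp (by simp)
  refine ((runs_decode (h := numRows P) hG.rows hpow (.var 10)).seq fun m₁ hF₁ h₁ =>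
    (hinit m₁).seq fun m₂ hF₂ h₂ => (runs_finalRows (n := n) (h := numRows P)
      (v := numCols P - 1) ?_ ?_ h₂.1 h₂.2.1 ?_).seq fun m₃ hF₃ h₃ =>
    (Runs.of_wp (c := .seq (.ite (.eq (.var 46) (.lit 0)) (.setVar 43 (.lit 0)) .skip)
      (.seq (.setNat 37 (.var 10) (.var 43))
        (.setReal 13 (.var 10) (.sub (.get 7 (.lit 0)) (.get 7 (.lit 0))))))
      (Q := fun m' => ((m₃.nat 46 0 = 0 → m'.nat 37 c = 0) ∧
        (m₃.nat 46 0 ≠ 0 → m'.nat 37 c = m₃.nat 43 0)) ∧ m'.real 13 c = 0 ∧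
        ∀ x ≠ c, m'.nat 37 x = m.nat 37 x ∧ m'.real 13 x = m.real 13 x) ?_).imp
      fun m₄ _ h₄ => ⟨h₄.2.2, fun ω hω hc => ?_⟩).mono_time ?_
  · rw [hF₂.nat 0 rfl, hF₁.nat 0 rfl, hG.stride]
  · rw [hF₂.nat 3 rfl, hF₁.nat 3 rfl, hG.rows]
  · rw [h₂.2.2, hF₁.nat 2 rfl, hG.cols]
  · have e10 : m₃.nat 10 0 = c := by rw [hF₃.nat 10 rfl, hF₂.nat 10 rfl, hF₁.nat 10 rfl, h10]
    have e37 : m₃.nat 37 = m.nat 37 := by rw [hF₃.nat 37 rfl, hF₂.nat 37 rfl, hF₁.nat 37 rfl]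
    have e13 : m₃.real 13 = m.real 13 := by
      rw [hF₃.real 13 rfl, hF₂.real 13 rfl, hF₁.real 13 rfl]
    simp [e10, e37, e13]
    refine ⟨fun h => ⟨fun h' => absurd h h', ?_⟩, fun h => ⟨fun h' => absurd h' h, ?_⟩⟩ <;>
    · intro x hx
      simp [hx]
  · simp only [Prog.maxCost, NExpr.cost, RExpr.cost, BExpr.cost, BExpr.eq]
    nlinarith
  · have e20 : m₂.nat 20 = m₁.nat 20 := hF₂.nat 20 rfl
    have e5 : m₂.nat 5 = m.nat 5 := by rw [hF₂.nat 5 rfl, hF₁.nat 5 rfl]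
    rw [e20, e5] at h₃
    have hl : ∀ k < numRows P, m₁.nat 20 k = label ω k := fun k hk =>
      (h₁ ω hω (by simp [h10, hc]) k hk).1
    refine stored_nil ?_ h₄.2.1
    rw [finalOK_iff (mem_stateSpace.1 hω).1 hl fun k hk => hG.terminal k hk _ (by omega), ← h₃.1]
    by_cases h46 : m₃.nat 46 0 = 0
    · simp [h₄.1.1 h46, h46]
    · rw [h₄.1.2 h46, h₃.2 h46]
      simp [h46]

theorem exists_runs_finalLayer : ∃ K, ∀ (P : Finset Pt) (n : ℕ) (m : Mem), GridStored P n m →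
    1 ≤ numCols P → 1 ≤ numRows P → (∀ k < numRows P, m.nat 18 k = 5 ^ k) →
    m.nat 17 0 = 5 ^ numRows P →
    Runs finalLayer m (K * (5 ^ numRows P * numRows P)) (LayerStored P 0) := by
  obtain ⟨K, hK⟩ := exists_runs_finalBody
  refine ⟨3 * (3 * K + (NExpr.var 17).cost + 10), fun P n m hG hv hh hpow h17 => ?_⟩
  have h5 : 1 ≤ 5 ^ numRows P := Nat.one_le_pow _ _ (by decide)
  refine ((Runs.forLoop (T := K * (numRows P + 2)) (5 ^ numRows P) (fun c m' =>
    ∀ ω ∈ stateSpace (numRows P), code (numRows P) ω < c →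
      Stored P [] ω (m'.nat 37 (code (numRows P) ω)) (m'.real 13 (code (numRows P) ω)))
    (by simp) ?_ ?_).imp ?_).mono_time (loop_time_le (K := 3 * K) h5 hh (by nlinarith))
  · intro c m' hF _
    simp only [NExpr.eval]
    rw [hF.nat 17 rfl, h17]
  · intro c hc m₁ hF h10 hI
    refine (hK P n c m₁ (hG.congr (fun a ha => ?_) (fun a ha => ?_)) hv (fun k hk => ?_) h10).imp
      fun m₂ hF₂ h₂ => ⟨by rw [hF₂.nat 10 rfl, h10], fun ω hω hcω => ?_⟩
    · exact hF.nat a (by fin_cases ha <;> rfl)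
    · exact hF.real a (by fin_cases ha <;> rfl)
    · rw [hF.nat 18 rfl, hpow k hk]
    · rw [nat_writeNat_of_ne _ _ _ (by decide), real_writeNat]
      rcases (Nat.lt_succ_iff.1 hcω).eq_or_lt with h | h
      · rw [h]
        exact h₂.2 ω hω h
      · rw [(h₂.1 _ h.ne).1, (h₂.1 _ h.ne).2]
        exact hI ω hω h
  · intro m' _ hI ω hω
    have hdrop : (gridEdges (numRows P) (numCols P)).drop (lastLayer P - 0) = [] := by
      simp [lastLayer]
    rw [hdrop, zero_mul, zero_add]
    exact hI ω hω (code_lt _ ω)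

set_option linter.unusedSimpArgs false

/-! ### The list of the grid edges -/

/-- Appends an edge that starts in row `9` and column `10` to the list of edges; `48` is the address
of its first end in the array `5`. -/
def edgeBody (kind : ℕ) (row col : NExpr) : Prog :=
  .seq (.setNat 12 (.var 11) (.lit kind)) <| .seq (.setNat 13 (.var 11) (.var 9)) <|
  .seq (.setNat 14 (.var 11) (.get 5 (.var 48))) <|
  .seq (.setReal 9 (.var 11) (.get 6 (.var 10))) <|
  .seq (.setReal 10 (.var 11) (.get 7 (.var 9))) <|
  .seq (.setReal 11 (.var 11) (.get 6 col)) <| .seq (.setReal 12 (.var 11) (.get 7 row)) <|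
  .seq (.setVar 48 (.add (.var 48) (.var 0))) (.setVar 11 (.add (.var 11) (.lit 1)))

def vertBody : Prog := edgeBody 0 (.add (.var 9) (.lit 1)) (.var 10)

def horizBody : Prog := edgeBody 1 (.var 9) (.add (.var 10) (.lit 1))

/-- Lists the grid edges. -/
def edgeList : Prog :=
  .seq (.setVar 11 (.lit 0)) <| .forLoop 10 (.var 2) <|
  .seq (.seq (.setVar 48 (.var 10)) (.forLoop 9 (.sub (.var 3) (.lit 1)) vertBody)) <|
  .ite (.ltNat (.add (.var 10) (.lit 1)) (.var 2))
    (.seq (.setVar 48 (.var 10)) (.forLoop 9 (.var 3) horizBody)) .skip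

theorem EdgesStored.concat {P : Finset Pt} {l : List GridEdge} {e : GridEdge} {m m' : Mem}
    (hE : EdgesStored P l m) (h11 : m'.nat 11 0 = l.length + 1)
    (hn : ∀ a ∈ [12, 13, 14], ∀ k ≠ l.length, m'.nat a k = m.nat a k)
    (hr : ∀ a ∈ [9, 10, 11, 12], ∀ k ≠ l.length, m'.real a k = m.real a k)
    (he : EdgeStored P l.length e m') : EdgesStored P (l ++ [e]) m' := by
  simp only [List.forall_mem_cons, List.not_mem_nil, false_implies, implies_true, and_true] at hn hr
  obtain ⟨n1, n2, n3⟩ := hn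
  obtain ⟨r1, r2, r3, r4⟩ := hr
  refine ⟨by simpa using h11, fun k e' hk => ?_⟩
  rcases lt_trichotomy k l.length with h | rfl | h
  · rw [List.getElem?_append_left h] at hk
    obtain ⟨h1, h2, h3, h4, h5, h6, h7⟩ := hE.edge k e' hk
    exact ⟨by rw [n1 k h.ne, h1], by rw [n2 k h.ne, h2], by rw [n3 k h.ne, h3],
      by rw [r1 k h.ne, h4], by rw [r2 k h.ne, h5], by rw [r3 k h.ne, h6], by rw [r4 k h.ne, h7]⟩
  · obtain rfl : e = e' := by simpa using hk
    exact he
  · rw [List.getElem?_eq_none (by simp; omega)] at hk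
    simp at hk

/-- What is known while the edges from column `j` are listed. -/
structure ListInv (P : Finset Pt) (n j a : ℕ) (l : List GridEdge) (m : Mem) : Prop where
  edges : EdgesStored P l m
  col : m.nat 10 0 = j
  address : m.nat 48 0 = a

theorem runs_vertBody {P : Finset Pt} {n i j : ℕ} {l : List GridEdge} {m : Mem}
    (hG : GridStored P n m) (hi : i + 1 < numRows P) (hj : j < numCols P) (h9 : m.nat 9 0 = i)
    (hI : ListInv P n j (i * n + j) l m) :
    Runs vertBody m vertBody.maxCost fun m' =>
      m'.nat 9 0 = i ∧ ListInv P n j ((i + 1) * n + j) (l ++ [.vert i j]) m' := by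
  apply Runs.of_wp
  have h11 := hI.edges.length
  simp only [vertBody, edgeBody, Prog.wp, NExpr.eval, RExpr.eval, nat_writeNat, nat_writeReal,
    real_writeReal, real_writeNat, Nat.reduceEqDiff, false_and, if_false, true_and, if_true,
    h11, hI.col, hI.address, h9, hG.stride]
  refine ⟨hI.edges.concat (by simp) ?_ ?_ ⟨?_, ?_, ?_, ?_, ?_, ?_, ?_⟩, ?_, ?_⟩
  · intro a ha k hk
    fin_cases ha <;> simp [hk]
  · intro a ha k hk
    fin_cases ha <;> simp [hk]
  · simp
  · simp [GridEdge.src]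
  · simpa [GridEdge.src] using hG.terminal i (by omega) j hj
  · simpa [GridEdge.src] using hG.x j hj
  · simpa [GridEdge.src] using hG.y i (by omega)
  · simpa [GridEdge.tgt] using hG.x j hj
  · simpa [GridEdge.tgt] using hG.y (i + 1) hi
  · simpa using hI.col
  · simp [add_mul]
    omega

theorem runs_horizBody {P : Finset Pt} {n i j : ℕ} {l : List GridEdge} {m : Mem}
    (hG : GridStored P n m) (hi : i < numRows P) (hj : j + 1 < numCols P) (h9 : m.nat 9 0 = i)
    (hI : ListInv P n j (i * n + j) l m) :
    Runs horizBody m horizBody.maxCost fun m' =>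
      m'.nat 9 0 = i ∧ ListInv P n j ((i + 1) * n + j) (l ++ [.horiz i j]) m' := by
  apply Runs.of_wp
  have h11 := hI.edges.length
  simp only [horizBody, edgeBody, Prog.wp, NExpr.eval, RExpr.eval, nat_writeNat, nat_writeReal,
    real_writeReal, real_writeNat, Nat.reduceEqDiff, false_and, if_false, true_and, if_true,
    h11, hI.col, hI.address, h9, hG.stride]
  refine ⟨hI.edges.concat (by simp) ?_ ?_ ⟨?_, ?_, ?_, ?_, ?_, ?_, ?_⟩, ?_, ?_⟩
  · intro a ha k hk
    fin_cases ha <;> simp [hk]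
  · intro a ha k hk
    fin_cases ha <;> simp [hk]
  · simp
  · simp [GridEdge.src]
  · simpa [GridEdge.src] using hG.terminal i hi j (by omega)
  · simpa [GridEdge.src] using hG.x j (by omega)
  · simpa [GridEdge.src] using hG.y i hi
  · simpa [GridEdge.tgt] using hG.x (j + 1) hj
  · simpa [GridEdge.tgt] using hG.y i hi
  · simpa using hI.col
  · simp [add_mul]
    omega

/-- The edges that start in column `j`. -/
def columnEdges (h v j : ℕ) : List GridEdge :=
  (List.range (h - 1)).map (fun i => GridEdge.vert i j) ++
    if j + 1 < v then (List.range h).map (fun i => GridEdge.horiz i j) else []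

theorem EdgesStored.writeNat {P : Finset Pt} {l : List GridEdge} {m : Mem}
    (hE : EdgesStored P l m) {a : ℕ} (ha : a ∉ [11, 12, 13, 14]) (i k : ℕ) :
    EdgesStored P l (m.writeNat a i k) :=
  hE.congr (fun _ hb => nat_writeNat_of_ne _ _ _ fun h => ha (h ▸ hb)) fun _ _ => rfl

theorem ListInv.writeNat {P : Finset Pt} {n j a : ℕ} {l : List GridEdge} {m : Mem}
    (hI : ListInv P n j a l m) {b : ℕ} (hb : b ∉ [10, 11, 12, 13, 14, 48]) (i k : ℕ) :
    ListInv P n j a l (m.writeNat b i k) := by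
  simp only [List.mem_cons, List.not_mem_nil, or_false, not_or] at hb
  refine ⟨hI.edges.writeNat (by simp; tauto) i k, ?_, ?_⟩
  · rw [nat_writeNat_of_ne _ _ _ (by tauto), hI.col]
  · rw [nat_writeNat_of_ne _ _ _ (by tauto), hI.address]

/-- The marks of the vertices `(i, j)` are kept at `i * n + j`. Without multiplication, the address
starts at `j` in each loop over the rows and grows by `n` per row. -/
theorem exists_runs_edgeList : ∃ K, ∀ (P : Finset Pt) (n : ℕ) (m : Mem), GridStored P n m →
    1 ≤ numCols P → 1 ≤ numRows P → Runs edgeList m (K * (numCols P * numRows P)) fun m' =>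
      EdgesStored P (gridEdges (numRows P) (numCols P)) m' := by
  refine ⟨3 + 3 * (6 * (vertBody.maxCost + horizBody.maxCost + 30) + (NExpr.var 2).cost + 10),
    fun P n m hG hv hh => ?_⟩
  have hinit : Runs (.setVar 11 (.lit 0)) m 3 (fun m' => m' = m.writeNat 11 0 0) :=
    Runs.of_wp (by simp)
  have hset : ∀ m : Mem, Runs (.setVar 48 (.var 10)) m 4
      (fun m' => m' = m.writeNat 48 0 (m.nat 10 0)) := fun m => Runs.of_wp (by simp)
  refine (hinit.seq fun m₁ _ e₁ => (Runs.forLoop (T := 2 * ((numRows P + 2) * (vertBody.maxCost +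
    horizBody.maxCost + 30))) (numCols P)
    (fun j m' => EdgesStored P ((List.range j).flatMap (columnEdges (numRows P) (numCols P))) m')
    ?_ ?_ fun j hj m₂ hF₂ h10 hE => ?_)).mono_time ?_
  · subst e₁
    exact ⟨by simp, by simp⟩
  · intro j m' hF _
    simp only [NExpr.eval]
    rw [hF.nat 2 rfl, e₁, nat_writeNat_of_ne _ _ _ (by decide), hG.cols]
  · have hG₂ : GridStored P n m₂ := by
      subst e₁
      refine hG.congr (fun a ha => ?_) (fun a ha => ?_)
      · rw [hF₂.nat a (by fin_cases ha <;> rfl)]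
        exact nat_writeNat_of_ne _ _ _ (by fin_cases ha <;> decide)
      · rw [hF₂.real a (by fin_cases ha <;> rfl)]
        rfl
    set l := (List.range j).flatMap (columnEdges (numRows P) (numCols P)) with hl
    have hverts := (hset m₂).seq fun m₃ _ e₃ => Runs.forLoop (i := 9)
      (bound := .sub (.var 3) (.lit 1)) (c := vertBody) (m := m₃) (T := vertBody.maxCost)
      (numRows P - 1) (fun i m' => ListInv P n j (i * n + j)
        (l ++ (List.range i).map fun i => GridEdge.vert i j) m') (by
        subst e₃
        simpa using (ListInv.mk (n := n) (j := j) (a := j) (hE.writeNat (a := 48) (by decide) 0 _)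
          (by simpa using h10) (by simpa using h10)).writeNat (b := 9) (by decide) 0 0) (by
        intro i m' hF _
        simp only [NExpr.eval]
        rw [hF.nat 3 rfl, e₃, nat_writeNat_of_ne _ _ _ (by decide), hG₂.rows]) (by
        intro i hi m₄ hF₄ h9 hI
        have hG₄ : GridStored P n m₄ := by
          subst e₃
          refine hG₂.congr (fun a ha => ?_) (fun a ha => ?_)
          · rw [hF₄.nat a (by fin_cases ha <;> rfl)]
            exact nat_writeNat_of_ne _ _ _ (by fin_cases ha <;> decide)
          · rw [hF₄.real a (by fin_cases ha <;> rfl)]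
            rfl
        refine (runs_vertBody hG₄ (by omega) hj h9 hI).imp fun m₅ _ h₅ => ⟨h₅.1, ?_⟩
        have := h₅.2.writeNat (b := 9) (by decide) 0 (i + 1)
        rwa [List.append_assoc, ← List.map_singleton (f := fun i => GridEdge.vert i j),
          ← List.map_append, ← List.range_succ] at this)
    refine ((hverts.seq (d := .ite (.ltNat (.add (.var 10) (.lit 1)) (.var 2))
      (.seq (.setVar 48 (.var 10)) (.forLoop 9 (.var 3) horizBody)) .skip)
      (T' := 7 + 1 + (4 + (numRows P + 2) * (horizBody.maxCost + 2 + 10)))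
      (Q := fun m' => m'.nat 10 0 = j ∧
        EdgesStored P (l ++ columnEdges (numRows P) (numCols P) j) m') fun m₃ hF₃ h₃ => ?_).imp
      fun m₄ _ h₄ => ⟨h₄.1, ?_⟩).mono_time ?_
    · have hG₃ : GridStored P n m₃ := hG₂.congr (fun a ha => hF₃.nat a (by fin_cases ha <;> rfl))
        (fun a ha => hF₃.real a (by fin_cases ha <;> rfl))
      by_cases hj' : j + 1 < numCols P
      · refine Runs.iteTrue (by simpa [h₃.col, hG₃.cols] using hj') ?_
        refine (hset m₃).seq fun m₄ _ e₄ => (Runs.forLoop (numRows P)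
          (fun i m' => ListInv P n j (i * n + j) ((l ++ (List.range (numRows P - 1)).map
            fun i => GridEdge.vert i j) ++ (List.range i).map fun i => GridEdge.horiz i j) m')
          ?_ ?_ ?_).imp ?_
        · subst e₄
          simpa using (ListInv.mk (n := n) (j := j) (a := j)
            (h₃.edges.writeNat (a := 48) (by decide) 0 _)
            (by simpa using h₃.col) (by simpa using h₃.col)).writeNat (b := 9) (by decide) 0 0
        · intro i m' hF _
          simp only [NExpr.eval]
          rw [hF.nat 3 rfl, e₄, nat_writeNat_of_ne _ _ _ (by decide), hG₃.rows]
        · intro i hi m₅ hF₅ h9 hI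
          have hG₅ : GridStored P n m₅ := by
            subst e₄
            refine hG₃.congr (fun a ha => ?_) (fun a ha => ?_)
            · rw [hF₅.nat a (by fin_cases ha <;> rfl)]
              exact nat_writeNat_of_ne _ _ _ (by fin_cases ha <;> decide)
            · rw [hF₅.real a (by fin_cases ha <;> rfl)]
              rfl
          refine (runs_horizBody hG₅ hi hj' h9 hI).imp fun m₆ _ h₆ => ⟨h₆.1, ?_⟩
          have := h₆.2.writeNat (b := 9) (by decide) 0 (i + 1)
          rwa [List.append_assoc, ← List.map_singleton (f := fun i => GridEdge.horiz i j),
            ← List.map_append, ← List.range_succ] at this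
        · intro m₅ _ h₅
          refine ⟨h₅.col, ?_⟩
          rw [columnEdges, if_pos hj', ← List.append_assoc]
          exact h₅.edges
      · refine (Runs.iteFalse (by simpa [h₃.col, hG₃.cols] using hj')
          (Runs.of_wp (c := .skip) ?_)).mono_time ?_
        · refine ⟨h₃.col, ?_⟩
          rw [columnEdges, if_neg hj', List.append_nil]
          exact h₃.edges
        · simp only [Prog.maxCost, BExpr.cost, NExpr.cost]
          omega
    · simp only [NExpr.cost]
      have h1 : numRows P - 1 + 2 ≤ numRows P + 2 := by omega
      have h2 := Nat.mul_le_mul_right (vertBody.maxCost + (1 + 1 + 1 + 1) + 10) h1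
      nlinarith
    · rw [List.range_succ, List.flatMap_append]
      simpa using h₄.2.writeNat (a := 10) (by decide) 0 (j + 1)
  · have := loop_time_le (c := (NExpr.var 2).cost) (T := 2 * ((numRows P + 2) * (vertBody.maxCost +
      horizBody.maxCost + 30))) (K := 6 * (vertBody.maxCost + horizBody.maxCost + 30)) hv hh
      (by nlinarith)
    refine (Nat.add_le_add_left this 3).trans ?_
    rw [add_mul]
    have h6 : 1 ≤ numCols P * numRows P := Nat.mul_pos hv hh
    exact Nat.add_le_add_right (by omega) _

set_option linter.unusedSimpArgs false

/-! ### The columns of the grid -/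

/-- The first `v` values of `a` are the elements of `s` in increasing order. -/
def ListsInOrder (s : Finset ℝ) (v : ℕ) (a : ℕ → ℝ) : Prop :=
  (∀ k < v, ∀ j < k, a j < a k) ∧ ∀ x, x ∈ s ↔ ∃ j < v, a j = x

/-- A finite set has only one increasing enumeration. -/
theorem ListsInOrder.eq {s : Finset ℝ} {v : ℕ} {a : ℕ → ℝ} (h : ListsInOrder s v a) :
    v = s.card ∧ ∀ j < s.card, a j = coord s j := by
  have hinj : Set.InjOn a (Finset.range v : Finset ℕ) := by
    intro j hj k hk hjk
    simp only [Finset.coe_range, Set.mem_Iio] at hj hk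
    rcases lt_trichotomy j k with h1 | h1 | h1
    · exact absurd hjk (h.1 k hk j h1).ne
    · exact h1
    · exact absurd hjk (h.1 j hj k h1).ne'
  have hs : (Finset.range v).image a = s := by
    ext x
    simp [h.2]
  have hv : v = s.card := by
    rw [← hs, Finset.card_image_of_injOn hinj, Finset.card_range]
  refine ⟨hv, fun j hj => ?_⟩
  subst hv
  have := Finset.orderEmbOfFin_unique (s := s) rfl (f := fun i : Fin s.card => a i)
    (fun i => (h.2 _).2 ⟨i, i.2, rfl⟩) (fun i k hik => h.1 k k.2 i hik)
  have h2 := congrFun this ⟨j, hj⟩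
  rw [coord_eq_getElem hj]
  exact h2

/-- The memory holds the points of `P`, listed from left to right. -/
structure InputStored (P : Finset Pt) (n : ℕ) (m : Mem) : Prop where
  num : m.nat 0 0 = n
  mem : ∀ p, p ∈ P ↔ ∃ k < n, (m.real 0 k, m.real 1 k) = p
  le : ∀ k < n, ∀ q ≤ k, m.real 0 q ≤ m.real 0 k

/-- Adds the column of the point `8` if it is new. -/
def columnBody : Prog :=
  .seq (.ite (.or (.eq (.var 2) (.lit 0))
      (.ltReal (.get 6 (.sub (.var 2) (.lit 1))) (.get 0 (.var 8))))
    (.seq (.setReal 6 (.var 2) (.get 0 (.var 8))) (.setVar 2 (.add (.var 2) (.lit 1)))) .skip)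
  (.setNat 4 (.var 8) (.sub (.var 2) (.lit 1)))

/-- Computes the columns of the grid and the column of each point. -/
def columns : Prog := .seq (.setVar 2 (.lit 0)) (.forLoop 8 (.var 0) columnBody)

/-- The points come in order of `x`, so each lies on the last column found or starts a new one; one
pass suffices. -/
theorem runs_columns {P : Finset Pt} {n : ℕ} {m : Mem} (hI : InputStored P n m) :
    Runs columns m (3 + (n + 2) * (columnBody.maxCost + 2 + 10)) fun m' =>
      m'.nat 2 0 = numCols P ∧ (∀ j < numCols P, m'.real 6 j = coord (P.image Prod.fst) j) ∧
      ∀ k < n, m'.nat 4 k < numCols P ∧ m.real 0 k = coord (P.image Prod.fst) (m'.nat 4 k) := by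
  have hinit : Runs (.setVar 2 (.lit 0)) m 3 (fun m' => m' = m.writeNat 2 0 0) :=
    Runs.of_wp (by simp)
  refine hinit.seq fun m₁ _ e₁ => (Runs.forLoop n (fun k m' =>
    (∀ j < m'.nat 2 0, ∀ i < j, m'.real 6 i < m'.real 6 j) ∧
    (∀ j < m'.nat 2 0, ∃ q < k, m.real 0 q = m'.real 6 j) ∧
    (∀ q < k, m'.nat 4 q < m'.nat 2 0 ∧ m'.real 6 (m'.nat 4 q) = m.real 0 q) ∧
    ∀ q < k, m.real 0 q ≤ m'.real 6 (m'.nat 2 0 - 1)) ?_ ?_ ?_).imp ?_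
  · subst e₁
    simp
  · intro k m' hF _
    simp only [NExpr.eval]
    rw [hF.nat 0 rfl, e₁, nat_writeNat_of_ne _ _ _ (by decide), hI.num]
  · rintro k hk m₂ hF h8 ⟨h1, h2, h3, h4⟩
    apply Runs.of_wp
    have e0 : m₂.real 0 = m.real 0 := by rw [hF.real 0 rfl, e₁]; rfl
    have hle : ∀ q < k, m.real 0 q ≤ m.real 0 k := fun q hq => hI.le k hk q hq.le
    simp [columnBody, h8, e0]
    generalize m₂.nat 2 0 = v at *
    generalize m₂.real 6 = a at *
    generalize m₂.nat 4 = col at *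
    refine ⟨fun hv => ⟨fun j hj i hij => ?_, fun j hj => ?_, fun q hq => ?_, ?_⟩,
      fun hv hv' => ⟨h1, fun j hj => ?_, fun q hq => ?_, fun q hq => ?_⟩⟩
    · rw [if_neg (by omega : i ≠ v)]
      split_ifs with h
      · rcases hv with hv | hv
        · omega
        · rcases (Nat.le_sub_one_of_lt (h ▸ hij : i < v)).eq_or_lt with h' | h'
          · rwa [h']
          · exact (h1 (v - 1) (by omega) i h').trans hv
      · exact h1 j (by omega) i hij
    · split_ifs with h
      · exact ⟨k, le_rfl, rfl⟩
      · obtain ⟨q, hq, h'⟩ := h2 j (by omega)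
        exact ⟨q, hq.le, h'⟩
    · by_cases hqk : q = k
      · simp [hqk]
      · have h' := h3 q (by omega)
        simp [hqk, h'.1.ne, h'.1.le, h'.2]
    · exact fun q hq => hI.le k hk q hq
    · obtain ⟨q, hq, h'⟩ := h2 j hj
      exact ⟨q, hq.le, h'⟩
    · by_cases hqk : q = k
      · obtain ⟨q', hq', h'⟩ := h2 (v - 1) (by omega)
        have := hle q' hq'
        simp only [hqk, if_true]
        exact ⟨by omega, by linarith⟩
      · simpa [hqk] using h3 q (by omega)
    · by_cases hqk : q = k
      · rwa [hqk]
      · exact h4 q (by omega)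
  · rintro m' - ⟨h1, h2, h3, -⟩
    have hL : ListsInOrder (P.image Prod.fst) (m'.nat 2 0) (m'.real 6) := by
      refine ⟨h1, fun x => ?_⟩
      simp only [Finset.mem_image]
      constructor
      · rintro ⟨p, hp, rfl⟩
        obtain ⟨k, hk, rfl⟩ := (hI.mem p).1 hp
        exact ⟨_, (h3 k hk).1, (h3 k hk).2⟩
      · rintro ⟨j, hj, rfl⟩
        obtain ⟨q, hq, h⟩ := h2 j hj
        exact ⟨_, (hI.mem _).2 ⟨q, hq, rfl⟩, h⟩
    obtain ⟨hv, hx⟩ := hL.eq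
    refine ⟨hv, hx, fun k hk => ?_⟩
    rw [hv] at h3
    exact ⟨(h3 k hk).1, by rw [← hx _ (h3 k hk).1, (h3 k hk).2]⟩

/-! ### The rows of the grid -/

/-- Marks the point `8` if it lies in the last row found, and compares it with the best candidate
for the next row. -/
def rowBody : Prog :=
  .ite (.or (.eq (.var 3) (.lit 0))
      (.ltReal (.get 7 (.sub (.var 3) (.lit 1))) (.get 1 (.var 8))))
    (.ite (.or (.eq (.var 7) (.lit 0)) (.ltReal (.get 1 (.var 8)) (.get 8 (.lit 0))))
      (.seq (.setVar 7 (.lit 1)) (.setReal 8 (.lit 0) (.get 1 (.var 8)))) .skip)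
    (.ite (.ltReal (.get 1 (.var 8)) (.get 7 (.sub (.var 3) (.lit 1)))) .skip
      (.setNat 5 (.add (.sub (.var 6) (.var 0)) (.get 4 (.var 8))) (.lit 1)))

def nextRow : Prog :=
  .seq (.setVar 7 (.lit 0)) <| .seq (.forLoop 8 (.var 0) rowBody) <|
  .ite (.ltNat (.lit 0) (.var 7))
    (.seq (.setReal 7 (.var 3) (.get 8 (.lit 0))) (.seq (.setVar 3 (.add (.var 3) (.lit 1)))
      (.setVar 6 (.add (.var 6) (.var 0))))) .skip

/-- Computes the rows of the grid and the positions of the points. -/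
def rows : Prog :=
  .seq (.seq (.setVar 3 (.lit 0)) (.seq (.setVar 6 (.lit 0)) (.setVar 7 (.lit 1))))
    (.loop (.ltNat (.lit 0) (.var 7)) nextRow)

/-- After `t` rows have been found, a pass does two things: among the points above row `t - 1` it
finds the lowest, which gives row `t`, and it marks the points on row `t - 1`. For `t = 0` the
truncated index `t - 1` is harmless, since every point is a candidate. -/
theorem runs_rowLoop {m : Mem} {n t : ℕ} (h0 : m.nat 0 0 = n) (h3 : m.nat 3 0 = t)
    (h6 : m.nat 6 0 = t * n) (h7 : m.nat 7 0 = 0) :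
    Runs (.forLoop 8 (.var 0) rowBody) m ((n + 2) * (rowBody.maxCost + 2 + 10)) fun m' =>
      (m'.nat 7 0 = 0 ↔ ∀ q < n, ¬ (t = 0 ∨ m.real 7 (t - 1) < m.real 1 q)) ∧
      (m'.nat 7 0 ≠ 0 → (∃ q < n, (t = 0 ∨ m.real 7 (t - 1) < m.real 1 q) ∧
        m.real 1 q = m'.real 8 0) ∧ ∀ q < n, (t = 0 ∨ m.real 7 (t - 1) < m.real 1 q) →
          m'.real 8 0 ≤ m.real 1 q) ∧
      ∀ x, 0 < m'.nat 5 x ↔ 0 < m.nat 5 x ∨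
        ∃ q < n, t ≠ 0 ∧ m.real 1 q = m.real 7 (t - 1) ∧ x = (t - 1) * n + m.nat 4 q := by
  refine Runs.forLoop n (fun k m' => (m'.nat 7 0 = 0 ↔
      ∀ q < k, ¬ (t = 0 ∨ m.real 7 (t - 1) < m.real 1 q)) ∧
      (m'.nat 7 0 ≠ 0 → (∃ q < k, (t = 0 ∨ m.real 7 (t - 1) < m.real 1 q) ∧
        m.real 1 q = m'.real 8 0) ∧ ∀ q < k, (t = 0 ∨ m.real 7 (t - 1) < m.real 1 q) →
          m'.real 8 0 ≤ m.real 1 q) ∧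
      ∀ x, 0 < m'.nat 5 x ↔ 0 < m.nat 5 x ∨
        ∃ q < k, t ≠ 0 ∧ m.real 1 q = m.real 7 (t - 1) ∧ x = (t - 1) * n + m.nat 4 q) ?_ ?_ ?_
  · simp [h7]
  · intro k m' hF _
    simp only [NExpr.eval]
    rw [hF.nat 0 rfl, h0]
  · rintro k hk m₂ hF h8 ⟨k1, k2, k3⟩
    apply Runs.of_wp
    have e1 : m₂.real 1 = m.real 1 := hF.real 1 rfl
    have e7 : m₂.real 7 = m.real 7 := hF.real 7 rfl
    have e3 : m₂.nat 3 0 = t := by rw [hF.nat 3 rfl, h3]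
    have e0 : m₂.nat 0 0 = n := by rw [hF.nat 0 rfl, h0]
    -- The variable `6` is one row ahead of the row that is being marked.
    have e6 : m₂.nat 6 0 - n = (t - 1) * n := by rw [hF.nat 6 rfl, h6, Nat.sub_mul, one_mul]
    have e4 : m₂.nat 4 = m.nat 4 := hF.nat 4 rfl
    simp [rowBody, h8, e1, e7, e3, e0, e6, e4]
    simp only [forall_le_iff, exists_le_iff]
    clear hF h8 e1 e7 e3 e0 e6 e4 h0 h3 h6 h7
    generalize m₂.nat 7 0 = fnd at *
    generalize m₂.real 8 0 = best at *
    generalize m₂.nat 5 = mark at *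
    generalize m.nat 5 = mark₀ at *
    generalize m.nat 4 = col at *
    generalize m.real 1 = y at *
    generalize m.real 7 (t - 1) = z at *
    refine ⟨fun k4 => ⟨fun k5 => ⟨?_, ⟨?_, ?_⟩, ?_⟩, fun k5 k6 => ⟨?_, ?_, ?_⟩⟩,
      fun k4 k5 => ⟨fun k6 => ⟨?_, ?_, ?_⟩, fun k6 => ⟨?_, ?_, ?_⟩⟩⟩
    all_goals grind

/-- What is known when `t` rows have been looked for. -/
structure RowInv (s : Finset ℝ) (n : ℕ) (y : ℕ → ℝ) (col : ℕ → ℕ) (t : ℕ) (m : Mem) : Prop where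
  num : m.nat 3 0 = min t s.card
  base : m.nat 6 0 = min t s.card * n
  found : 0 < m.nat 7 0 ↔ t ≤ s.card
  coord : ∀ i < min t s.card, m.real 7 i = coord s i
  -- A row is marked in the pass after the one that found it, whence `t - 1`.
  mark : ∀ x, 0 < m.nat 5 x ↔ ∃ q < n, ∃ i < t - 1, y q = RST.coord s i ∧ x = i * n + col q

theorem runs_nextRow {s : Finset ℝ} {n t : ℕ} {m : Mem} (h0 : m.nat 0 0 = n)
    (hs : ∀ y, y ∈ s ↔ ∃ q < n, m.real 1 q = y) (ht : t ≤ s.card)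
    (hI : RowInv s n (m.real 1) (m.nat 4) t m) :
    Runs nextRow m (3 + ((n + 2) * (rowBody.maxCost + 2 + 10) + 30))
      (RowInv s n (m.real 1) (m.nat 4) (t + 1)) := by
  obtain ⟨h3, h6, -, h7, h5⟩ := hI
  rw [min_eq_left ht] at h3 h6 h7
  have hinit : Runs (.setVar 7 (.lit 0)) m 3 (fun m' => m' = m.writeNat 7 0 0) :=
    Runs.of_wp (by simp)
  refine hinit.seq fun m₁ _ e₁ => (runs_rowLoop (n := n) (t := t) ?_ ?_ ?_ ?_).seq fun m₂ hF₂ h₂ =>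
    (Runs.of_wp ?_).mono_time ?_
  · subst e₁; simpa using h0
  · subst e₁; simpa using h3
  · subst e₁; simpa using h6
  · subst e₁; simp
  · subst e₁
    simp only [real_writeNat, nat_writeNat_of_ne _ _ _ (show (5 : ℕ) ≠ 7 by decide),
      nat_writeNat_of_ne _ _ _ (show (4 : ℕ) ≠ 7 by decide)] at h₂
    obtain ⟨k1, k2, k3⟩ := h₂
    have e0 : m₂.nat 0 0 = n := by rw [hF₂.nat 0 rfl]; simpa using h0
    have e3 : m₂.nat 3 0 = t := by rw [hF₂.nat 3 rfl]; simpa using h3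
    have e6 : m₂.nat 6 0 = t * n := by rw [hF₂.nat 6 rfl]; simpa using h6
    have e7 : m₂.real 7 = m.real 7 := by rw [hF₂.real 7 rfl]; rfl
    have hlast : 0 < t → m.real 7 (t - 1) = coord s (t - 1) := fun h => h7 _ (by omega)
    have hcand : ∀ j < s.card, (t = 0 ∨ m.real 7 (t - 1) < coord s j) ↔ t ≤ j := by
      intro j hj
      constructor
      · rintro (h | h)
        · omega
        · by_contra hjt
          rw [hlast (by omega)] at h
          exact (coord_le (show j ≤ t - 1 by omega) (by omega)).not_gt h
      · intro h
        rcases Nat.eq_zero_or_pos t with h' | h'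
        · exact .inl h'
        · rw [hlast h']
          exact .inr (coord_lt (by omega) hj)
    have hmark : ∀ x, 0 < m₂.nat 5 x ↔
        ∃ q < n, ∃ i < t, m.real 1 q = coord s i ∧ x = i * n + m.nat 4 q := by
      intro x
      rw [k3, h5]
      constructor
      · rintro (⟨q, hq, i, hi, h⟩ | ⟨q, hq, h1, h2, h⟩)
        · exact ⟨q, hq, i, by omega, h⟩
        · exact ⟨q, hq, t - 1, by omega, by rw [h2, hlast (by omega)], h⟩
      · rintro ⟨q, hq, i, hi, h1, h⟩
        by_cases hit : i = t - 1
        · exact .inr ⟨q, hq, by omega, by rw [h1, hlast (by omega), hit], hit ▸ h⟩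
        · exact .inl ⟨q, hq, i, by omega, h1, h⟩
    simp only [Prog.wp, BExpr.eval, NExpr.eval, RExpr.eval, e3, e6, e0]
    refine ⟨fun hpos => ?_, fun hzero => ?_⟩
    · obtain ⟨⟨q, hq, hc, hq8⟩, hmin⟩ := k2 (by omega)
      obtain ⟨i, hi, hiq⟩ := exists_coord ((hs _).2 ⟨q, hq, rfl⟩)
      rw [← hiq, hcand i hi] at hc
      have htlt : t < s.card := by omega
      obtain ⟨q', hq', hq''⟩ := (hs _).1 (coord_mem htlt)
      have h8 : m₂.real 8 0 = coord s t := by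
        have hle := hmin q' hq' (by rw [hq'', hcand t htlt])
        rw [← hq8, ← hiq, hq''] at hle
        rw [← hq8, ← hiq]
        exact le_antisymm hle (coord_le hc hi)
      refine ⟨?_, ?_, ?_, fun j hj => ?_, fun x => ?_⟩
      · simp [e3]
        omega
      · simp [show min (t + 1) s.card = t + 1 by omega, add_mul, e6, e0]
      · simp only [nat_writeNat]
        simp
        omega
      · simp [h8, e7]
        split_ifs with h
        · rw [h]
        · exact h7 j (by omega)
      · simpa using hmark x
    · have hall := k1.1 (by simpa using hzero)
      have ht' : t = s.card := by
        by_contra hne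
        have htlt : t < s.card := by omega
        obtain ⟨q', hq', hq''⟩ := (hs _).1 (coord_mem htlt)
        exact hall q' hq' (by rw [hq'', hcand t htlt])
      refine ⟨?_, ?_, ?_, fun j hj => ?_, fun x => ?_⟩
      · rw [e3]; omega
      · rw [e6, ht']; simp
      · omega
      · rw [e7]
        exact h7 j (by omega)
      · rw [hmark, Nat.add_sub_cancel]
  · simp only [Prog.maxCost, NExpr.cost, RExpr.cost, BExpr.cost]
    omega

/-- There are `s.card + 1` passes: the last one finds no further row but marks the points of the top
row. -/
theorem runs_rows {s : Finset ℝ} {n : ℕ} {m : Mem} (h0 : m.nat 0 0 = n)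
    (hs : ∀ y, y ∈ s ↔ ∃ q < n, m.real 1 q = y) (h5 : ∀ x, m.nat 5 x = 0) :
    Runs rows m (9 + (s.card + 2) * (3 + ((n + 2) * (rowBody.maxCost + 2 + 10) + 30) + 4 + 1))
      fun m' => m'.nat 3 0 = s.card ∧ (∀ i < s.card, m'.real 7 i = coord s i) ∧
        ∀ x, 0 < m'.nat 5 x ↔
          ∃ q < n, ∃ i < s.card, m.real 1 q = coord s i ∧ x = i * n + m.nat 4 q := by
  have hinit : Runs (.seq (.setVar 3 (.lit 0)) (.seq (.setVar 6 (.lit 0)) (.setVar 7 (.lit 1)))) m 9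
      (RowInv s n (m.real 1) (m.nat 4) 0) :=
    Runs.of_wp ⟨by simp, by simp, by simp, by simp, by simp [h5]⟩
  refine hinit.seq fun m₁ hF₁ h₁ => (Runs.loop (b := .ltNat (.lit 0) (.var 7)) (c := nextRow)
    (s.card + 1) (RowInv s n (m.real 1) (m.nat 4)) h₁
    (fun t ht m₂ hF₂ h₂ => ⟨h₂.found.2 (by omega), ?_⟩) fun m₂ hF₂ h₂ => ?_).imp fun m₂ _ h₂ => ?_
  · have e1 : m₂.real 1 = m.real 1 := by rw [hF₂.real 1 rfl, hF₁.real 1 rfl]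
    have e4 : m₂.nat 4 = m.nat 4 := by rw [hF₂.nat 4 rfl, hF₁.nat 4 rfl]
    rw [← e1, ← e4] at h₂ ⊢
    exact runs_nextRow (by rw [hF₂.nat 0 rfl, hF₁.nat 0 rfl, h0]) (by rwa [e1]) (by omega) h₂
  · have := h₂.found
    simp only [BExpr.eval, NExpr.eval]
    omega
  · have hmin : min (s.card + 1) s.card = s.card := by omega
    exact ⟨by rw [h₂.num, hmin], fun i hi => h₂.coord i (by omega), fun x => by simpa using h₂.mark x⟩

theorem exists_runs_grid : ∃ K, ∀ (P : Finset Pt) (n : ℕ) (m : Mem), InputStored P n m →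
    1 ≤ n → 1 ≤ numRows P → (∀ x, m.nat 5 x = 0) →
    Runs (.seq columns rows) m (K * (n * numRows P)) (GridStored P n) := by
  refine ⟨3 + 3 * (columnBody.maxCost + 12) + (9 + 3 * (3 * (rowBody.maxCost + 12) + 38)),
    fun P n m hI hn hh h5 => ?_⟩
  have hs : ∀ y, y ∈ P.image Prod.snd ↔ ∃ q < n, m.real 1 q = y := by
    intro y
    rw [Finset.mem_image]
    constructor
    · rintro ⟨p, hp, rfl⟩
      obtain ⟨q, hq, rfl⟩ := (hI.mem p).1 hp
      exact ⟨q, hq, rfl⟩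
    · rintro ⟨q, hq, rfl⟩
      exact ⟨_, (hI.mem _).2 ⟨q, hq, rfl⟩, rfl⟩
  refine ((runs_columns hI).seq fun m₁ hF₁ h₁ => (runs_rows (s := P.image Prod.snd) (n := n)
    ?_ ?_ ?_).imp fun m₂ hF₂ h₂ => ?_).mono_time ?_
  · rw [hF₁.nat 0 rfl, hI.num]
  · rw [hF₁.real 1 rfl]
    exact hs
  · rw [hF₁.nat 5 rfl]
    exact h5
  · obtain ⟨hv, hx, hcol⟩ := h₁
    obtain ⟨hr, hy, hmark⟩ := h₂
    -- The stride `n` is at least the number of columns, so different grid vertices have different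
    -- addresses.
    have hvn : numCols P ≤ n := by
      have h1 : P.image Prod.fst ⊆ (Finset.range n).image (m.real 0) := by
        intro x hx
        obtain ⟨p, hp, rfl⟩ := Finset.mem_image.1 hx
        obtain ⟨q, hq, rfl⟩ := (hI.mem p).1 hp
        exact Finset.mem_image.2 ⟨q, Finset.mem_range.2 hq, rfl⟩
      simpa [numCols] using (Finset.card_le_card h1).trans Finset.card_image_le
    refine ⟨by rw [hF₂.nat 0 rfl, hF₁.nat 0 rfl, hI.num], by rw [hF₂.nat 2 rfl, hv], hr,
      fun j hj => by rw [hF₂.real 6 rfl, hx j hj], hy, fun i hi j hj => ?_⟩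
    rw [hmark, hI.mem, hF₁.real 1 rfl]
    refine exists_congr fun q => and_congr_right fun hq => ?_
    rw [gridPt_eq, Prod.mk.injEq, (hcol q hq).2]
    constructor
    · rintro ⟨i', hi', h1, h2⟩
      obtain ⟨rfl, rfl⟩ := address_inj (hj.trans_le hvn) ((hcol q hq).1.trans_le hvn) h2
      exact ⟨rfl, h1⟩
    · rintro ⟨h1, h2⟩
      exact ⟨i, hi, h2, by rw [coord_inj (hcol q hq).1 hj h1]⟩
  · have h1 : n ≤ n * numRows P := Nat.le_mul_of_pos_right n hh
    have h2 : 1 ≤ n * numRows P := Nat.mul_pos hn hh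
    have h3 : (n + 2) * (columnBody.maxCost + 2 + 10) ≤
        3 * (columnBody.maxCost + 12) * (n * numRows P) := by
      calc _ ≤ (3 * n) * (columnBody.maxCost + 12) := Nat.mul_le_mul (by omega) (by omega)
        _ = 3 * (columnBody.maxCost + 12) * n := by ring
        _ ≤ _ := Nat.mul_le_mul_left _ h1
    have h4 : 3 + ((n + 2) * (rowBody.maxCost + 2 + 10) + 30) + 4 + 1 ≤
        (3 * (rowBody.maxCost + 12) + 38) * n := by nlinarith
    have h5 : (numRows P + 2) * (3 + ((n + 2) * (rowBody.maxCost + 2 + 10) + 30) + 4 + 1) ≤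
        3 * (3 * (rowBody.maxCost + 12) + 38) * (n * numRows P) := by
      calc _ ≤ (3 * numRows P) * ((3 * (rowBody.maxCost + 12) + 38) * n) :=
            Nat.mul_le_mul (by omega) h4
        _ = _ := by ring
    rw [show (P.image Prod.snd).card = numRows P from rfl]
    refine (Nat.add_le_add (Nat.add_le_add_left h3 3) (Nat.add_le_add_left h5 9)).trans ?_
    have h6 : ∀ A B X : ℕ, 1 ≤ X → 3 + A * X + (9 + B * X) ≤ (3 + A + (9 + B)) * X :=
      fun A B X hX => by nlinarith
    exact h6 _ _ _ h2

/-! ### The whole program -/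

/-- Finds the edges of a shortest tree if there are any grid edges. -/
def solve : Prog :=
  .seq powers <| .seq tables <| .seq finalLayer <| .seq dynamicProgram trace

/-- Computes a shortest rectilinear Steiner tree. -/
def steinerProg : Prog :=
  .seq (.seq columns rows) <| .seq edgeList <| .ite (.ltNat (.lit 0) (.var 11)) solve .skip

theorem lastLayer_le (P : Finset Pt) : lastLayer P ≤ 2 * (numCols P * numRows P) := by
  unfold lastLayer gridEdges
  rw [List.length_flatMap]
  refine (List.sum_le_card_nsmul _ (2 * numRows P) ?_).trans (by simp; ring_nf; rfl)
  intro x hx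
  obtain ⟨j, -, rfl⟩ := List.mem_map.1 hx
  split_ifs <;> simp <;> omega

/-- The output is the list of the edges of a shortest connecting set. -/
def OutputsMinConnecting (P : Finset Pt) (m : Mem) : Prop :=
  ∃ l : List GridEdge, l.Sublist (gridEdges (numRows P) (numCols P)) ∧
    IsMinConnecting P l.toFinset ∧ outputEdges m = l.map (GridEdge.seg P)

theorem OutputsMinConnecting.correct {P : Finset Pt} {m : Mem} (hP : P.Nonempty)
    (h : OutputsMinConnecting P m) : (outputEdges m).Nodup ∧
      IsShortestSteinerTree P (outputGraph P m) ∧ InHananGrid P (outputGraph P m) := by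
  obtain ⟨l, hl, hmin, hout⟩ := h
  have hG : outputGraph P m = graphOf P (l.toFinset.image (GridEdge.seg P)) := by
    have : (outputEdges m).toFinset = l.toFinset.image (GridEdge.seg P) := by
      rw [hout]
      ext s
      simp
    unfold outputGraph graphOf
    rw [this]
  refine ⟨?_, ?_, ?_⟩
  · rw [hout]
    exact List.Nodup.map_on (fun a ha b hb hab => seg_injOn P (hl.subset ha) (hl.subset hb) hab)
      ((nodup_gridEdges _ _).sublist hl)
  · rw [hG]
    exact hmin.isShortestSteinerTree hP
  · rw [hG]
    exact inHananGrid_graphOf hmin.mem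

theorem exists_isBest {P : Finset Pt} (hP : P.Nonempty) (hL : 1 ≤ lastLayer P) :
    ∃ bs, IsBest P (gridEdges (numRows P) (numCols P)) ∅ bs := by
  obtain ⟨S, hS⟩ := exists_isMinConnecting P
  obtain ⟨bs, h1, h2⟩ := accepts_of_isMinConnecting hP (List.ne_nil_of_length_pos hL) hS
  refine ⟨bs, h1, fun bs' h' => ?_⟩
  rw [h2, ← sum_chosen (nodup_gridEdges _ _)]
  exact hS.le _ (isConnecting_of_accepts hP h')

/-- With `N = 5 ^ h` and `L ≤ 2 * v * h` edges, the stages cost `O(h)` for the powers, `O(h * h *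
N)` for the tables, `O(N * h)` for the last layer, `O(L * N)` for the other layers and `O(L)` for
the trace. Each is `O(n * h * N)` because `h ≤ n` and `v ≤ n`. -/
theorem exists_runs_solve : ∃ K, ∀ (P : Finset Pt) (n : ℕ) (m : Mem), P.Nonempty →
    GridStored P n m → EdgesStored P (gridEdges (numRows P) (numCols P)) m → m.nat 1 0 = 0 →
    1 ≤ lastLayer P → numRows P ≤ n → numCols P ≤ n →
    Runs solve m (K * (n * numRows P * 5 ^ numRows P)) (OutputsMinConnecting P) := by
  obtain ⟨K₁, hK₁⟩ := exists_runs_tables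
  obtain ⟨K₂, hK₂⟩ := exists_runs_finalLayer
  obtain ⟨K₃, hK₃⟩ := exists_runs_dynamicProgram
  refine ⟨600 + K₁ + K₂ + 2 * K₃ + 3 + 4 * (traceBody.maxCost + 12),
    fun P n m hP hG hE h1 hL hhn hvn => ?_⟩
  have hh : 1 ≤ numRows P := Finset.card_pos.2 (hP.image _)
  have hv : 1 ≤ numCols P := Finset.card_pos.2 (hP.image _)
  have htables : ∀ m₁ m₂ m₃ : Mem, powers.Frame m m₁ → tables.Frame m₁ m₂ → finalLayer.Frame m₂ m₃ →
      m₁.nat 17 0 = 5 ^ numRows P → (∀ k < numRows P, m₁.nat 15 k = k * 5 ^ numRows P) →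
      (∀ i < numRows P, ∀ ω ∈ stateSpace (numRows P),
        TableEntry (numRows P) ω i (i * 5 ^ numRows P + code (numRows P) ω) m₂) →
      TablesStored P m₃ := by
    intro m₁ m₂ m₃ hF₁ hF₂ hF₃ p1 p3 h₂
    refine ⟨by rw [hF₃.nat 17 rfl, hF₂.nat 17 rfl, p1],
      by rw [hF₃.nat 15 rfl, hF₂.nat 15 rfl]; exact p3, fun i hi ω hω => ?_,
      hE.congr (fun a ha => ?_) (fun a ha => ?_)⟩
    · exact (h₂ i hi ω hω).congr (by rw [hF₃.nat 33 rfl]) (by rw [hF₃.nat 34 rfl])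
        (by rw [hF₃.nat 35 rfl]) (by rw [hF₃.nat 36 rfl])
    · rw [hF₃.nat a (by fin_cases ha <;> rfl), hF₂.nat a (by fin_cases ha <;> rfl),
        hF₁.nat a (by fin_cases ha <;> rfl)]
    · rw [hF₃.real a (by fin_cases ha <;> rfl), hF₂.real a (by fin_cases ha <;> rfl),
        hF₁.real a (by fin_cases ha <;> rfl)]
  refine ((runs_powers hG.rows).seq fun m₁ hF₁ ⟨p1, p2, p3⟩ =>
    (hK₁ (numRows P) m₁ hh ?_ p1 p2 p3).seq fun m₂ hF₂ h₂ =>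
    (hK₂ P n m₂ ?_ hv hh ?_ ?_).seq fun m₃ hF₃ h₃ => (hK₃ P m₃ ?_ hL h₃).seq fun m₄ hF₄ h₄ =>
    (runs_trace ?_ h₄.2 ?_ h₄.1 (exists_isBest hP hL)).imp ?_).mono_time ?_
  · rw [hF₁.nat 3 rfl, hG.rows]
  · refine hG.congr (fun a ha => ?_) (fun a ha => ?_)
    · rw [hF₂.nat a (by fin_cases ha <;> rfl), hF₁.nat a (by fin_cases ha <;> rfl)]
    · rw [hF₂.real a (by fin_cases ha <;> rfl), hF₁.real a (by fin_cases ha <;> rfl)]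
  · intro k hk
    rw [hF₂.nat 18 rfl, p2 k hk]
  · rw [hF₂.nat 17 rfl, p1]
  · exact htables m₁ m₂ m₃ hF₁ hF₂ hF₃ p1 p3 h₂
  · exact (htables m₁ m₂ m₃ hF₁ hF₂ hF₃ p1 p3 h₂).congr
      (fun a ha => hF₄.nat a (by fin_cases ha <;> rfl))
      (fun a ha => hF₄.real a (by fin_cases ha <;> rfl))
  · rw [hF₄.nat 1 rfl, hF₃.nat 1 rfl, hF₂.nat 1 rfl, hF₁.nat 1 rfl, h1]
  · rintro m' - ⟨bs, hbs, hout⟩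
    exact ⟨_, chosen_sublist _ _, isMinConnecting_of_accepts hP hbs.1 hbs.2, hout⟩
  · have hX := lastLayer_le P
    have h5 : 1 ≤ 5 ^ numRows P := Nat.one_le_pow _ _ (by decide)
    generalize 5 ^ numRows P = N at *
    generalize numRows P = h at *
    generalize numCols P = v at *
    generalize lastLayer P = L at *
    generalize traceBody.maxCost = T
    have hn : 1 ≤ n := hh.trans hhn
    have hhX : h ≤ n * h * N :=
      (Nat.le_mul_of_pos_left h hn).trans (Nat.le_mul_of_pos_right _ h5)
    have hLX : L ≤ 2 * (n * h) := hX.trans (Nat.mul_le_mul_left 2 (Nat.mul_le_mul_right h hvn))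
    have t1 : h * (N * h) ≤ n * h * N := by
      rw [mul_comm N h, ← mul_assoc]
      exact Nat.mul_le_mul_right N (Nat.mul_le_mul_right h hhn)
    have t2 : N * h ≤ n * h * N := by
      rw [mul_comm N h]
      exact Nat.mul_le_mul_right N (Nat.le_mul_of_pos_left h hn)
    have t3 : L * N ≤ 2 * (n * h * N) := by
      rw [← mul_assoc]
      exact Nat.mul_le_mul_right N hLX
    have t4 : L + 2 ≤ 4 * (n * h * N) := by
      have := Nat.le_mul_of_pos_right (n * h) h5
      have h6 : 1 ≤ n * h := Nat.mul_pos hn hh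
      omega
    generalize n * h * N = X at *
    have s1 := Nat.mul_le_mul_left K₁ t1
    have s2 := Nat.mul_le_mul_left K₂ t2
    have s3 := Nat.mul_le_mul_left K₃ t3
    have s4 := Nat.mul_le_mul_right (T + 2 + 10) t4
    nlinarith

theorem exists_runs_steinerProg : ∃ K, ∀ (P : Finset Pt) (n : ℕ) (m : Mem), P.Nonempty →
    InputStored P n m → numRows P ≤ n → numCols P ≤ n → (∀ x, m.nat 5 x = 0) → m.nat 1 0 = 0 →
    Runs steinerProg m (K * (n * numRows P * 5 ^ numRows P)) (OutputsMinConnecting P) := by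
  obtain ⟨K₁, hK₁⟩ := exists_runs_grid
  obtain ⟨K₂, hK₂⟩ := exists_runs_edgeList
  obtain ⟨K₃, hK₃⟩ := exists_runs_solve
  refine ⟨K₁ + K₂ + (6 + K₃), fun P n m hP hI hhn hvn h5 h1 => ?_⟩
  have hh : 1 ≤ numRows P := Finset.card_pos.2 (hP.image _)
  have hv : 1 ≤ numCols P := Finset.card_pos.2 (hP.image _)
  have hn : 1 ≤ n := hh.trans hhn
  have h5' : 1 ≤ 5 ^ numRows P := Nat.one_le_pow _ _ (by decide)
  have hX : 1 ≤ n * numRows P * 5 ^ numRows P := Nat.mul_pos (Nat.mul_pos hn hh) h5'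
  have hnh : n * numRows P ≤ n * numRows P * 5 ^ numRows P := Nat.le_mul_of_pos_right _ h5'
  refine ((hK₁ P n m hI hn hh h5).seq fun m₁ hF₁ hG => (hK₂ P n m₁ hG hv hh).seq
    (T' := 4 + 1 + (1 + K₃ * (n * numRows P * 5 ^ numRows P))) fun m₂ hF₂ hE => ?_).mono_time ?_
  · have h11 : m₂.nat 11 0 = lastLayer P := hE.length
    have h1' : m₂.nat 1 0 = 0 := by rw [hF₂.nat 1 rfl, hF₁.nat 1 rfl, h1]
    by_cases hL : 0 < lastLayer P
    · refine Runs.iteTrue (b := .ltNat (.lit 0) (.var 11)) (by simpa [h11] using hL)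
        ((hK₃ P n m₂ hP ?_ hE h1' hL hhn hvn).mono_time (by omega))
      exact hG.congr (fun a ha => hF₂.nat a (by fin_cases ha <;> rfl))
        (fun a ha => hF₂.real a (by fin_cases ha <;> rfl))
    -- Without grid edges `P` is a single point, and the empty output is the tree.
    · refine Runs.iteFalse (b := .ltNat (.lit 0) (.var 11)) (by simpa [h11] using hL)
        ((Runs.of_wp (c := .skip) ?_).mono_time (Nat.le_add_right 1 _))
      have hnil : gridEdges (numRows P) (numCols P) = [] :=
        List.eq_nil_of_length_eq_zero (Nat.eq_zero_of_not_pos hL)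
      exact ⟨[], List.nil_sublist _, isMinConnecting_empty hnil, by simp [outputEdges, h1']⟩
  · have s1 := Nat.mul_le_mul_left K₁ hnh
    have s2 := Nat.mul_le_mul_left K₂ ((Nat.mul_le_mul_right (numRows P) hvn).trans hnh)
    rw [add_mul, add_mul, add_mul]
    omega

theorem inputStored_inputMem {n : ℕ} {p : Fin n → Pt} (hp : Monotone fun k => (p k).1) :
    InputStored (Finset.univ.image p) n (inputMem p) := by
  have h0 : ∀ k (hk : k < n), (inputMem p).real 0 k = (p ⟨k, hk⟩).1 := fun k hk => by
    simp [inputMem, hk]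
  have h1 : ∀ k (hk : k < n), (inputMem p).real 1 k = (p ⟨k, hk⟩).2 := fun k hk => by
    simp [inputMem, hk]
  refine ⟨by simp [inputMem], fun x => ?_, fun k hk q hq => ?_⟩
  · simp only [Finset.mem_image, Finset.mem_univ, true_and]
    constructor
    · rintro ⟨k, rfl⟩
      exact ⟨k, k.2, by rw [h0 k k.2, h1 k k.2]⟩
    · rintro ⟨k, hk, rfl⟩
      exact ⟨⟨k, hk⟩, by rw [h0 k hk, h1 k hk]⟩
  · rw [h0 k hk, h0 q (hq.trans_lt hk)]
    exact hp hq

/-- A shortest rectilinear Steiner tree is computed in time `O(n h 5 ^ h)`. -/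
theorem exists_program : ∃ (prog : Prog) (C : ℕ), ∀ (n : ℕ) (p : Fin n → Pt), 1 ≤ n →
    Function.Injective p → Monotone (fun k => (p k).1) → ∃ (m : Mem) (t : ℕ),
      Exec prog (inputMem p) m t ∧
      t ≤ C * (n * numRows (Finset.univ.image p) * 5 ^ numRows (Finset.univ.image p)) ∧
      (outputEdges m).Nodup ∧
      IsShortestSteinerTree (Finset.univ.image p) (outputGraph (Finset.univ.image p) m) ∧
      InHananGrid (Finset.univ.image p) (outputGraph (Finset.univ.image p) m) := by
  obtain ⟨K, hK⟩ := exists_runs_steinerProg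
  refine ⟨steinerProg, K, fun n p hn _ hmono => ?_⟩
  have hP : (Finset.univ.image p).Nonempty := ⟨p ⟨0, hn⟩, by simp⟩
  have hcard : (Finset.univ.image p).card ≤ n := by
    simpa using Finset.card_image_le (s := Finset.univ) (f := p)
  obtain ⟨m, t, h1, h2, h3⟩ := hK (Finset.univ.image p) n (inputMem p) hP
    (inputStored_inputMem hmono) (Finset.card_image_le.trans hcard)
    (Finset.card_image_le.trans hcard) (fun x => by simp [inputMem]) (by simp [inputMem])
  exact ⟨m, t, h1, h2, h3.correct hP⟩

end RST

end

theorem mainTheorem2 :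
    -- a shortest rectilinear Steiner tree is computed in time `O(n h 5 ^ h)`
    (∃ (prog : RST.Prog) (C : ℕ), ∀ (n : ℕ) (p : Fin n → RST.Pt), 1 ≤ n →
      Function.Injective p → Monotone (fun k => (p k).1) →
        ∃ (m : RST.Mem) (t : ℕ),
          RST.Exec prog (RST.inputMem p) m t ∧
          t ≤ C * (n * RST.numRows (Finset.univ.image p) *
            5 ^ RST.numRows (Finset.univ.image p)) ∧
          (RST.outputEdges m).Nodup ∧
          RST.IsShortestSteinerTree (Finset.univ.image p)
            (RST.outputGraph (Finset.univ.image p) m) ∧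
          RST.InHananGrid (Finset.univ.image p) (RST.outputGraph (Finset.univ.image p) m)) ∧
    -- the frontier dynamic program on the Hanan grid finds the length of a shortest tree
    (∀ P : Finset RST.Pt, P.Nonempty →
      ∃ T : RST.PlaneGraph, RST.IsShortestSteinerTree P T ∧ RST.InHananGrid P T ∧
        RST.dpValue P = (T.length : WithTop ℝ)) ∧
    -- the states of each layer are non-crossing partitions with zero-degree vertices
    (∀ P : Finset RST.Pt, P.Nonempty → ∀ l ≤ RST.lastLayer P,
      RST.layer P l ⊆ RST.stateSpace (RST.numRows P)) ∧
    -- and there are `O(5 ^ h)` such states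
    (∃ C : ℕ, ∀ h : ℕ, (RST.stateSpace h).card ≤ C * 5 ^ h) := by
  refine ⟨RST.exists_program, fun P hP => RST.exists_shortest_in_grid hP,
    fun P _ l _ => RST.layer_subset_stateSpace P l,
    1, fun h => by simpa using RST.card_stateSpace_le h⟩
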